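/- Let $d\ge 2$ and let $\phi:\mathbb R^d\to\mathbb R$ satisfy (H1) $\int_{\mathbb R^d} e^{-\phi}\,dx=1$ and $\int_{\mathbb R^d} x\,e^{-\phi}\,dx=0$ (the latter integral being absolutely convergent); (H2) $\phi\in C^2(\mathbb R^d)$ and for every $\varepsilon>0$ there is a constant $C_\varepsilon$ with $|D^2\phi(x)|\le\varepsilon|\nabla\phi(x)|^2+C_\varepsilon$ for all $x$, where $|D^2\phi|$ is the Euclidean (Frobenius) norm of the Hessian. Let $L^2=L^2(\mathbb R^d,e^{-\phi}dx)$ (real-valued functions) with norm $\|\cdot\|$ and scalar product $(\cdot,\cdot)$; for vector- or matrix-valued $g$, $\|g\|^2$ is the sum of the squared norms of the entries. Put $\lfloor\nabla\phi\rceil=\sqrt{1+|\nabla\phi|^2}$, and let $\Lambda$, with domain $\mathcal D(\Lambda)$, be the closure in $L^2$ of the operator $f\mapsto-\Delta f+\nabla\phi\cdot\nabla f+f$ defined on $C_c^\infty(\mathbb R^d)$. Derivatives of functions in $L^2$ are taken in the sense of distributions. (1) $\Lambda$ is self-adjoint, $\Lambda:\mathcal D(\Lambda)\to L^2$ is bijective,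 and $$\mathcal D(\Lambda)=\Big\{f\in L^2:\ \big\|\lfloor\nabla\phi\rceil^2f\big\|+\big\|\lfloor\nabla\phi\rceil\nabla f\big\|+\big\|D^2f\big\|<\infty\Big\}.$$ Moreover there are constants $C_\phi>8$ and $C_\phi'>C_\phi$ such that for all $x\in\mathbb R^d$ $$4\sqrt d\,|D^2\phi(x)|\le|\nabla\phi(x)|^2+C_\phi-1\quad\text{and}\quad 4\,|D^2\phi(x)|\le C_\phi^{-1/2}\big(|\nabla\phi(x)|^2+C_\phi'\big).\qquad(*)$$ (2) For all real numbers $8<C_\phi<C_\phi'$ there is a constant $C_B>0$, depending only on $C_\phi$, $C_\phi'$ and $d$, such that, for every $\phi$ satisfying (H1), (H2) and $(*)$ with these constants and every $f\in L^2$, $$\big\|D^2\Lambda^{-1}f\big\|^2+\big\|\lfloor\nabla\phi\rceil\,\nabla\Lambda^{-1}f\big\|^2+\big\|\lfloor\nabla\phi\rceil^2\Lambda^{-1}f\big\|^2\le C_B\|f\|^2,\qquad(a)$$ $$\big\|\Lambda^{-1}D^2f\big\|^2+\big\|\Lambda^{-1}\lfloor\nabla\phi\rceil\,\nabla f\big\|^2+\big\|\Lambda^{-1}\lfloor\nabla\phi\rceil^2f\big\|^2\le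 C_B\|f\|^2.\qquad(b)$$ In (b), $\Lambda^{-1}$ acts entry by entry and is extended by duality: for a distribution $T$, $\Lambda^{-1}T$ is the unique $h\in L^2$ with $(h,\Lambda\psi)=\langle T,\psi e^{-\phi}\rangle$ for all $\psi\in C_c^\infty(\mathbb R^d)$; the existence and uniqueness of $h$ for each entry $T$ of $D^2f$, of $\lfloor\nabla\phi\rceil\nabla f$ and for $T=\lfloor\nabla\phi\rceil^2f$ is part of the claim. Furthermore (a) holds with the explicit constant $$81\,\frac{C_\phi'^2}{C_\phi}+196\,C_\phi'^2+K+\frac12\Big(d+\sqrt{d^2+4dK}\Big),\qquad K=\frac{277}{8}\,(C_\phi-1)\,C_\phi'^2.$$ -/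

import Mathlib

open MeasureTheory
open scoped ENNReal ContDiff

noncomputable section

namespace WittenToolbox

/-- The space `ℝ^d` with its Euclidean norm. -/
abbrev Sp (d : ℕ) : Type := EuclideanSpace ℝ (Fin d)

/-- The classical partial derivative `∂_i g`. -/
def pd {d : ℕ} (i : Fin d) (g : Sp d → ℝ) (x : Sp d) : ℝ :=
  fderiv ℝ g x (EuclideanSpace.single i 1)

/-- The Euclidean (Frobenius) norm `|D²g(x)|` of the Hessian matrix. -/
def hessNorm {d : ℕ} (g : Sp d → ℝ) (x : Sp d) : ℝ :=
  Real.sqrt (∑ i, ∑ j, (pd i (pd j g) x) ^ 2)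

/-- The weight `⌊∇φ⌉ = √(1 + |∇φ|²)`. -/
def wgt {d : ℕ} (φ : Sp d → ℝ) (x : Sp d) : ℝ :=
  Real.sqrt (1 + ‖gradient φ x‖ ^ 2)

/-- The measure `e^{-φ} dx`. -/
def gibbs {d : ℕ} (φ : Sp d → ℝ) : Measure (Sp d) :=
  volume.withDensity (fun x => ENNReal.ofReal (Real.exp (-φ x)))

/-- Real `L²(e^{-φ} dx)`. -/
abbrev L2 {d : ℕ} (φ : Sp d → ℝ) : Type := Lp ℝ 2 (gibbs φ)

/-- `e^{-φ} dx` is a centred probability measure. -/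
def IsCentredProb {d : ℕ} (φ : Sp d → ℝ) : Prop :=
  (∫ x, Real.exp (-φ x)) = 1 ∧
    Integrable (fun x : Sp d => Real.exp (-φ x) • x) ∧
    (∫ x : Sp d, Real.exp (-φ x) • x) = 0

/-- `φ` is `C²` and `|D²φ|` is infinitesimally bounded by `|∇φ|²`. -/
def IsRegular {d : ℕ} (φ : Sp d → ℝ) : Prop :=
  ContDiff ℝ 2 φ ∧
    ∀ ε : ℝ, 0 < ε → ∃ Cε : ℝ, ∀ x, hessNorm φ x ≤ ε * ‖gradient φ x‖ ^ 2 + Cε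

/-- The two pointwise inequalities that define the structural constants `C_φ`, `C_φ'`. -/
def HasConstants {d : ℕ} (φ : Sp d → ℝ) (C C' : ℝ) : Prop :=
  ∀ x, 4 * Real.sqrt d * hessNorm φ x ≤ ‖gradient φ x‖ ^ 2 + C - 1 ∧
    4 * hessNorm φ x ≤ (Real.sqrt C)⁻¹ * (‖gradient φ x‖ ^ 2 + C')

/-- Smooth functions with compact support. -/
def IsTest {d : ℕ} (ψ : Sp d → ℝ) : Prop :=
  ContDiff ℝ ∞ ψ ∧ HasCompactSupport ψ

/-- The differential expression `-Δψ + ∇φ·∇ψ + ψ`. -/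
def diffOp {d : ℕ} (φ ψ : Sp d → ℝ) (x : Sp d) : ℝ :=
  -Laplacian.laplacian ψ x + inner ℝ (gradient φ x) (gradient ψ x) + ψ x

theorem IsTest.contDiffAt {d : ℕ} {ψ : Sp d → ℝ} (h : IsTest ψ) (x : Sp d) :
    ContDiffAt ℝ 2 ψ x :=
  (h.1.of_le (WithTop.coe_le_coe.2 le_top)).contDiffAt

theorem IsTest.differentiableAt {d : ℕ} {ψ : Sp d → ℝ} (h : IsTest ψ) (x : Sp d) :
    DifferentiableAt ℝ ψ x :=
  (h.contDiffAt x).differentiableAt (by norm_num)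

theorem diffOp_add {d : ℕ} (φ : Sp d → ℝ) {ψ χ : Sp d → ℝ} (hψ : IsTest ψ) (hχ : IsTest χ)
    (x : Sp d) : diffOp φ (ψ + χ) x = diffOp φ ψ x + diffOp φ χ x := by
  have h1 := (hψ.contDiffAt x).laplacian_add (hχ.contDiffAt x)
  have h2 : gradient (ψ + χ) x = gradient ψ x + gradient χ x := by
    unfold gradient
    rw [fderiv_add (hψ.differentiableAt x) (hχ.differentiableAt x), map_add]
  simp only [diffOp, h1, h2, inner_add_right, Pi.add_apply]
  ring

theorem diffOp_smul {d : ℕ} (φ : Sp d → ℝ) (c : ℝ) {ψ : Sp d → ℝ} (hψ : IsTest ψ)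
    (x : Sp d) : diffOp φ (c • ψ) x = c * diffOp φ ψ x := by
  have h1 := InnerProductSpace.laplacian_smul c (hψ.contDiffAt x)
  have h2 : gradient (c • ψ) x = c • gradient ψ x := by
    unfold gradient
    rw [fderiv_const_smul (hψ.differentiableAt x)]
    simp
  simp only [diffOp, h1, h2, inner_smul_right, Pi.smul_apply, smul_eq_mul]
  ring

/-- The graph in `L² × L²` of `-Δ + ∇φ·∇ + 1` on smooth functions with compact support. -/
def minimalGraph {d : ℕ} (φ : Sp d → ℝ) : Submodule ℝ (L2 φ × L2 φ) where
  carrier := {p | ∃ ψ : Sp d → ℝ, IsTest ψ ∧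
    (p.1 : Sp d → ℝ) =ᵐ[gibbs φ] ψ ∧ (p.2 : Sp d → ℝ) =ᵐ[gibbs φ] diffOp φ ψ}
  add_mem' := by
    rintro p q ⟨ψ, hψ, h1, h2⟩ ⟨χ, hχ, k1, k2⟩
    refine ⟨ψ + χ, ⟨hψ.1.add hχ.1, hψ.2.add hχ.2⟩, ?_, ?_⟩
    · filter_upwards [Lp.coeFn_add p.1 q.1, h1, k1] with x hx a b
      simp only [Prod.fst_add, hx, Pi.add_apply, a, b]
    · filter_upwards [Lp.coeFn_add p.2 q.2, h2, k2] with x hx a b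
      simp only [Prod.snd_add, hx, Pi.add_apply, a, b, diffOp_add φ hψ hχ]
  zero_mem' := by
    have h0 : IsTest (0 : Sp d → ℝ) := ⟨contDiff_const, HasCompactSupport.zero⟩
    refine ⟨0, h0, Lp.coeFn_zero ℝ 2 (gibbs φ), ?_⟩
    filter_upwards [Lp.coeFn_zero ℝ 2 (gibbs φ)] with x hx
    have := diffOp_smul φ 0 h0 x
    simp only [smul_zero, zero_mul] at this
    rw [this]
    exact hx
  smul_mem' := by
    rintro c p ⟨ψ, hψ, h1, h2⟩
    refine ⟨c • ψ, ⟨hψ.1.const_smul c, hψ.2.smul_left (f := fun _ => c)⟩, ?_, ?_⟩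
    · filter_upwards [Lp.coeFn_smul c p.1, h1] with x hx a
      simp only [Prod.smul_fst, hx, Pi.smul_apply, a]
    · filter_upwards [Lp.coeFn_smul c p.2, h2] with x hx a
      simp only [Prod.smul_snd, hx, Pi.smul_apply, a, diffOp_smul φ c hψ, smul_eq_mul]

/-- `Λ = -Δ_φ + Id`: the closure in `L²(e^{-φ} dx)` of `-Δ + ∇φ·∇ + 1` with domain `C_c^∞`.
(An essentially self-adjoint operator has its closure as unique self-adjoint extension.) -/
def Lam {d : ℕ} (φ : Sp d → ℝ) : L2 φ →ₗ.[ℝ] L2 φ :=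
  (minimalGraph φ).toLinearPMap.closure

/-- `Λ⁻¹ : L² → D(Λ) ⊆ L²`, the inverse function of `Λ : D(Λ) → L²`
(meaningful when `Λ` is bijective). -/
def LamInv {d : ℕ} (φ : Sp d → ℝ) (f : L2 φ) : L2 φ :=
  ((Function.invFun (fun u : (Lam φ).domain => Lam φ u) f : (Lam φ).domain) : L2 φ)

/-- `g` is the weak (distributional) partial derivative `∂_i f` on `ℝ^d`. -/
def HasWeakPartial {d : ℕ} (i : Fin d) (f g : Sp d → ℝ) : Prop :=
  LocallyIntegrable f volume ∧ LocallyIntegrable g volume ∧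
    ∀ ψ : Sp d → ℝ, IsTest ψ → (∫ x, f x * pd i ψ x) = -∫ x, g x * ψ x

/-- `G` is the weak gradient of `f` and `H` its weak Hessian. -/
def HasWeakDerivs {d : ℕ} (f : Sp d → ℝ) (G : Fin d → Sp d → ℝ)
    (H : Fin d → Fin d → Sp d → ℝ) : Prop :=
  (∀ j, HasWeakPartial j f (G j)) ∧ ∀ i j, HasWeakPartial i (G j) (H i j)

/-- `‖g‖² = ∫ |g|² e^{-φ} dx`, with values in `[0, ∞]`. -/
def sqNorm {d : ℕ} (φ g : Sp d → ℝ) : ℝ≥0∞ :=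
  ∫⁻ x, ‖g x‖ₑ ^ 2 ∂(gibbs φ)

/-- `‖H‖² + ‖⌊∇φ⌉ G‖² + ‖⌊∇φ⌉² f‖²`, with values in `[0, ∞]`. -/
def toolboxSq {d : ℕ} (φ f : Sp d → ℝ) (G : Fin d → Sp d → ℝ)
    (H : Fin d → Fin d → Sp d → ℝ) : ℝ≥0∞ :=
  (∑ i, ∑ j, sqNorm φ (H i j)) + (∑ j, sqNorm φ (fun x => wgt φ x * G j x)) +
    sqNorm φ (fun x => wgt φ x ^ 2 * f x)

/-- The estimate `‖D²Λ⁻¹f‖² + ‖⌊∇φ⌉∇Λ⁻¹f‖² + ‖⌊∇φ⌉²Λ⁻¹f‖² ≤ B ‖f‖²` for all `f ∈ L²`. -/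
def ToolboxEstimate {d : ℕ} (φ : Sp d → ℝ) (B : ℝ) : Prop :=
  ∀ f : L2 φ, ∃ G H, HasWeakDerivs (LamInv φ f) G H ∧
    toolboxSq φ (LamInv φ f) G H ≤ ENNReal.ofReal (B * ‖f‖ ^ 2)

/-- The distribution `∂_i ∂_j f`, paired with `ψ` through `e^{-φ} dx`:
`⟨∂_i ∂_j f, ψ e^{-φ}⟩ = ∫ f ∂_i ∂_j (ψ e^{-φ}) dx`. -/
def pairHess {d : ℕ} (φ : Sp d → ℝ) (i j : Fin d) (f ψ : Sp d → ℝ) : ℝ :=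
  ∫ x, f x * pd i (pd j (fun y => ψ y * Real.exp (-φ y))) x

/-- The distribution `⌊∇φ⌉ ∂_i f`, paired with `ψ` through `e^{-φ} dx`:
`⟨⌊∇φ⌉ ∂_i f, ψ e^{-φ}⟩ = - ∫ f ∂_i (⌊∇φ⌉ ψ e^{-φ}) dx`. -/
def pairGrad {d : ℕ} (φ : Sp d → ℝ) (i : Fin d) (f ψ : Sp d → ℝ) : ℝ :=
  -∫ x, f x * pd i (fun y => wgt φ y * ψ y * Real.exp (-φ y)) x

/-- The function `⌊∇φ⌉² f`, paired with `ψ` through `e^{-φ} dx`. -/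
def pairWgt {d : ℕ} (φ : Sp d → ℝ) (f ψ : Sp d → ℝ) : ℝ :=
  ∫ x, wgt φ x ^ 2 * f x * ψ x ∂(gibbs φ)

/-- `h = Λ⁻¹ T` for a distribution `T`, where `Λ⁻¹` is extended by duality:
`h ∈ L²` and `(h, Λψ) = T(ψ)` for every test function `ψ`. -/
def IsLamInvDist {d : ℕ} (φ : Sp d → ℝ) (T : (Sp d → ℝ) → ℝ) (h : L2 φ) : Prop :=
  ∀ ψ : Sp d → ℝ, IsTest ψ → (∫ x, h x * diffOp φ ψ x ∂(gibbs φ)) = T ψ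

/-- For all `f ∈ L²`, the objects `Λ⁻¹D²f`, `Λ⁻¹⌊∇φ⌉∇f`, `Λ⁻¹⌊∇φ⌉²f` exist in `L²`, are
unique, and `‖Λ⁻¹D²f‖² + ‖Λ⁻¹⌊∇φ⌉∇f‖² + ‖Λ⁻¹⌊∇φ⌉²f‖² ≤ B ‖f‖²`. -/
def DualEstimate {d : ℕ} (φ : Sp d → ℝ) (B : ℝ) : Prop :=
  ∀ f : L2 φ, ∃ (a : Fin d → Fin d → L2 φ) (b : Fin d → L2 φ) (c : L2 φ),
    (∀ i j h, IsLamInvDist φ (pairHess φ i j f) h ↔ h = a i j) ∧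
    (∀ i h, IsLamInvDist φ (pairGrad φ i f) h ↔ h = b i) ∧
    (∀ h, IsLamInvDist φ (pairWgt φ f) h ↔ h = c) ∧
    (∑ i, ∑ j, ‖a i j‖ ^ 2) + (∑ i, ‖b i‖ ^ 2) + ‖c‖ ^ 2 ≤ B * ‖f‖ ^ 2

/-- `K = (277/8) (C - 1) C'²`. -/
def constK (C C' : ℝ) : ℝ := 277 / 8 * (C - 1) * C' ^ 2

/-- `81 C'²/C + 196 C'² + K + (d + √(d² + 4dK))/2`. -/
def constB (d : ℕ) (C C' : ℝ) : ℝ :=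
  81 * C' ^ 2 / C + 196 * C' ^ 2 + constK C C' +
    (d + Real.sqrt ((d : ℝ) ^ 2 + 4 * d * constK C C')) / 2

end WittenToolbox

end

namespace WittenToolbox

open Filter Topology
open scoped Convolution

variable {d : ℕ}

/-! ### Partial derivatives -/

/-! Everything rests on an a priori estimate for test functions and on the density of `Λ(C_c^∞)` in
`L²`.

The estimate (`toolbox_test`) is obtained by integrating weighted divergences. The energy identity
bounds `‖ψ‖` and `‖∇ψ‖` by `‖Λψ‖`. The flux `2a²∇φ`, with the first inequality of `HasConstants`,
gives the Poincaré type bound `‖|∇φ|a‖² ≤ (C-1)/2 ‖a‖² + 8‖∇a‖²`. Bochner's formula bounds `‖D²ψ‖²`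
by `‖Λψ‖²` plus a Hessian term which the second inequality of `HasConstants` turns into a small
multiple of `‖|∇φ|∇ψ‖²`. Poincaré with `a = ∂_iψ` bounds that quantity back by `8‖D²ψ‖²`, and since
`C > 8` the loop closes. Poincaré with `a = ⌊∇φ⌉ψ` then yields the weight of order two. The outcome
is the constant `196 C'²`, one of the summands of `constB`, the others being nonnegative.

For density (`denseRange_diffOp`), let `h` be orthogonal to the range. Then `u = e^{-φ/2}h` is a
square integrable weak solution of `-Δu + (1 + V)u = 0` with `V = |∇φ|²/4 - Δφ/2`. Because `-Δ + V`
is the sum of squares `Σ (∂_i + ∂_iφ/2)^*(∂_i + ∂_iφ/2)`, a Caccioppoli inequality holds with no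
lower bound on `V`, and dilated cutoffs force `u = 0`. Mollification replaces elliptic regularity.

Hence `Λψ ↦ ψ` extends to a bounded operator `R`, symmetric, injective and of dense range, and the
graph of the closure is exactly `{(Rf, f)}` (`IsResolvent.mem_graph_iff`): self-adjointness,
bijectivity and `R = Λ⁻¹` follow. The maps from `Λψ` to `D²ψ`, `⌊∇φ⌉∇ψ` and `⌊∇φ⌉²ψ` extend
likewise, which is estimate (a). Conversely, a function with finite toolbox norm solves `(f, Λψ) =
(g, ψ)` for an explicit `g ∈ L²`, so it equals `Rg` (`IsResolvent.exists_eq_of_toolboxSq_lt_top`).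
For (b), the formal adjoints of `D²` and `⌊∇φ⌉∇` are dominated pointwise by the toolbox terms;
composed with `Λ⁻¹` they are bounded, and the Hilbert space adjoints of these bounded operators give
the dual objects (`exists_lamInvDist`). -/

theorem pd_add {f g : Sp d → ℝ} {x : Sp d} (i : Fin d) (hf : DifferentiableAt ℝ f x)
    (hg : DifferentiableAt ℝ g x) : pd i (fun y => f y + g y) x = pd i f x + pd i g x := by
  simp only [pd]
  rw [fderiv_fun_add hf hg]; rfl

theorem pd_sub {f g : Sp d → ℝ} {x : Sp d} (i : Fin d) (hf : DifferentiableAt ℝ f x)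
    (hg : DifferentiableAt ℝ g x) : pd i (fun y => f y - g y) x = pd i f x - pd i g x := by
  simp only [pd]
  rw [fderiv_fun_sub hf hg]; rfl

theorem pd_neg {f : Sp d → ℝ} {x : Sp d} (i : Fin d) :
    pd i (fun y => -f y) x = -pd i f x := by
  simp only [pd]
  rw [fderiv_fun_neg]; rfl

theorem pd_mul {f g : Sp d → ℝ} {x : Sp d} (i : Fin d) (hf : DifferentiableAt ℝ f x)
    (hg : DifferentiableAt ℝ g x) :
    pd i (fun y => f y * g y) x = pd i f x * g x + f x * pd i g x := by
  simp only [pd]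
  rw [fderiv_fun_mul hf hg]
  simp only [add_apply, smul_apply, smul_eq_mul]
  ring

theorem pd_const_mul {f : Sp d → ℝ} {x : Sp d} (i : Fin d) (c : ℝ) (hf : DifferentiableAt ℝ f x) :
    pd i (fun y => c * f y) x = c * pd i f x := by
  simp only [pd]
  rw [fderiv_const_mul hf]; rfl

theorem pd_sum {ι : Type*} {s : Finset ι} {f : ι → Sp d → ℝ} {x : Sp d} (i : Fin d)
    (hf : ∀ k ∈ s, DifferentiableAt ℝ (f k) x) :
    pd i (fun y => ∑ k ∈ s, f k y) x = ∑ k ∈ s, pd i (f k) x := by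
  simp only [pd]
  rw [fderiv_fun_sum hf]
  simp

theorem pd_exp {f : Sp d → ℝ} {x : Sp d} (i : Fin d) (hf : DifferentiableAt ℝ f x) :
    pd i (fun y => Real.exp (f y)) x = Real.exp (f x) * pd i f x := by
  simp only [pd]
  rw [fderiv_exp hf]; rfl

theorem contDiff_pd {f : Sp d → ℝ} {m n : WithTop ℕ∞} (hf : ContDiff ℝ n f) (hmn : m + 1 ≤ n)
    (i : Fin d) : ContDiff ℝ m (pd i f) :=
  (hf.fderiv_right hmn).clm_apply contDiff_const

theorem continuous_pd {f : Sp d → ℝ} (hf : ContDiff ℝ 1 f) (i : Fin d) : Continuous (pd i f) :=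
  (contDiff_pd (m := 0) hf (by simp) i).continuous

theorem contDiff_one_pd {f : Sp d → ℝ} (hf : ContDiff ℝ 2 f) (i : Fin d) :
    ContDiff ℝ 1 (pd i f) :=
  contDiff_pd hf (by norm_num) i

theorem tsupport_pd_subset (f : Sp d → ℝ) (i : Fin d) : tsupport (pd i f) ⊆ tsupport f :=
  (closure_mono fun x hx => by
    rw [Function.mem_support] at hx ⊢
    intro h
    exact hx (by simp [pd, h])).trans (tsupport_fderiv_subset ℝ)

theorem hasCompactSupport_pd {f : Sp d → ℝ} (hf : HasCompactSupport f) (i : Fin d) :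
    HasCompactSupport (pd i f) :=
  hf.of_isClosed_subset (isClosed_tsupport _) (tsupport_pd_subset f i)

theorem pd_pd {f : Sp d → ℝ} (hf : ContDiff ℝ 2 f) (i j : Fin d) (x : Sp d) :
    pd i (pd j f) x =
      fderiv ℝ (fderiv ℝ f) x (EuclideanSpace.single i 1) (EuclideanSpace.single j 1) := by
  have h : DifferentiableAt ℝ (fderiv ℝ f) x :=
    ((hf.fderiv_right (m := 1) (by norm_num)).differentiable (by norm_num)) x
  change fderiv ℝ (fun y => (fderiv ℝ f y) ((fun _ => EuclideanSpace.single j (1 : ℝ)) y)) x _ = _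
  rw [fderiv_clm_apply h (by fun_prop)]
  simp

theorem pd_comm {f : Sp d → ℝ} (hf : ContDiff ℝ 2 f) (i j : Fin d) (x : Sp d) :
    pd i (pd j f) x = pd j (pd i f) x := by
  rw [pd_pd hf, pd_pd hf]
  exact (hf.contDiffAt.isSymmSndFDerivAt (by simp)) _ _

theorem gradient_apply (f : Sp d → ℝ) (x : Sp d) (i : Fin d) : gradient f x i = pd i f x := by
  have h : inner ℝ (gradient f x) (EuclideanSpace.single i (1 : ℝ)) = pd i f x := by
    simp only [gradient, pd, InnerProductSpace.toDual_symm_apply]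
  rw [← h, EuclideanSpace.inner_single_right]
  simp

theorem inner_gradient (f g : Sp d → ℝ) (x : Sp d) :
    inner ℝ (gradient f x) (gradient g x) = ∑ i, pd i f x * pd i g x := by
  simp only [PiLp.inner_apply, gradient_apply]
  exact Finset.sum_congr rfl fun i _ => by simp [mul_comm]

theorem norm_gradient_sq (f : Sp d → ℝ) (x : Sp d) :
    ‖gradient f x‖ ^ 2 = ∑ i, pd i f x ^ 2 := by
  rw [← real_inner_self_eq_norm_sq, inner_gradient]
  exact Finset.sum_congr rfl fun i _ => by ring

theorem laplacian_eq_sum_pd {f : Sp d → ℝ} (hf : ContDiff ℝ 2 f) (x : Sp d) :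
    Laplacian.laplacian f x = ∑ i, pd i (pd i f) x := by
  rw [InnerProductSpace.laplacian_eq_iteratedFDeriv_orthonormalBasis f
    (EuclideanSpace.basisFun (Fin d) ℝ)]
  refine Finset.sum_congr rfl fun i _ => ?_
  rw [pd_pd hf, iteratedFDeriv_two_apply]
  simp

theorem diffOp_eq {f : Sp d → ℝ} (φ : Sp d → ℝ) (hf : ContDiff ℝ 2 f) (x : Sp d) :
    diffOp φ f x = (∑ i, (-pd i (pd i f) x + pd i φ x * pd i f x)) + f x := by
  rw [diffOp, laplacian_eq_sum_pd hf, inner_gradient, Finset.sum_add_distrib,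
    Finset.sum_neg_distrib]

/-- `|∇φ|²` in coordinates. -/
noncomputable def gradSq (φ : Sp d → ℝ) (x : Sp d) : ℝ := ∑ i, pd i φ x ^ 2

theorem gradSq_nonneg (φ : Sp d → ℝ) (x : Sp d) : 0 ≤ gradSq φ x :=
  Finset.sum_nonneg fun _ _ => sq_nonneg _

theorem continuous_gradSq {φ : Sp d → ℝ} (hφ : ContDiff ℝ 1 φ) : Continuous (gradSq φ) :=
  continuous_finsetSum _ fun i _ => (continuous_pd hφ i).pow 2

theorem wgt_sq (φ : Sp d → ℝ) (x : Sp d) : wgt φ x ^ 2 = 1 + gradSq φ x := by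
  rw [wgt, norm_gradient_sq, Real.sq_sqrt]
  · rfl
  · have := gradSq_nonneg φ x
    unfold gradSq at this
    linarith

theorem wgt_eq (φ : Sp d → ℝ) (x : Sp d) : wgt φ x = Real.sqrt (1 + gradSq φ x) := by
  rw [wgt, norm_gradient_sq]; rfl

theorem wgt_pos (φ : Sp d → ℝ) (x : Sp d) : 0 < wgt φ x := by
  rw [wgt_eq]
  exact Real.sqrt_pos.2 (by linarith [gradSq_nonneg φ x])

theorem contDiff_gradSq {φ : Sp d → ℝ} (hφ : ContDiff ℝ 2 φ) : ContDiff ℝ 1 (gradSq φ) :=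
  ContDiff.sum fun i _ => (contDiff_one_pd hφ i).pow 2

theorem contDiff_wgt {φ : Sp d → ℝ} (hφ : ContDiff ℝ 2 φ) : ContDiff ℝ 1 (wgt φ) := by
  have h : wgt φ = fun x => Real.sqrt (1 + gradSq φ x) := funext (wgt_eq φ)
  rw [h]
  exact (contDiff_const.add (contDiff_gradSq hφ)).sqrt fun x => by
    linarith [gradSq_nonneg φ x]

theorem hessNorm_nonneg (φ : Sp d → ℝ) (x : Sp d) : 0 ≤ hessNorm φ x := Real.sqrt_nonneg _

theorem hessNorm_sq (φ : Sp d → ℝ) (x : Sp d) :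
    hessNorm φ x ^ 2 = ∑ i, ∑ j, pd i (pd j φ) x ^ 2 :=
  Real.sq_sqrt (Finset.sum_nonneg fun _ _ => Finset.sum_nonneg fun _ _ => sq_nonneg _)

/-! ### Integration by parts -/

theorem integral_pd_eq_zero {F : Sp d → ℝ} (hF : ContDiff ℝ 1 F) (hc : HasCompactSupport F)
    (i : Fin d) : ∫ x, pd i F x = 0 := by
  have h := integral_mul_fderiv_eq_neg_fderiv_mul_of_integrable (μ := (volume : Measure (Sp d)))
    (f := fun _ => (1 : ℝ)) (g := F) (v := EuclideanSpace.single i 1) (by simp)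
    (by
      simp only [one_mul]
      exact (continuous_pd hF i).integrable_of_hasCompactSupport (hasCompactSupport_pd hc i))
    (by
      simp only [one_mul]
      exact hF.continuous.integrable_of_hasCompactSupport hc)
    (fun x _ => by fun_prop) (fun x _ => (hF.differentiable (by norm_num)) x)
  simpa [pd] using h

theorem integral_gibbs {φ : Sp d → ℝ} (hφ : Continuous φ) (g : Sp d → ℝ) :
    ∫ x, g x ∂(gibbs φ) = ∫ x, Real.exp (-φ x) * g x := by
  rw [gibbs, integral_withDensity_eq_integral_toReal_smul (by fun_prop) (by simp)]
  simp [ENNReal.toReal_ofReal (Real.exp_pos _).le]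

theorem isLocallyFiniteMeasure_gibbs {φ : Sp d → ℝ} (hφ : Continuous φ) :
    IsLocallyFiniteMeasure (gibbs φ) :=
  IsLocallyFiniteMeasure.withDensity_ofReal (by fun_prop)

theorem integrable_gibbs {φ f : Sp d → ℝ} (hφ : Continuous φ) (hf : Continuous f)
    {K : Set (Sp d)} (hK : IsCompact K) (h0 : ∀ x ∉ K, f x = 0) : Integrable f (gibbs φ) :=
  haveI := isLocallyFiniteMeasure_gibbs hφ
  hf.integrable_of_hasCompactSupport (HasCompactSupport.intro hK h0)

/-- The integrand is `e^φ ∂_i(F e^{-φ})`. The weighted integral inequalities below all come from a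
choice of such fluxes `F`. -/
theorem integral_gibbs_div_eq_zero {φ F : Sp d → ℝ} (hφ : ContDiff ℝ 1 φ) (hF : ContDiff ℝ 1 F)
    (hc : HasCompactSupport F) (i : Fin d) :
    ∫ x, (pd i F x - pd i φ x * F x) ∂(gibbs φ) = 0 := by
  rw [integral_gibbs hφ.continuous]
  have h := integral_pd_eq_zero (F := fun x => F x * Real.exp (-φ x))
    (hF.mul hφ.neg.exp) hc.mul_right i
  rw [← h]
  refine integral_congr_ae (Eventually.of_forall fun x => ?_)
  have h1 : DifferentiableAt ℝ φ x := (hφ.differentiable (by norm_num)) x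
  have h2 : DifferentiableAt ℝ F x := (hF.differentiable (by norm_num)) x
  simp only
  rw [pd_mul i h2 (by fun_prop), pd_exp i h1.fun_neg, pd_neg]
  ring

theorem eq_zero_of_notMem_tsupport {f : Sp d → ℝ} {x : Sp d} (hx : x ∉ tsupport f) : f x = 0 :=
  image_eq_zero_of_notMem_tsupport hx

theorem pd_eq_zero_of_notMem_tsupport {f : Sp d → ℝ} {x : Sp d} (hx : x ∉ tsupport f)
    (i : Fin d) : pd i f x = 0 :=
  image_eq_zero_of_notMem_tsupport fun h => hx (tsupport_pd_subset f i h)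

theorem pd_pd_eq_zero_of_notMem_tsupport {f : Sp d → ℝ} {x : Sp d} (hx : x ∉ tsupport f)
    (i j : Fin d) : pd i (pd j f) x = 0 :=
  pd_eq_zero_of_notMem_tsupport (fun h => hx (tsupport_pd_subset f j h)) i

theorem gradSq_eq_zero_of_notMem_tsupport {f : Sp d → ℝ} {x : Sp d} (hx : x ∉ tsupport f) :
    gradSq f x = 0 := by
  simp [gradSq, pd_eq_zero_of_notMem_tsupport hx]

theorem hessNorm_eq_zero_of_notMem_tsupport {f : Sp d → ℝ} {x : Sp d} (hx : x ∉ tsupport f) :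
    hessNorm f x = 0 := by
  simp [hessNorm, pd_pd_eq_zero_of_notMem_tsupport hx]

theorem diffOp_eq_zero_of_notMem_tsupport {φ f : Sp d → ℝ} (hf : ContDiff ℝ 2 f) {x : Sp d}
    (hx : x ∉ tsupport f) : diffOp φ f x = 0 := by
  simp [diffOp_eq φ hf, pd_pd_eq_zero_of_notMem_tsupport hx, pd_eq_zero_of_notMem_tsupport hx,
    eq_zero_of_notMem_tsupport hx]

theorem continuous_hessNorm {f : Sp d → ℝ} (hf : ContDiff ℝ 2 f) : Continuous (hessNorm f) :=
  Real.continuous_sqrt.comp <| continuous_finsetSum _ fun _ _ => continuous_finsetSum _ fun j _ =>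
    (continuous_pd (contDiff_one_pd hf j) _).pow 2

theorem continuous_diffOp {φ f : Sp d → ℝ} (hφ : ContDiff ℝ 1 φ) (hf : ContDiff ℝ 2 f) :
    Continuous (diffOp φ f) := by
  rw [funext (diffOp_eq φ hf)]
  refine Continuous.add (continuous_finsetSum _ fun i _ => ?_) hf.continuous
  exact (continuous_pd (contDiff_one_pd hf i) i).neg.add
    ((continuous_pd hφ i).mul (continuous_pd (hf.of_le (by norm_num)) i))

/-- If a sum of weighted divergences is dominated by `A`, then `A` has nonnegative integral. -/
theorem integral_nonneg_of_div_le {ι : Type*} [Fintype ι] {φ A : Sp d → ℝ}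
    (hφ : ContDiff ℝ 1 φ) {F : ι → Sp d → ℝ} (k : ι → Fin d) {K : Set (Sp d)} (hK : IsCompact K)
    (hF : ∀ i, ContDiff ℝ 1 (F i)) (hF0 : ∀ i, ∀ x ∉ K, F i x = 0)
    (hA : Continuous A) (hA0 : ∀ x ∉ K, A x = 0)
    (h : ∀ x, ∑ i, (pd (k i) (F i) x - pd (k i) φ x * F i x) ≤ A x) :
    0 ≤ ∫ x, A x ∂(gibbs φ) := by
  have hc : ∀ i, HasCompactSupport (F i) := fun i => HasCompactSupport.intro hK (hF0 i)
  have hint : ∀ i, Integrable (fun x => pd (k i) (F i) x - pd (k i) φ x * F i x) (gibbs φ) := by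
    intro i
    refine integrable_gibbs hφ.continuous ((continuous_pd (hF i) _).sub
      ((continuous_pd hφ _).mul (hF i).continuous)) (hc i).isCompact fun x hx => ?_
    rw [pd_eq_zero_of_notMem_tsupport hx, eq_zero_of_notMem_tsupport hx]
    simp
  have h0 : ∫ x, ∑ i, (pd (k i) (F i) x - pd (k i) φ x * F i x) ∂(gibbs φ) = 0 := by
    rw [integral_finsetSum _ fun i _ => hint i]
    exact Finset.sum_eq_zero fun i _ => integral_gibbs_div_eq_zero hφ (hF i) (hc i) (k i)
  rw [← h0]
  exact integral_mono (integrable_finsetSum _ fun i _ => hint i)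
    (integrable_gibbs hφ.continuous hA hK hA0) h

/-! ### Energy, Poincaré and Bochner inequalities for compactly supported functions -/

theorem pd_mul_of_contDiff {f g : Sp d → ℝ} (hf : ContDiff ℝ 1 f) (hg : ContDiff ℝ 1 g)
    (i : Fin d) (x : Sp d) :
    pd i (fun y => f y * g y) x = pd i f x * g x + f x * pd i g x :=
  pd_mul i ((hf.differentiable (by norm_num)) x) ((hg.differentiable (by norm_num)) x)

/-- Pointwise form of `(ψ, Λψ) = ‖∇ψ‖² + ‖ψ‖²`. -/
theorem sum_div_mul_pd {φ ψ : Sp d → ℝ} (hψ : ContDiff ℝ 2 ψ) (x : Sp d) :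
    ∑ i, (pd i (fun y => ψ y * pd i ψ y) x - pd i φ x * (ψ x * pd i ψ x)) =
      gradSq ψ x + ψ x ^ 2 - ψ x * diffOp φ ψ x := by
  have h1 : ContDiff ℝ 1 ψ := hψ.of_le (by norm_num)
  rw [diffOp_eq φ hψ, gradSq, mul_add, Finset.mul_sum, add_sub_assoc, ← sq, sub_add_cancel_right,
    ← sub_eq_add_neg, ← Finset.sum_sub_distrib]
  refine Finset.sum_congr rfl fun i _ => ?_
  rw [pd_mul_of_contDiff h1 (contDiff_one_pd hψ i)]
  ring

/-- Combine `(ψ, Λψ) = ‖∇ψ‖² + ‖ψ‖²` with `2ψΛψ ≤ ψ² + (Λψ)²`. -/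
theorem integral_diffOp_energy {φ ψ : Sp d → ℝ} (hφ : ContDiff ℝ 1 φ) (hψ : ContDiff ℝ 2 ψ)
    (hc : HasCompactSupport ψ) :
    0 ≤ ∫ x, (diffOp φ ψ x ^ 2 - ψ x ^ 2 - 2 * gradSq ψ x) ∂(gibbs φ) := by
  have h1 : ContDiff ℝ 1 ψ := hψ.of_le (by norm_num)
  refine integral_nonneg_of_div_le (ι := Fin d) hφ (F := fun i y => -2 * (ψ y * pd i ψ y))
    (fun i => i) hc.isCompact (fun i => contDiff_const.mul (h1.mul (contDiff_one_pd hψ i)))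
    (fun i x hx => by simp [eq_zero_of_notMem_tsupport hx])
    (by
      have := continuous_diffOp hφ hψ
      have := continuous_gradSq h1
      have := hψ.continuous
      fun_prop)
    (fun x hx => by
      simp [diffOp_eq_zero_of_notMem_tsupport hψ hx, eq_zero_of_notMem_tsupport hx,
        gradSq_eq_zero_of_notMem_tsupport hx]) fun x => ?_
  have h2 : ∀ i, pd i (fun y => -2 * (ψ y * pd i ψ y)) x - pd i φ x * (-2 * (ψ x * pd i ψ x)) =
      -2 * (pd i (fun y => ψ y * pd i ψ y) x - pd i φ x * (ψ x * pd i ψ x)) := by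
    intro i
    rw [pd_const_mul i _ (((h1.mul (contDiff_one_pd hψ i)).differentiable (by norm_num)) x)]
    ring
  rw [Finset.sum_congr rfl fun i _ => h2 i, ← Finset.mul_sum, sum_div_mul_pd hψ]
  nlinarith [sq_nonneg (diffOp φ ψ x - ψ x)]

/-- Cauchy–Schwarz for the trace; it accounts for the factor `√d` in the first inequality of
`HasConstants`. -/
theorem abs_laplacian_le_hessNorm (φ : Sp d → ℝ) (x : Sp d) :
    |∑ i, pd i (pd i φ) x| ≤ Real.sqrt d * hessNorm φ x := by
  rw [hessNorm, ← Real.sqrt_mul (Nat.cast_nonneg d), ← Real.sqrt_sq_eq_abs]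
  refine Real.sqrt_le_sqrt ?_
  have h1 := sq_sum_le_card_mul_sum_sq (s := Finset.univ) (f := fun i => pd i (pd i φ) x)
  simp only [Finset.card_univ, Fintype.card_fin] at h1
  refine h1.trans (mul_le_mul_of_nonneg_left (Finset.sum_le_sum fun i _ => ?_) (Nat.cast_nonneg d))
  exact Finset.single_le_sum (f := fun j => pd i (pd j φ) x ^ 2) (fun j _ => sq_nonneg _)
    (Finset.mem_univ i)

/-- The weighted Poincaré type inequality
`‖∇φ a‖² ≤ (C - 1)/2 ‖a‖² + 8 ‖∇a‖²`. -/
theorem integral_gradSq_mul_sq_le {φ a : Sp d → ℝ} {C C' : ℝ} (hφ : ContDiff ℝ 2 φ)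
    (hC : HasConstants φ C C') (ha : ContDiff ℝ 1 a) (hc : HasCompactSupport a) :
    0 ≤ ∫ x, ((C - 1) / 2 * a x ^ 2 + 8 * gradSq a x - gradSq φ x * a x ^ 2) ∂(gibbs φ) := by
  have hφ1 : ContDiff ℝ 1 φ := hφ.of_le (by norm_num)
  -- The flux `2a²∇φ` has weighted divergence `2a²Δφ + 4a∇φ·∇a - 2a²|∇φ|²`. The first two terms cost
  -- at most half of `|∇φ|²a²` each, so `-|∇φ|²a²` survives.
  refine integral_nonneg_of_div_le (ι := Fin d) hφ1 (F := fun i y => pd i φ y * (2 * a y ^ 2))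
    (fun i => i) hc.isCompact
    (fun i => (contDiff_one_pd hφ i).mul (contDiff_const.mul (ha.pow 2)))
    (fun i x hx => by simp [eq_zero_of_notMem_tsupport hx])
    (by
      have := continuous_gradSq hφ1
      have := continuous_gradSq ha
      have := ha.continuous
      fun_prop)
    (fun x hx => by
      simp [eq_zero_of_notMem_tsupport hx, gradSq_eq_zero_of_notMem_tsupport hx]) fun x => ?_
  have hd : DifferentiableAt ℝ a x := (ha.differentiable (by norm_num)) x
  have h1 : ∀ i, pd i (fun y => pd i φ y * (2 * a y ^ 2)) x - pd i φ x * (pd i φ x * (2 * a x ^ 2))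
      = pd i (pd i φ) x * (2 * a x ^ 2) + pd i φ x * (4 * a x * pd i a x)
        - pd i φ x ^ 2 * (2 * a x ^ 2) := by
    intro i
    rw [pd_mul_of_contDiff (contDiff_one_pd hφ i) (contDiff_const.mul (ha.pow 2)),
      pd_const_mul i _ (hd.fun_pow 2), show (fun y => a y ^ 2) = fun y => a y * a y from
        funext fun y => sq (a y), pd_mul i hd hd]
    ring
  rw [Finset.sum_congr rfl fun i _ => h1 i, Finset.sum_sub_distrib, Finset.sum_add_distrib,
    ← Finset.sum_mul, ← Finset.sum_mul]
  have h2 : (∑ i, pd i (pd i φ) x) * (2 * a x ^ 2) ≤ (gradSq φ x + C - 1) / 2 * a x ^ 2 := by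
    have h3 := (hC x).1
    rw [norm_gradient_sq] at h3
    have h4 := (le_abs_self _).trans (abs_laplacian_le_hessNorm φ x)
    have h5 : 4 * (∑ i, pd i (pd i φ) x) ≤ gradSq φ x + C - 1 := by unfold gradSq; linarith
    nlinarith [sq_nonneg (a x)]
  -- Young's inequality in the form `4a∇φ·∇a ≤ 8|∇a|² + |∇φ|²a²/2`.
  have h6 : 0 ≤ ∑ i, (1 / 2 : ℝ) * (4 * pd i a x - pd i φ x * a x) ^ 2 :=
    Finset.sum_nonneg fun i _ => by positivity
  have h7 : ∑ i, (1 / 2 : ℝ) * (4 * pd i a x - pd i φ x * a x) ^ 2 =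
      8 * gradSq a x - (∑ i, pd i φ x * (4 * a x * pd i a x)) + 1 / 2 * gradSq φ x * a x ^ 2 := by
    simp only [gradSq, Finset.mul_sum, Finset.sum_mul]
    rw [← Finset.sum_sub_distrib, ← Finset.sum_add_distrib]
    exact Finset.sum_congr rfl fun i _ => by ring
  have h8 : (∑ i, pd i φ x ^ 2) = gradSq φ x := rfl
  rw [h8]
  nlinarith

/-- Cauchy–Schwarz over pairs of indices: the Frobenius norm of `v ⊗ v` is `|v|²`. -/
theorem abs_hess_quadratic_le (φ : Sp d → ℝ) (v : Fin d → ℝ) (x : Sp d) :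
    |∑ i, ∑ j, v i * pd i (pd j φ) x * v j| ≤ hessNorm φ x * ∑ i, v i ^ 2 := by
  have h0 : 0 ≤ ∑ i, v i ^ 2 := Finset.sum_nonneg fun _ _ => sq_nonneg _
  refine abs_le_of_sq_le_sq ?_ (mul_nonneg (hessNorm_nonneg φ x) h0)
  rw [mul_pow, hessNorm_sq]
  have h := Finset.sum_mul_sq_le_sq_mul_sq (Finset.univ : Finset (Fin d × Fin d))
    (fun p => pd p.1 (pd p.2 φ) x) (fun p => v p.1 * v p.2)
  simp only [Fintype.sum_prod_type] at h
  have h1 : ∑ i, ∑ j, (v i * v j) ^ 2 = (∑ i, v i ^ 2) ^ 2 := by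
    rw [sq (∑ i, v i ^ 2), Finset.sum_mul_sum]
    simp [mul_pow]
  rw [h1] at h
  refine le_trans (le_of_eq ?_) h
  congr 1
  exact Finset.sum_congr rfl fun i _ => Finset.sum_congr rfl fun j _ => by ring

theorem IsTest.contDiff_of {ψ : Sp d → ℝ} (hψ : IsTest ψ) (n : ℕ) : ContDiff ℝ n ψ :=
  hψ.1.of_le (by exact_mod_cast le_top)

theorem IsTest.pd {ψ : Sp d → ℝ} (hψ : IsTest ψ) (i : Fin d) : IsTest (pd i ψ) :=
  ⟨contDiff_pd hψ.1 (by simp) i, hasCompactSupport_pd hψ.2 i⟩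

/-- Bochner's inequality for the Witten Laplacian. -/
theorem integral_bochner {φ ψ : Sp d → ℝ} {C C' : ℝ} (hφ : ContDiff ℝ 2 φ)
    (hC : HasConstants φ C C') (hψ : IsTest ψ) :
    0 ≤ ∫ x, (diffOp φ ψ x ^ 2 + (4 * Real.sqrt C)⁻¹ * ((gradSq φ x + C') * gradSq ψ x)
      - hessNorm ψ x ^ 2) ∂(gibbs φ) := by
  have hφ1 : ContDiff ℝ 1 φ := hφ.of_le (by norm_num)
  have hψ2 : ContDiff ℝ 2 ψ := hψ.contDiff_of 2
  have hψ1 : ContDiff ℝ 1 ψ := hψ.contDiff_of 1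
  have hp1 : ∀ i, ContDiff ℝ 1 (pd i ψ) := fun i => (hψ.pd i).contDiff_of 1
  have hp2 : ∀ i, ContDiff ℝ 2 (pd i ψ) := fun i => (hψ.pd i).contDiff_of 2
  have hpp : ∀ i j, ContDiff ℝ 1 (pd i (pd j ψ)) := fun i j => ((hψ.pd j).pd i).contDiff_of 1
  have hφp : ∀ i, ContDiff ℝ 1 (pd i φ) := contDiff_one_pd hφ
  -- `L = Λψ - ψ`. It is differentiated only once, so third derivatives fall on `ψ` alone and `φ ∈
  -- C²` suffices.
  set L : Sp d → ℝ := fun x => ∑ j, (-pd j (pd j ψ) x + pd j φ x * pd j ψ x) with hL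
  have hL1 : ContDiff ℝ 1 L :=
    ContDiff.sum fun j _ => (hpp j j).neg.add ((hφp j).mul (hp1 j))
  have hdL : ∀ i x, pd i L x = ∑ j, (-pd j (pd j (pd i ψ)) x + pd i (pd j φ) x * pd j ψ x +
      pd j φ x * pd j (pd i ψ) x) := by
    intro i x
    have hdiff : ∀ {f : Sp d → ℝ}, ContDiff ℝ 1 f → DifferentiableAt ℝ f x := fun hf =>
      (hf.differentiable (by norm_num)) x
    rw [hL, pd_sum i fun j _ => (hdiff (hpp j j)).fun_neg.fun_add (hdiff ((hφp j).mul (hp1 j)))]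
    refine Finset.sum_congr rfl fun j _ => ?_
    rw [pd_add i (hdiff (hpp j j)).fun_neg (hdiff ((hφp j).mul (hp1 j))), pd_neg,
      pd_mul_of_contDiff (hφp j) (hp1 j), pd_comm (hp2 j) i j,
      show pd i (pd j ψ) = pd j (pd i ψ) from funext fun y => pd_comm hψ2 i j y]
    ring
  -- The first flux `-L∇ψ` gives `L² - ∇ψ·∇L`; the second, `-∇|∇ψ|²/2`, gives `∇ψ·∇L - |D²ψ|² -
  -- D²φ(∇ψ,∇ψ)`, so the third order terms cancel in the sum. The third, `-2ψ∇ψ`, converts `L²` into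
  -- `(Λψ)²`.
  let F : Fin d ⊕ (Fin d ⊕ Fin d) → Sp d → ℝ := Sum.elim (fun i y => -(pd i ψ y * L y))
    (Sum.elim (fun j y => -∑ i, pd i ψ y * pd j (pd i ψ) y) (fun i y => -2 * (ψ y * pd i ψ y)))
  refine integral_nonneg_of_div_le hφ1 (F := F) (Sum.elim (fun i => i)
    (Sum.elim (fun i => i) (fun i => i))) hψ.2.isCompact ?_ ?_ ?_ ?_ fun x => ?_
  · rintro (i | i | i)
    · exact ((hp1 i).mul hL1).neg
    · exact (ContDiff.sum (s := Finset.univ) (f := fun j y => pd j ψ y * pd i (pd j ψ) y)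
        fun j _ => (hp1 j).mul (hpp i j)).neg
    · exact contDiff_const.mul (hψ1.mul (hp1 i))
  · rintro (i | i | i) x hx <;>
    simp [F, pd_eq_zero_of_notMem_tsupport hx]
  · have := continuous_gradSq hφ1
    have := continuous_gradSq hψ1
    have := continuous_diffOp hφ1 hψ2
    have := continuous_hessNorm hψ2
    fun_prop
  · intro x hx
    simp [diffOp_eq_zero_of_notMem_tsupport hψ2 hx, gradSq_eq_zero_of_notMem_tsupport hx,
      hessNorm_eq_zero_of_notMem_tsupport hx]
  · simp only [Fintype.sum_sum_type, F, Sum.elim_inl, Sum.elim_inr]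
    have hdiff : ∀ {f : Sp d → ℝ}, ContDiff ℝ 1 f → DifferentiableAt ℝ f x := fun hf =>
      (hf.differentiable (by norm_num)) x
    have h1 : ∑ i, (pd i (fun y => pd i ψ y * L y) x - pd i φ x * (pd i ψ x * L x)) =
        -L x ^ 2 + ∑ i, pd i ψ x * pd i L x := by
      have e : ∀ i, pd i (fun y => pd i ψ y * L y) x - pd i φ x * (pd i ψ x * L x) =
          -(-pd i (pd i ψ) x + pd i φ x * pd i ψ x) * L x + pd i ψ x * pd i L x := by
        intro i
        rw [pd_mul_of_contDiff (hp1 i) hL1]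
        ring
      rw [Finset.sum_congr rfl fun i _ => e i, Finset.sum_add_distrib, ← Finset.sum_mul,
        Finset.sum_neg_distrib, sq, neg_mul]
    have h2 : ∑ j, (pd j (fun y => ∑ i, pd i ψ y * pd j (pd i ψ) y) x -
          pd j φ x * ∑ i, pd i ψ x * pd j (pd i ψ) x) =
        hessNorm ψ x ^ 2 - (∑ i, pd i ψ x * pd i L x) +
          ∑ i, ∑ j, pd i ψ x * pd i (pd j φ) x * pd j ψ x := by
      rw [hessNorm_sq]
      have e : ∀ j, (pd j (fun y => ∑ i, pd i ψ y * pd j (pd i ψ) y) x -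
          pd j φ x * ∑ i, pd i ψ x * pd j (pd i ψ) x) = ∑ i, (pd j (pd i ψ) x ^ 2 +
            pd i ψ x * (pd j (pd j (pd i ψ)) x - pd j φ x * pd j (pd i ψ) x)) := by
        intro j
        rw [pd_sum j fun i _ => hdiff ((hp1 i).mul (hpp j i)), Finset.mul_sum,
          ← Finset.sum_sub_distrib]
        refine Finset.sum_congr rfl fun i _ => ?_
        rw [pd_mul_of_contDiff (hp1 i) (hpp j i)]
        ring
      rw [Finset.sum_congr rfl fun j _ => e j]
      simp only [Finset.sum_add_distrib]
      have e2 : ∀ i, pd i ψ x * pd i L x = ∑ j, (pd i ψ x * pd i (pd j φ) x * pd j ψ x -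
          pd i ψ x * (pd j (pd j (pd i ψ)) x - pd j φ x * pd j (pd i ψ) x)) := by
        intro i
        rw [hdL, Finset.mul_sum]
        exact Finset.sum_congr rfl fun j _ => by ring
      rw [Finset.sum_congr rfl fun i _ => e2 i]
      simp only [Finset.sum_sub_distrib]
      rw [Finset.sum_comm (f := fun j i => pd i ψ x *
        (pd j (pd j (pd i ψ)) x - pd j φ x * pd j (pd i ψ) x))]
      ring
    have h3 : ∑ i, (pd i (fun y => -2 * (ψ y * pd i ψ y)) x -
        pd i φ x * (-2 * (ψ x * pd i ψ x))) =
          -2 * (gradSq ψ x + ψ x ^ 2 - ψ x * diffOp φ ψ x) := by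
      rw [← sum_div_mul_pd hψ2, Finset.mul_sum]
      refine Finset.sum_congr rfl fun i _ => ?_
      rw [pd_const_mul i _ (hdiff (hψ1.mul (hp1 i)))]
      ring
    have hneg : ∀ (G : Fin d → Sp d → ℝ), ∑ i, (pd i (fun y => -G i y) x - pd i φ x * -G i x) =
        -∑ i, (pd i (G i) x - pd i φ x * G i x) := by
      intro G
      rw [← Finset.sum_neg_distrib]
      refine Finset.sum_congr rfl fun i _ => ?_
      rw [pd_neg, mul_neg]
      ring
    rw [hneg fun i y => pd i ψ y * L y, hneg fun j y => ∑ i, pd i ψ y * pd j (pd i ψ) y,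
      h1, h2, h3]
    have h4 : diffOp φ ψ x = L x + ψ x := diffOp_eq φ hψ2 x
    have h5 := neg_le_of_abs_le (abs_hess_quadratic_le φ (fun i => pd i ψ x) x)
    have h7 : hessNorm φ x ≤ (4 * Real.sqrt C)⁻¹ * (gradSq φ x + C') := by
      have h := (hC x).2
      rw [norm_gradient_sq] at h
      rw [mul_inv, mul_assoc]
      unfold gradSq
      linarith
    have h8 : hessNorm φ x * gradSq ψ x ≤
        (4 * Real.sqrt C)⁻¹ * (gradSq φ x + C') * gradSq ψ x :=
      mul_le_mul_of_nonneg_right h7 (gradSq_nonneg ψ x)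
    have h9 : (∑ i, pd i ψ x ^ 2) = gradSq ψ x := rfl
    have h10 := gradSq_nonneg ψ x
    rw [h9] at h5
    rw [h4]
    rw [mul_assoc] at h8
    -- After the identities the favourable terms `-ψ² - 2|∇ψ|²` are left over and discarded.
    nlinarith [sq_nonneg (ψ x)]

theorem sum_gradSq_pd {ψ : Sp d → ℝ} (hψ : ContDiff ℝ 2 ψ) (x : Sp d) :
    ∑ i, gradSq (pd i ψ) x = hessNorm ψ x ^ 2 := by
  rw [hessNorm_sq]
  exact Finset.sum_congr rfl fun i _ => Finset.sum_congr rfl fun j _ => by rw [pd_comm hψ]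

/-- `‖∇φ ∇ψ‖² ≤ (C - 1)/2 ‖∇ψ‖² + 8 ‖D²ψ‖²`. -/
theorem integral_gradSq_mul_gradSq_le {φ ψ : Sp d → ℝ} {C C' : ℝ} (hφ : ContDiff ℝ 2 φ)
    (hC : HasConstants φ C C') (hψ : IsTest ψ) :
    0 ≤ ∫ x, ((C - 1) / 2 * gradSq ψ x + 8 * hessNorm ψ x ^ 2 - gradSq φ x * gradSq ψ x)
      ∂(gibbs φ) := by
  have hφ1 : ContDiff ℝ 1 φ := hφ.of_le (by norm_num)
  have hp1 : ∀ i, ContDiff ℝ 1 (pd i ψ) := fun i => (hψ.pd i).contDiff_of 1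
  have h1 : ∀ x, (C - 1) / 2 * gradSq ψ x + 8 * hessNorm ψ x ^ 2 - gradSq φ x * gradSq ψ x =
      ∑ i, ((C - 1) / 2 * pd i ψ x ^ 2 + 8 * gradSq (pd i ψ) x - gradSq φ x * pd i ψ x ^ 2) := by
    intro x
    rw [Finset.sum_sub_distrib, Finset.sum_add_distrib, ← Finset.mul_sum, ← Finset.mul_sum,
      ← Finset.mul_sum, sum_gradSq_pd (hψ.contDiff_of 2)]
    rfl
  simp only [h1]
  rw [integral_finsetSum]
  · exact Finset.sum_nonneg fun i _ => integral_gradSq_mul_sq_le hφ hC (hp1 i) (hψ.pd i).2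
  · intro i _
    refine integrable_gibbs hφ.continuous ?_ hψ.2.isCompact fun x hx => ?_
    · have := continuous_gradSq hφ1
      have := continuous_gradSq (hp1 i)
      have := (hp1 i).continuous
      fun_prop
    · simp [gradSq, pd_pd_eq_zero_of_notMem_tsupport hx, pd_eq_zero_of_notMem_tsupport hx]

/-! ### The gradient of the weight and the toolbox estimate for test functions -/

theorem pd_wgt {φ : Sp d → ℝ} (hφ : ContDiff ℝ 2 φ) (i : Fin d) (x : Sp d) :
    pd i (wgt φ) x = (∑ j, pd i (pd j φ) x * pd j φ x) / wgt φ x := by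
  have hw := contDiff_wgt hφ
  have hd : ∀ {f : Sp d → ℝ}, ContDiff ℝ 1 f → DifferentiableAt ℝ f x := fun hf =>
    (hf.differentiable (by norm_num)) x
  have h : (fun y => wgt φ y * wgt φ y) = fun y => 1 + ∑ j, pd j φ y * pd j φ y := by
    funext y
    rw [← sq, wgt_sq, gradSq]
    simp only [sq]
  have h1 := pd_mul_of_contDiff hw hw i x
  have hj : ∀ j, ContDiff ℝ 1 (pd j φ) := contDiff_one_pd hφ
  have hs : ContDiff ℝ 1 (fun y => ∑ j, pd j φ y * pd j φ y) :=
    ContDiff.sum fun j _ => (hj j).mul (hj j)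
  have hc : pd i (fun _ : Sp d => (1 : ℝ)) x = 0 := by simp [pd]
  rw [h, pd_add i (by fun_prop) (hd hs), pd_sum i fun j _ => hd ((hj j).mul (hj j)), hc] at h1
  rw [eq_div_iff (wgt_pos φ x).ne']
  have h2 : ∑ j, pd i (fun y => pd j φ y * pd j φ y) x = 2 * ∑ j, pd i (pd j φ) x * pd j φ x := by
    rw [Finset.mul_sum]
    refine Finset.sum_congr rfl fun j _ => ?_
    rw [pd_mul_of_contDiff (hj j) (hj j)]
    ring
  rw [h2] at h1
  linarith

/-- Since `∇⌊∇φ⌉ = D²φ∇φ/⌊∇φ⌉` and `|∇φ| ≤ ⌊∇φ⌉`, Cauchy–Schwarz in each row leaves only the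
Hessian. -/
theorem gradSq_wgt_le {φ : Sp d → ℝ} (hφ : ContDiff ℝ 2 φ) (x : Sp d) :
    gradSq (wgt φ) x ≤ hessNorm φ x ^ 2 := by
  rw [hessNorm_sq, gradSq]
  refine Finset.sum_le_sum fun i _ => ?_
  rw [pd_wgt hφ, div_pow, div_le_iff₀ (by have := wgt_pos φ x; positivity)]
  refine (Finset.sum_mul_sq_le_sq_mul_sq _ _ _).trans ?_
  refine mul_le_mul_of_nonneg_left ?_ (Finset.sum_nonneg fun _ _ => sq_nonneg _)
  rw [wgt_sq]
  exact le_add_of_nonneg_left zero_le_one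

theorem gradSq_mul_le {f g : Sp d → ℝ} (hf : ContDiff ℝ 1 f) (hg : ContDiff ℝ 1 g) (x : Sp d) :
    gradSq (fun y => f y * g y) x ≤ 2 * f x ^ 2 * gradSq g x + 2 * g x ^ 2 * gradSq f x := by
  simp only [gradSq, Finset.mul_sum]
  rw [← Finset.sum_add_distrib]
  refine Finset.sum_le_sum fun i _ => ?_
  rw [pd_mul_of_contDiff hf hg]
  nlinarith [sq_nonneg (pd i f x * g x - f x * pd i g x)]

/-- Squaring the second structural inequality gives `16|D²φ|² ≤ (|∇φ|² + C')²/C`; then `(s + t)² ≤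
2s² + 2t²` and `C > 8` produce the factor 64. -/
theorem HasConstants.hessNorm_sq_le {φ : Sp d → ℝ} {C C' : ℝ} (hC : HasConstants φ C C')
    (h8 : 8 < C) (x : Sp d) :
    64 * hessNorm φ x ^ 2 ≤ gradSq φ x ^ 2 + C' ^ 2 := by
  have h := (hC x).2
  rw [norm_gradient_sq] at h
  change 4 * hessNorm φ x ≤ (Real.sqrt C)⁻¹ * (gradSq φ x + C') at h
  have h0 := hessNorm_nonneg φ x
  have h1 : (4 * hessNorm φ x) ^ 2 ≤ ((Real.sqrt C)⁻¹ * (gradSq φ x + C')) ^ 2 :=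
    pow_le_pow_left₀ (by positivity) h 2
  rw [mul_pow, mul_pow, inv_pow, Real.sq_sqrt (by linarith), inv_mul_eq_div,
    le_div_iff₀ (by linarith)] at h1
  nlinarith [sq_nonneg (gradSq φ x - C'), sq_nonneg (hessNorm φ x)]

/-- The linear bookkeeping behind `toolbox_test`: `F = ‖Λψ‖²`, `N0, N1, N2` are the squared norms of
`ψ, ∇ψ, D²ψ`, `P0, P1` those of `|∇φ|ψ, |∇φ|∇ψ`, and `Z` that of `|∇φ|²ψ`. The only circular pair is
`e3`, `e4`, which bound `P1` by `8 N2` and `N2` by a small multiple of `P1`. -/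
theorem toolbox_arith {C C' F N0 N1 N2 P0 P1 Z : ℝ} (h8 : 8 < C) (hCC : C < C') (pN0 : 0 ≤ N0)
    (pN1 : 0 ≤ N1) (pP0 : 0 ≤ P0) (pP1 : 0 ≤ P1) (e1 : 0 ≤ F - N0 - 2 * N1)
    (e2 : 0 ≤ (C - 1) / 2 * N0 + 8 * N1 - P0) (e3 : 0 ≤ (C - 1) / 2 * N1 + 8 * N2 - P1)
    (e4 : 0 ≤ F + (4 * Real.sqrt C)⁻¹ * (P1 + C' * N1) - N2)
    (e5 : 0 ≤ ((C - 1) / 2 + C' ^ 2 / 4) * N0 + ((C - 1) / 2 - 1) * P0 + 16 * N1 + 16 * P1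
      - 3 / 4 * Z) :
    N0 ≤ F ∧ N2 + (N1 + P1) + (N0 + 2 * P0 + Z) ≤ 196 * C' ^ 2 * F := by
  refine ⟨by linarith, ?_⟩
  -- `2.8² = 7.84 < 8` and `4 · 2.8 = 56/5`. The feedback factor of the pair `e3`, `e4` is then `8 ·
  -- 5/56 = 5/7 < 1`.
  have hs : (4 * Real.sqrt C)⁻¹ ≤ 5 / 56 := by
    have : (2.8 : ℝ) ≤ Real.sqrt C := Real.le_sqrt_of_sq_le (by norm_num; linarith)
    rw [inv_le_comm₀ (by positivity) (by norm_num)]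
    norm_num at this ⊢
    linarith
  have e4' : N2 ≤ F + 5 / 56 * (P1 + C' * N1) := by
    have : 0 ≤ P1 + C' * N1 := add_nonneg pP1 (mul_nonneg (by linarith) pN1)
    nlinarith
  have a1 : C * N1 ≤ C' * N1 := mul_le_mul_of_nonneg_right hCC.le pN1
  have a2 : C * N0 ≤ C' * N0 := mul_le_mul_of_nonneg_right hCC.le pN0
  have pF : 0 ≤ F := by linarith
  have a3 : 8 * F ≤ C' * F := mul_le_mul_of_nonneg_right (by linarith) pF
  have a4 : C' * (N0 + 2 * N1) ≤ C' * F := mul_le_mul_of_nonneg_left (by linarith) (by linarith)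
  have a5 : 8 * N1 ≤ C' * N1 := mul_le_mul_of_nonneg_right (by linarith) pN1
  have a6 : 0 ≤ C' * N0 := mul_nonneg (by linarith) pN0
  have b2 : N2 ≤ C' * F := by linarith
  have b1 : P1 ≤ 9 * (C' * F) := by linarith
  have b0 : P0 ≤ C' * F := by linarith
  have a7 : C' * P0 ≤ C' * (C' * F) := mul_le_mul_of_nonneg_left b0 (by linarith)
  have a8 : C * P0 ≤ C' * P0 := mul_le_mul_of_nonneg_right hCC.le pP0
  have a9 : 8 * (C' * F) ≤ C' * (C' * F) := by
    nlinarith [mul_nonneg (by linarith : (0 : ℝ) ≤ C') pF]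
  have a10 : C' ^ 2 * N0 ≤ C' * (C' * F) := by
    nlinarith [mul_nonneg (by linarith : (0 : ℝ) ≤ C') (by linarith : (0:ℝ) ≤ F - N0)]
  have b3 : Z ≤ 60 * (C' * (C' * F)) := by linarith
  nlinarith

/-- The toolbox estimate for a test function. -/
theorem toolbox_test {φ ψ : Sp d → ℝ} {C C' : ℝ} (h8 : 8 < C) (hCC : C < C')
    (hφ : ContDiff ℝ 2 φ) (hC : HasConstants φ C C') (hψ : IsTest ψ) :
    (∫ x, ψ x ^ 2 ∂(gibbs φ)) ≤ (∫ x, diffOp φ ψ x ^ 2 ∂(gibbs φ)) ∧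
    (∫ x, hessNorm ψ x ^ 2 ∂(gibbs φ)) + (∫ x, wgt φ x ^ 2 * gradSq ψ x ∂(gibbs φ)) +
      (∫ x, (wgt φ x ^ 2 * ψ x) ^ 2 ∂(gibbs φ)) ≤
        196 * C' ^ 2 * ∫ x, diffOp φ ψ x ^ 2 ∂(gibbs φ) := by
  have hφ1 : ContDiff ℝ 1 φ := hφ.of_le (by norm_num)
  have hψ2 : ContDiff ℝ 2 ψ := hψ.contDiff_of 2
  have hψ1 : ContDiff ℝ 1 ψ := hψ.contDiff_of 1
  have hw := contDiff_wgt hφ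
  have c1 := continuous_gradSq hφ1
  have c2 := continuous_gradSq hψ1
  have c3 := hψ2.continuous
  have c4 := continuous_diffOp hφ1 hψ2
  have c5 := continuous_hessNorm hψ2
  have z : ∀ x ∉ tsupport ψ, ψ x = 0 ∧ diffOp φ ψ x = 0 ∧ gradSq ψ x = 0 ∧ hessNorm ψ x = 0 :=
    fun x hx => ⟨eq_zero_of_notMem_tsupport hx, diffOp_eq_zero_of_notMem_tsupport hψ2 hx,
      gradSq_eq_zero_of_notMem_tsupport hx, hessNorm_eq_zero_of_notMem_tsupport hx⟩
  have hI : ∀ {f : Sp d → ℝ}, Continuous f → (∀ x ∉ tsupport ψ, f x = 0) →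
      Integrable f (gibbs φ) := fun hf h0 => integrable_gibbs hφ.continuous hf hψ.2.isCompact h0
  have iF : Integrable (fun x => diffOp φ ψ x ^ 2) (gibbs φ) :=
    hI (by fun_prop) fun x hx => by simp [z x hx]
  have iN0 : Integrable (fun x => ψ x ^ 2) (gibbs φ) :=
    hI (by fun_prop) fun x hx => by simp [z x hx]
  have iN1 : Integrable (fun x => gradSq ψ x) (gibbs φ) :=
    hI (by fun_prop) fun x hx => by simp [z x hx]
  have iN2 : Integrable (fun x => hessNorm ψ x ^ 2) (gibbs φ) :=
    hI (by fun_prop) fun x hx => by simp [z x hx]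
  have iP0 : Integrable (fun x => gradSq φ x * ψ x ^ 2) (gibbs φ) :=
    hI (by fun_prop) fun x hx => by simp [z x hx]
  have iP1 : Integrable (fun x => gradSq φ x * gradSq ψ x) (gibbs φ) :=
    hI (by fun_prop) fun x hx => by simp [z x hx]
  have iZ : Integrable (fun x => gradSq φ x ^ 2 * ψ x ^ 2) (gibbs φ) :=
    hI (by fun_prop) fun x hx => by simp [z x hx]
  set F := ∫ x, diffOp φ ψ x ^ 2 ∂(gibbs φ) with hF
  set N0 := ∫ x, ψ x ^ 2 ∂(gibbs φ) with hN0
  set N1 := ∫ x, gradSq ψ x ∂(gibbs φ) with hN1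
  set N2 := ∫ x, hessNorm ψ x ^ 2 ∂(gibbs φ) with hN2
  set P0 := ∫ x, gradSq φ x * ψ x ^ 2 ∂(gibbs φ) with hP0
  set P1 := ∫ x, gradSq φ x * gradSq ψ x ∂(gibbs φ) with hP1
  set Z := ∫ x, gradSq φ x ^ 2 * ψ x ^ 2 ∂(gibbs φ) with hZ
  have pN0 : 0 ≤ N0 := integral_nonneg fun x => sq_nonneg _
  have pN1 : 0 ≤ N1 := integral_nonneg fun x => gradSq_nonneg _ _
  have pP0 : 0 ≤ P0 := integral_nonneg fun x => mul_nonneg (gradSq_nonneg _ _) (sq_nonneg _)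
  have pP1 : 0 ≤ P1 := integral_nonneg fun x => mul_nonneg (gradSq_nonneg _ _) (gradSq_nonneg _ _)
  have e1 : 0 ≤ F - N0 - 2 * N1 := by
    have h := integral_diffOp_energy hφ1 hψ2 hψ.2
    rwa [integral_sub (by fun_prop) (by fun_prop), integral_sub (by fun_prop) (by fun_prop),
      integral_const_mul] at h
  have e2 : 0 ≤ (C - 1) / 2 * N0 + 8 * N1 - P0 := by
    have h := integral_gradSq_mul_sq_le hφ hC hψ1 hψ.2
    rwa [integral_sub (by fun_prop) (by fun_prop), integral_add (by fun_prop) (by fun_prop),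
      integral_const_mul, integral_const_mul] at h
  have e3 : 0 ≤ (C - 1) / 2 * N1 + 8 * N2 - P1 := by
    have h := integral_gradSq_mul_gradSq_le hφ hC hψ
    rwa [integral_sub (by fun_prop) (by fun_prop), integral_add (by fun_prop) (by fun_prop),
      integral_const_mul, integral_const_mul] at h
  have e4 : 0 ≤ F + (4 * Real.sqrt C)⁻¹ * (P1 + C' * N1) - N2 := by
    have h := integral_bochner hφ hC hψ
    simp only [add_mul] at h
    rwa [integral_sub (by fun_prop) (by fun_prop), integral_add (by fun_prop) (by fun_prop),
      integral_const_mul, integral_add (by fun_prop) (by fun_prop), integral_const_mul] at h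
  -- Poincaré for `a = ⌊∇φ⌉ψ`. The term where the derivative hits the weight is at most `16ψ²|D²φ|²
  -- ≤ ψ²(|∇φ|⁴ + C'²)/4`, so three quarters of `Z` remain.
  have e5 : 0 ≤ ((C - 1) / 2 + C' ^ 2 / 4) * N0 + ((C - 1) / 2 - 1) * P0 + 16 * N1 + 16 * P1
      - 3 / 4 * Z := by
    have h := integral_gradSq_mul_sq_le hφ hC (hw.mul hψ1) hψ.2.mul_left
    have hle : 0 ≤ ∫ x, (((C - 1) / 2 + C' ^ 2 / 4) * ψ x ^ 2 +
        ((C - 1) / 2 - 1) * (gradSq φ x * ψ x ^ 2) + 16 * gradSq ψ x +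
        16 * (gradSq φ x * gradSq ψ x) - 3 / 4 * (gradSq φ x ^ 2 * ψ x ^ 2)) ∂(gibbs φ) := by
      refine h.trans (integral_mono (hI ?_ fun x hx => ?_) (by fun_prop) fun x => ?_)
      · have := continuous_gradSq (hw.mul hψ1)
        have := hw.continuous
        fun_prop
      · have h1 : x ∉ tsupport (fun y => wgt φ y * ψ y) := fun h =>
          hx (tsupport_mul_subset_right h)
        rw [gradSq_eq_zero_of_notMem_tsupport h1]
        simp [z x hx]
      · have k1 := gradSq_mul_le hw hψ1 x
        have k2 := gradSq_wgt_le hφ x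
        have k3 := hC.hessNorm_sq_le h8 x
        have k4 : 64 * (ψ x ^ 2 * gradSq (wgt φ) x) ≤ ψ x ^ 2 * (gradSq φ x ^ 2 + C' ^ 2) := by
          nlinarith [sq_nonneg (ψ x)]
        simp only [mul_pow, wgt_sq] at k1 ⊢
        linarith
    rwa [integral_sub (by fun_prop) (by fun_prop), integral_add (by fun_prop) (by fun_prop),
      integral_add (by fun_prop) (by fun_prop), integral_add (by fun_prop) (by fun_prop),
      integral_const_mul, integral_const_mul, integral_const_mul, integral_const_mul,
      integral_const_mul] at hle
  have q1 : ∫ x, wgt φ x ^ 2 * gradSq ψ x ∂(gibbs φ) = N1 + P1 := by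
    rw [← integral_add iN1 iP1]
    exact integral_congr_ae (Eventually.of_forall fun x => by simp only [wgt_sq]; ring)
  have q0 : ∫ x, (wgt φ x ^ 2 * ψ x) ^ 2 ∂(gibbs φ) = N0 + 2 * P0 + Z := by
    have h : ∫ x, (wgt φ x ^ 2 * ψ x) ^ 2 ∂(gibbs φ) = ∫ x, (ψ x ^ 2 +
        2 * (gradSq φ x * ψ x ^ 2) + gradSq φ x ^ 2 * ψ x ^ 2) ∂(gibbs φ) :=
      integral_congr_ae (Eventually.of_forall fun x => by simp only [wgt_sq]; ring)
    rw [h, integral_add (by fun_prop) (by fun_prop), integral_add (by fun_prop) (by fun_prop),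
      integral_const_mul]
  rw [q1, q0]
  exact toolbox_arith h8 hCC pN0 pN1 pP0 pP1 e1 e2 e3 e4 e5

/-! ### Mollification -/

/-- A sequence of normalized bump functions shrinking to the origin. -/
noncomputable def mollBump (d n : ℕ) : ContDiffBump (0 : Sp d) where
  rIn := 1 / (2 * ((n : ℝ) + 1))
  rOut := 1 / ((n : ℝ) + 1)
  rIn_pos := by positivity
  rIn_lt_rOut := by
    have : (0 : ℝ) < (n : ℝ) + 1 := by positivity
    exact one_div_lt_one_div_of_lt this (by linarith)

/-- The mollifying kernel. -/
noncomputable def kern (d n : ℕ) : Sp d → ℝ := (mollBump d n).normed volume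

/-- The mollification of a function. -/
noncomputable def moll (n : ℕ) (f : Sp d → ℝ) : Sp d → ℝ :=
  kern d n ⋆[ContinuousLinearMap.lsmul ℝ ℝ, volume] f

theorem moll_apply (n : ℕ) (f : Sp d → ℝ) (x : Sp d) :
    moll n f x = ∫ t, kern d n t * f (x - t) := rfl

theorem kern_nonneg (n : ℕ) (x : Sp d) : 0 ≤ kern d n x := (mollBump d n).nonneg_normed x

theorem isTest_kern (n : ℕ) : IsTest (kern d n) :=
  ⟨(mollBump d n).contDiff_normed (n := ⊤), (mollBump d n).hasCompactSupport_normed⟩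

theorem integral_kern (n : ℕ) : ∫ x, kern d n x = 1 := (mollBump d n).integral_normed

/-- The radii `1/(n+1)` never exceed 1, so one unit thickening of a compact set carries all
mollifications at once. -/
theorem kern_eq_zero {n : ℕ} {x : Sp d} (hx : 1 < ‖x‖) : kern d n x = 0 := by
  have h : x ∉ Function.support (kern d n) := by
    rw [kern, (mollBump d n).support_normed_eq, Metric.mem_ball, dist_zero_right, not_lt]
    refine le_trans ?_ hx.le
    change 1 / ((n : ℝ) + 1) ≤ 1
    rw [div_le_one (by positivity)]
    have : (0 : ℝ) ≤ n := Nat.cast_nonneg n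
    linarith
  simpa using h

theorem tendsto_rOut_mollBump : Tendsto (fun n => (mollBump d n).rOut) atTop (𝓝 0) :=
  tendsto_one_div_add_atTop_nhds_zero_nat

theorem contDiff_moll (n : ℕ) {f : Sp d → ℝ} (hf : LocallyIntegrable f volume) :
    ContDiff ℝ ∞ (moll n f) :=
  (isTest_kern n).2.contDiff_convolution_left (n := ⊤) _ (isTest_kern n).1 hf

theorem pd_convolution_left {a f : Sp d → ℝ} (ha : ContDiff ℝ 1 a) (hc : HasCompactSupport a)
    (hf : LocallyIntegrable f volume) (i : Fin d) (x : Sp d) :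
    pd i (a ⋆[ContinuousLinearMap.lsmul ℝ ℝ, volume] f) x =
      (pd i a ⋆[ContinuousLinearMap.lsmul ℝ ℝ, volume] f) x := by
  have h := hc.hasFDerivAt_convolution_left (ContinuousLinearMap.lsmul ℝ ℝ) ha hf x
  rw [pd, h.fderiv]
  have hex : ConvolutionExistsAt (fderiv ℝ a) f x
      ((ContinuousLinearMap.lsmul ℝ ℝ).precompL (Sp d)) volume :=
    (hc.fderiv ℝ).convolutionExists_left _ (ha.continuous_fderiv (by norm_num)) hf x
  rw [convolution_def, ContinuousLinearMap.integral_apply hex]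
  rfl

theorem pd_moll {f : Sp d → ℝ} (hf : ContDiff ℝ 1 f) (hc : HasCompactSupport f) (n : ℕ)
    (i : Fin d) (x : Sp d) : pd i (moll n f) x = moll n (pd i f) x := by
  have hk : LocallyIntegrable (kern d n) volume := (isTest_kern n).1.continuous.locallyIntegrable
  have h := hc.hasFDerivAt_convolution_right (ContinuousLinearMap.lsmul ℝ ℝ) hk hf x
  rw [pd, moll, h.fderiv]
  have hex : ConvolutionExistsAt (kern d n) (fderiv ℝ f) x
      ((ContinuousLinearMap.lsmul ℝ ℝ).precompR (Sp d)) volume :=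
    (hc.fderiv ℝ).convolutionExists_right _ hk (hf.continuous_fderiv (by norm_num)) x
  rw [convolution_def, ContinuousLinearMap.integral_apply hex]
  rfl

/-- Locality of mollification; it permits replacing a function that is only locally square
integrable by a truncation. -/
theorem moll_congr_on {f g : Sp d → ℝ} {x : Sp d} (h : ∀ t, ‖t‖ ≤ 1 → f (x - t) = g (x - t))
    (n : ℕ) : moll n f x = moll n g x := by
  rw [moll_apply, moll_apply]
  refine integral_congr_ae (Eventually.of_forall fun t => ?_)
  by_cases ht : ‖t‖ ≤ 1
  · simp only [h t ht]
  · simp only [kern_eq_zero (not_le.1 ht), zero_mul]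

theorem moll_eq_zero {f : Sp d → ℝ} {K : Set (Sp d)} (h0 : ∀ x ∉ K, f x = 0) {x : Sp d}
    (hx : x ∉ Metric.cthickening 1 K) (n : ℕ) : moll n f x = 0 := by
  rw [moll_congr_on (g := fun _ => 0) (fun t ht => h0 _ fun hK => hx ?_), moll_apply]
  · simp
  · exact Metric.mem_cthickening_of_dist_le x (x - t) 1 K hK (by simpa [dist_eq_norm] using ht)

theorem tendsto_moll {f : Sp d → ℝ} (hf : Continuous f) (x : Sp d) :
    Tendsto (fun n => moll n f x) atTop (𝓝 (f x)) :=
  ContDiffBump.convolution_tendsto_right_of_continuous tendsto_rOut_mollBump hf x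

theorem abs_moll_le {f : Sp d → ℝ} {M : ℝ} (hM : ∀ x, |f x| ≤ M) (n : ℕ) (x : Sp d) :
    |moll n f x| ≤ M := by
  rw [moll_apply]
  have h := norm_integral_le_of_norm_le (μ := volume) (f := fun t => kern d n t * f (x - t))
    (g := fun t => kern d n t * M)
    (((mollBump d n).integrable_normed).mul_const M)
    (Eventually.of_forall fun t => by
      rw [norm_mul, Real.norm_of_nonneg (kern_nonneg n t)]
      exact mul_le_mul_of_nonneg_left (hM _) (kern_nonneg n t))
  rwa [integral_mul_const, integral_kern, one_mul] at h

theorem IsTest.moll {f : Sp d → ℝ} (hf : Continuous f) (hc : HasCompactSupport f) (n : ℕ) :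
    IsTest (moll n f) :=
  ⟨contDiff_moll n hf.locallyIntegrable,
    HasCompactSupport.convolution _ (isTest_kern n).2 hc⟩

/-- Testing against the mollification of a continuous function with compact support. -/
theorem tendsto_integral_mul_moll {f χ : Sp d → ℝ} (hf : LocallyIntegrable f volume)
    (hχ : Continuous χ) (hc : HasCompactSupport χ) :
    Tendsto (fun n => ∫ x, f x * moll n χ x) atTop (𝓝 (∫ x, f x * χ x)) := by
  obtain ⟨M, hM⟩ := hc.exists_bound_of_continuous hχ
  set K := Metric.cthickening 1 (tsupport χ)
  have hK : IsCompact K := hc.isCompact.cthickening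
  refine tendsto_integral_of_dominated_convergence
    (fun x => K.indicator (fun y => ‖f y‖ * M) x) (fun n => ?_) ?_ (fun n => ?_) ?_
  · exact hf.aestronglyMeasurable.mul (IsTest.moll hχ hc n).1.continuous.aestronglyMeasurable
  · rw [integrable_indicator_iff hK.measurableSet]
    exact (hf.integrableOn_isCompact hK).norm.mul_const M
  · refine Eventually.of_forall fun x => ?_
    by_cases hx : x ∈ K
    · rw [Set.indicator_of_mem hx, norm_mul]
      exact mul_le_mul_of_nonneg_left (abs_moll_le hM n x) (norm_nonneg _)
    · rw [Set.indicator_of_notMem hx, moll_eq_zero (fun y => eq_zero_of_notMem_tsupport) hx]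
      simp
  · exact Eventually.of_forall fun x => (tendsto_moll hχ x).const_mul _

/-! ### Mollification in `L²` -/

theorem aestronglyMeasurable_moll {f : Sp d → ℝ} (hf : LocallyIntegrable f volume) (n : ℕ) :
    AEStronglyMeasurable (moll n f) volume :=
  (contDiff_moll n hf).continuous.aestronglyMeasurable

/-- The kernel is a probability density, so `|moll n f|²` is at most the average of the translates
of `|f|²`; Tonelli and translation invariance conclude. -/
theorem eLpNorm_moll_le {f : Sp d → ℝ} (hf : AEStronglyMeasurable f volume) (n : ℕ) :
    eLpNorm (moll n f) 2 volume ≤ eLpNorm f 2 volume := by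
  -- Tonelli is applied to `(x, t) ↦ f (x - t)`, whose measurability is immediate for a strongly
  -- measurable representative; the convolution ignores null sets.
  wlog hm : StronglyMeasurable f generalizing f
  · have h1 : moll n f = moll n (hf.mk f) :=
      convolution_congr _ (Eventually.of_forall fun _ => rfl) hf.ae_eq_mk
    rw [h1, eLpNorm_congr_ae hf.ae_eq_mk]
    exact this hf.stronglyMeasurable_mk.aestronglyMeasurable hf.stronglyMeasurable_mk
  have hkc : Continuous (kern d n) := (isTest_kern n).1.continuous
  set ν : Measure (Sp d) := volume.withDensity fun t => ENNReal.ofReal (kern d n t) with hν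
  have hint : ∀ g : Sp d → ℝ, ∫ t, g t ∂ν = ∫ t, kern d n t * g t := by
    intro g
    rw [hν, integral_withDensity_eq_integral_toReal_smul (by fun_prop) (by simp)]
    simp [ENNReal.toReal_ofReal (kern_nonneg n _)]
  have hkint : Integrable (kern d n) volume := (mollBump d n).integrable_normed
  have : IsProbabilityMeasure ν := ⟨by
    rw [hν, withDensity_apply _ MeasurableSet.univ, Measure.restrict_univ,
      ← ofReal_integral_eq_lintegral_ofReal hkint
        (Eventually.of_forall (kern_nonneg n)), integral_kern, ENNReal.ofReal_one]⟩
  have hmeas : Measurable f := hm.measurable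
  have hpt : ∀ x, ‖moll n f x‖ₑ ^ 2 ≤ ∫⁻ t, ‖f (x - t)‖ₑ ^ 2 ∂ν := by
    intro x
    have hms : AEStronglyMeasurable (fun t => f (x - t)) ν :=
      (hmeas.comp (measurable_const.sub measurable_id)).aestronglyMeasurable
    have h1 : ‖moll n f x‖ₑ ≤ eLpNorm (fun t => f (x - t)) 2 ν := by
      rw [moll_apply, ← hint fun t => f (x - t)]
      refine (enorm_integral_le_lintegral_enorm _).trans ?_
      rw [← eLpNorm_one_eq_lintegral_enorm]
      exact eLpNorm_le_eLpNorm_of_exponent_le (by norm_num) hms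
    calc ‖moll n f x‖ₑ ^ 2 ≤ eLpNorm (fun t => f (x - t)) 2 ν ^ 2 := by gcongr
      _ = _ := by
        have := eLpNorm_nnreal_pow_eq_lintegral (p := 2) (μ := ν) (f := fun t => f (x - t))
          (by norm_num)
        norm_num at this
        exact_mod_cast this
  have hsq : ∀ g : Sp d → ℝ, eLpNorm g 2 volume ^ 2 = ∫⁻ x, ‖g x‖ₑ ^ 2 := by
    intro g
    have := eLpNorm_nnreal_pow_eq_lintegral (p := 2) (μ := (volume : Measure (Sp d))) (f := g)
      (by norm_num)
    norm_num at this
    exact_mod_cast this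
  rw [← ENNReal.pow_le_pow_left_iff two_ne_zero, hsq, hsq]
  calc ∫⁻ x, ‖moll n f x‖ₑ ^ 2 ≤ ∫⁻ x, ∫⁻ t, ‖f (x - t)‖ₑ ^ 2 ∂ν := lintegral_mono hpt
    _ = ∫⁻ t, (∫⁻ x, ‖f (x - t)‖ₑ ^ 2) ∂ν := by
      refine lintegral_lintegral_swap ?_
      exact ((hmeas.comp (measurable_fst.sub measurable_snd)).enorm.pow_const 2).aemeasurable
    _ = ∫⁻ _, (∫⁻ x, ‖f x‖ₑ ^ 2) ∂ν := by
      refine lintegral_congr fun t => ?_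
      exact lintegral_sub_right_eq_self (fun x => ‖f x‖ₑ ^ 2) t
    _ = ∫⁻ x, ‖f x‖ₑ ^ 2 := by simp

theorem memLp_moll {f : Sp d → ℝ} (hf : MemLp f 2 volume) (n : ℕ) :
    MemLp (moll n f) 2 volume :=
  ⟨aestronglyMeasurable_moll (hf.locallyIntegrable (by norm_num)) n,
    (eLpNorm_moll_le hf.1 n).trans_lt hf.2⟩

theorem moll_sub {f g : Sp d → ℝ} (hf : LocallyIntegrable f volume)
    (hg : LocallyIntegrable g volume) (n : ℕ) : moll n (f - g) = moll n f - moll n g := by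
  funext x
  have h : ∀ {k : Sp d → ℝ}, LocallyIntegrable k volume →
      Integrable (fun t => kern d n t * k (x - t)) volume := fun hk =>
    (isTest_kern n).2.convolutionExists_left (ContinuousLinearMap.lsmul ℝ ℝ)
      (isTest_kern n).1.continuous hk x
  simp only [Pi.sub_apply, moll_apply, mul_sub]
  exact integral_sub (h hf) (h hg)

theorem tendsto_eLpNorm_moll_sub_of_continuous {g : Sp d → ℝ} (hg : Continuous g)
    (hc : HasCompactSupport g) :
    Tendsto (fun n => eLpNorm (moll n g - g) 2 volume) atTop (𝓝 0) := by
  obtain ⟨M, hM⟩ := hc.exists_bound_of_continuous hg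
  set K := Metric.cthickening 1 (tsupport g)
  have hK : IsCompact K := hc.isCompact.cthickening
  have hsq : ∀ k : Sp d → ℝ, eLpNorm k 2 volume = (∫⁻ x, ‖k x‖ₑ ^ 2) ^ ((1 : ℝ) / 2) := by
    intro k
    rw [eLpNorm_eq_lintegral_rpow_enorm_toReal (by norm_num) (by norm_num)]
    norm_num
  simp only [hsq]
  have h0 : Tendsto (fun n => ∫⁻ x, ‖(moll n g - g) x‖ₑ ^ 2) atTop
      (𝓝 (∫⁻ _ : Sp d, (0 : ℝ≥0∞))) := by
    refine tendsto_lintegral_of_dominated_convergence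
      (fun x => K.indicator (fun _ => ENNReal.ofReal (2 * M) ^ 2) x) (fun n => ?_) (fun n => ?_)
      ?_ ?_
    · have := (contDiff_moll n hg.locallyIntegrable).continuous
      have h : Continuous (moll n g - g) := this.sub hg
      exact (h.measurable.enorm).pow_const 2
    · refine Eventually.of_forall fun x => ?_
      by_cases hx : x ∈ K
      · simp only [Set.indicator_of_mem hx, Pi.sub_apply]
        gcongr
        rw [Real.enorm_eq_ofReal_abs]
        refine ENNReal.ofReal_le_ofReal ((abs_sub _ _).trans ?_)
        have h1 := abs_moll_le hM n x
        have h2 := hM x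
        rw [Real.norm_eq_abs] at h2
        linarith
      · have h1 : g x = 0 := eq_zero_of_notMem_tsupport fun h =>
          hx (Metric.self_subset_cthickening _ h)
        simp [Pi.sub_apply, moll_eq_zero (fun y => eq_zero_of_notMem_tsupport) hx, h1]
    · rw [lintegral_indicator hK.measurableSet, setLIntegral_const]
      exact ENNReal.mul_ne_top (by finiteness) hK.measure_lt_top.ne
    · refine Eventually.of_forall fun x => ?_
      have h1 : Tendsto (fun n => (moll n g - g) x) atTop (𝓝 0) := by
        simpa using (tendsto_moll hg x).sub_const (g x)
      have h2 := (ENNReal.continuous_pow 2).continuousAt.tendsto.comp h1.enorm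
      simpa [Function.comp_def] using h2
  have h1 := h0.ennrpow_const ((1 : ℝ) / 2)
  simpa using h1

/-- An `ε/3` argument: mollification is a contraction, and continuous functions with compact support
are dense. -/
theorem tendsto_eLpNorm_moll_sub {f : Sp d → ℝ} (hf : MemLp f 2 volume) :
    Tendsto (fun n => eLpNorm (moll n f - f) 2 volume) atTop (𝓝 0) := by
  rw [ENNReal.tendsto_atTop_zero]
  intro ε hε
  obtain ⟨g, hgc, hgf, hgcont, hgm⟩ := hf.exists_hasCompactSupport_eLpNorm_sub_le
    (by norm_num) (ε := ε / 3) (ENNReal.div_pos hε.ne' (by norm_num)).ne'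
  obtain ⟨N, hN⟩ := (ENNReal.tendsto_atTop_zero.1
    (tendsto_eLpNorm_moll_sub_of_continuous hgcont hgc)) (ε / 3)
    (ENNReal.div_pos hε.ne' (by norm_num))
  refine ⟨N, fun n hn => ?_⟩
  have hfl := hf.locallyIntegrable (by norm_num)
  have hgl : LocallyIntegrable g volume := hgcont.locallyIntegrable
  have e : moll n f - f = moll n (f - g) + ((moll n g - g) - (f - g)) := by
    rw [moll_sub hfl hgl]
    abel
  have m1 : MemLp (moll n (f - g)) 2 volume := memLp_moll (hf.sub hgm) n
  have m2 : MemLp (moll n g - g) 2 volume := (memLp_moll hgm n).sub hgm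
  calc eLpNorm (moll n f - f) 2 volume
      ≤ eLpNorm (moll n (f - g)) 2 volume + eLpNorm ((moll n g - g) - (f - g)) 2 volume := by
        rw [e]
        exact eLpNorm_add_le m1.1 (m2.sub (hf.sub hgm)).1 (by norm_num)
    _ ≤ ε / 3 + (ε / 3 + ε / 3) := by
        refine add_le_add ((eLpNorm_moll_le (hf.sub hgm).1 n).trans hgf) ?_
        exact (eLpNorm_sub_le m2.1 (hf.sub hgm).1 (by norm_num)).trans (add_le_add (hN n hn) hgf)
    _ = ε := by rw [← add_assoc, ENNReal.add_thirds]

/-- Weighted products of mollifications converge. -/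
theorem tendsto_integral_moll_mul_moll {a f g : Sp d → ℝ} (ha : Continuous a)
    (hc : HasCompactSupport a) (hf : MemLp f 2 volume) (hg : MemLp g 2 volume) :
    Tendsto (fun n => ∫ x, a x * moll n f x * moll n g x) atTop
      (𝓝 (∫ x, a x * f x * g x)) := by
  obtain ⟨M, hM⟩ := hc.exists_bound_of_continuous ha
  have hM0 : 0 ≤ M := (norm_nonneg _).trans (hM 0)
  have haf : ∀ {k : Sp d → ℝ}, MemLp k 2 volume → MemLp (fun x => a x * k x) 2 volume :=
    fun {k} hk => MemLp.of_le_mul (c := M) hk (ha.aestronglyMeasurable.mul hk.1)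
      (Eventually.of_forall fun x => by
        rw [norm_mul]
        exact mul_le_mul_of_nonneg_right (hM x) (norm_nonneg _))
  have t1 : Tendsto (fun n => (haf (memLp_moll hf n)).toLp) atTop (𝓝 (haf hf).toLp) := by
    rw [Lp.tendsto_Lp_iff_tendsto_eLpNorm'']
    have h := ENNReal.Tendsto.const_mul (a := ENNReal.ofReal M) (tendsto_eLpNorm_moll_sub hf)
      (Or.inr ENNReal.ofReal_ne_top)
    rw [mul_zero] at h
    refine tendsto_of_tendsto_of_tendsto_of_le_of_le tendsto_const_nhds h (fun _ => zero_le)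
      fun n => ?_
    refine eLpNorm_le_mul_eLpNorm_of_ae_le_mul (Eventually.of_forall fun x => ?_) 2
    simp only [Pi.sub_apply]
    rw [← mul_sub, norm_mul]
    exact mul_le_mul_of_nonneg_right (hM x) (norm_nonneg _)
  have t2 : Tendsto (fun n => (memLp_moll hg n).toLp) atTop (𝓝 hg.toLp) := by
    rw [Lp.tendsto_Lp_iff_tendsto_eLpNorm'']
    exact tendsto_eLpNorm_moll_sub hg
  have t3 := t1.inner (𝕜 := ℝ) t2
  have key : ∀ {u v : Sp d → ℝ} (hu : MemLp u 2 volume) (hv : MemLp v 2 volume),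
      inner ℝ hu.toLp hv.toLp = ∫ x, u x * v x := by
    intro u v hu hv
    rw [L2.inner_def]
    refine integral_congr_ae ?_
    filter_upwards [hu.coeFn_toLp, hv.coeFn_toLp] with x h1 h2
    rw [h1, h2]
    simp [mul_comm]
  simpa only [key] using t3

/-! ### Testing weak identities against functions of finite smoothness -/

theorem locallyIntegrable_continuous_mul {f a : Sp d → ℝ} {μ : Measure (Sp d)}
    (hf : LocallyIntegrable f μ) (ha : Continuous a) : LocallyIntegrable (fun x => a x * f x) μ := by
  rw [locallyIntegrable_iff] at hf ⊢
  exact fun K hK => (hf K hK).continuousOn_mul ha.continuousOn hK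

theorem integrable_mul_of_hasCompactSupport {f a : Sp d → ℝ} {μ : Measure (Sp d)}
    (hf : LocallyIntegrable f μ) (ha : Continuous a) (hc : HasCompactSupport a) :
    Integrable (fun x => f x * a x) μ := by
  simpa [mul_comm] using hf.integrable_smul_left_of_hasCompactSupport ha hc

/-- Weak partial derivatives can be tested against `C¹` functions with compact support. -/
theorem HasWeakPartial.integral_eq {i : Fin d} {f g χ : Sp d → ℝ} (h : HasWeakPartial i f g)
    (hχ : ContDiff ℝ 1 χ) (hc : HasCompactSupport χ) :
    ∫ x, f x * pd i χ x = -∫ x, g x * χ x := by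
  have t1 := tendsto_integral_mul_moll h.1 (continuous_pd hχ i) (hasCompactSupport_pd hc i)
  have t2 := (tendsto_integral_mul_moll h.2.1 hχ.continuous hc).neg
  refine tendsto_nhds_unique t1 (t2.congr fun n => ?_)
  rw [← h.2.2 _ (IsTest.moll hχ.continuous hc n)]
  -- Mollification commutes with `∂_i`, so the mollified integrals are instances of the definition
  -- with a smooth test function.
  simp only [pd_moll hχ hc]

/-- If `h` is orthogonal to `Λψ` for all test functions `ψ`, then for all `C²` functions with
compact support. -/
theorem integral_mul_diffOp_eq_zero {φ h ψ : Sp d → ℝ} (hφ : ContDiff ℝ 1 φ)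
    (hh : LocallyIntegrable h volume)
    (h0 : ∀ η, IsTest η → ∫ x, h x * diffOp φ η x ∂(gibbs φ) = 0) (hψ : ContDiff ℝ 2 ψ)
    (hc : HasCompactSupport ψ) : ∫ x, h x * diffOp φ ψ x ∂(gibbs φ) = 0 := by
  have hk : LocallyIntegrable (fun x => Real.exp (-φ x) * h x) volume := by
    have := hφ.continuous
    exact locallyIntegrable_continuous_mul hh (by fun_prop)
  set k : Sp d → ℝ := fun x => Real.exp (-φ x) * h x with hkdef
  have hki : ∀ i, LocallyIntegrable (fun x => pd i φ x * k x) volume := fun i =>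
    locallyIntegrable_continuous_mul hk (continuous_pd hφ i)
  have hψ1 : ContDiff ℝ 1 ψ := hψ.of_le (by norm_num)
  have hp : ∀ i, ContDiff ℝ 1 (pd i ψ) := contDiff_one_pd hψ
  have hcp : ∀ i, HasCompactSupport (pd i ψ) := hasCompactSupport_pd hc
  -- Written against Lebesgue measure, each derivative of `χ` has a locally integrable coefficient,
  -- so the terms can be mollified one by one.
  have expand : ∀ {χ : Sp d → ℝ}, ContDiff ℝ 2 χ → HasCompactSupport χ →
      ∫ x, h x * diffOp φ χ x ∂(gibbs φ) = (∑ i, (-(∫ x, k x * pd i (pd i χ) x) +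
        ∫ x, pd i φ x * k x * pd i χ x)) + ∫ x, k x * χ x := by
    intro χ hχ hχc
    have i1 : ∀ i, Integrable (fun x => k x * pd i (pd i χ) x) volume := fun i =>
      integrable_mul_of_hasCompactSupport hk (continuous_pd (contDiff_one_pd hχ i) i)
        (hasCompactSupport_pd (hasCompactSupport_pd hχc i) i)
    have i2 : ∀ i, Integrable (fun x => pd i φ x * k x * pd i χ x) volume := fun i =>
      integrable_mul_of_hasCompactSupport (hki i) (continuous_pd (hχ.of_le (by norm_num)) i)
        (hasCompactSupport_pd hχc i)
    have i3 : Integrable (fun x => k x * χ x) volume :=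
      integrable_mul_of_hasCompactSupport hk hχ.continuous hχc
    have i4 : ∀ i ∈ Finset.univ, Integrable (fun x => -(k x * pd i (pd i χ) x) +
        pd i φ x * k x * pd i χ x) volume := fun i _ => (i1 i).neg.add (i2 i)
    have e : ∀ i, -(∫ x, k x * pd i (pd i χ) x) + ∫ x, pd i φ x * k x * pd i χ x =
        ∫ x, (-(k x * pd i (pd i χ) x) + pd i φ x * k x * pd i χ x) := by
      intro i
      rw [← integral_neg, integral_add (i1 i).fun_neg (i2 i)]
    rw [integral_gibbs hφ.continuous, Finset.sum_congr rfl fun i _ => e i,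
      ← integral_finsetSum _ i4, ← integral_add (integrable_finsetSum _ i4) i3]
    refine integral_congr_ae (Eventually.of_forall fun x => ?_)
    simp only [diffOp_eq φ hχ, hkdef, mul_add, Finset.mul_sum]
    congr 1
    · exact Finset.sum_congr rfl fun i _ => by ring
    · ring
  have hm : ∀ n, IsTest (moll n ψ) := IsTest.moll hψ.continuous hc
  have e1 : ∀ n i, pd i (moll n ψ) = moll n (pd i ψ) := fun n i => funext (pd_moll hψ1 hc n i)
  have e2 : ∀ n i, pd i (moll n (pd i ψ)) = moll n (pd i (pd i ψ)) := fun n i =>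
    funext (pd_moll (hp i) (hcp i) n i)
  have lim : Tendsto (fun n => ∫ x, h x * diffOp φ (moll n ψ) x ∂(gibbs φ)) atTop
      (𝓝 (∫ x, h x * diffOp φ ψ x ∂(gibbs φ))) := by
    rw [expand hψ hc]
    refine Tendsto.congr (fun n => (expand ((hm n).contDiff_of 2) (hm n).2).symm) ?_
    simp only [e1, e2]
    refine Tendsto.add (tendsto_finsetSum _ fun i _ => Tendsto.add (Tendsto.neg ?_) ?_) ?_
    · exact tendsto_integral_mul_moll hk (continuous_pd (hp i) i) (hasCompactSupport_pd (hcp i) i)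
    · exact tendsto_integral_mul_moll (hki i) (continuous_pd hψ1 i) (hcp i)
    · exact tendsto_integral_mul_moll hk hψ.continuous hc
  refine tendsto_nhds_unique lim ?_
  simp only [h0 _ (hm _)]
  exact tendsto_const_nhds

/-! ### The Schrödinger form of `Λ` -/

/-- The potential `|∇φ|²/4 - Δφ/2`. -/
noncomputable def pot (φ : Sp d → ℝ) (x : Sp d) : ℝ :=
  gradSq φ x / 4 - (∑ i, pd i (pd i φ) x) / 2

theorem continuous_pot {φ : Sp d → ℝ} (hφ : ContDiff ℝ 2 φ) : Continuous (pot φ) :=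
  ((continuous_gradSq (hφ.of_le (by norm_num))).div_const 4).sub
    ((continuous_finsetSum _ fun i _ => continuous_pd (contDiff_one_pd hφ i) i).div_const 2)

theorem pd_exp_half_mul {φ b : Sp d → ℝ} (hφ : ContDiff ℝ 1 φ) (hb : ContDiff ℝ 1 b) (i : Fin d)
    (x : Sp d) : pd i (fun y => Real.exp (1 / 2 * φ y) * b y) x =
      Real.exp (1 / 2 * φ x) * (pd i b x + 1 / 2 * (pd i φ x * b x)) := by
  have h1 : DifferentiableAt ℝ φ x := (hφ.differentiable (by norm_num)) x
  have h2 : DifferentiableAt ℝ b x := (hb.differentiable (by norm_num)) x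
  rw [pd_mul i (by fun_prop) h2, pd_exp i (h1.const_mul _), pd_const_mul i _ h1]
  ring

/-- Conjugation by `e^{φ/2}` removes the first order term: `e^{-φ/2} Λ e^{φ/2} = -Δ + 1 + V` with `V
= pot φ`. -/
theorem diffOp_exp_half_mul {φ η : Sp d → ℝ} (hφ : ContDiff ℝ 2 φ) (hη : ContDiff ℝ 2 η)
    (x : Sp d) : diffOp φ (fun y => Real.exp (1 / 2 * φ y) * η y) x =
      Real.exp (1 / 2 * φ x) * (-(∑ i, pd i (pd i η) x) + (1 + pot φ x) * η x) := by
  have hφ1 : ContDiff ℝ 1 φ := hφ.of_le (by norm_num)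
  have hη1 : ContDiff ℝ 1 η := hη.of_le (by norm_num)
  have hd : ∀ {f : Sp d → ℝ}, ContDiff ℝ 1 f → DifferentiableAt ℝ f x := fun hf =>
    (hf.differentiable (by norm_num)) x
  have hm : ∀ i, ContDiff ℝ 1 (fun y => pd i φ y * η y) := fun i =>
    (contDiff_one_pd hφ i).mul hη1
  have hc : ∀ i, ContDiff ℝ 1 (fun y => pd i η y + 1 / 2 * (pd i φ y * η y)) := fun i =>
    (contDiff_one_pd hη i).add (contDiff_const.mul (hm i))
  have hs : ContDiff ℝ 2 (fun y => Real.exp (1 / 2 * φ y) * η y) :=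
    (contDiff_const.mul hφ).exp.mul hη
  rw [diffOp_eq φ hs]
  have e : ∀ i, pd i (fun y => Real.exp (1 / 2 * φ y) * η y) = fun y =>
      Real.exp (1 / 2 * φ y) * (pd i η y + 1 / 2 * (pd i φ y * η y)) := fun i =>
    funext (pd_exp_half_mul hφ1 hη1 i)
  have e2 : ∀ i, -pd i (pd i (fun y => Real.exp (1 / 2 * φ y) * η y)) x +
      pd i φ x * pd i (fun y => Real.exp (1 / 2 * φ y) * η y) x = Real.exp (1 / 2 * φ x) *
        (-pd i (pd i η) x + (1 / 4 * pd i φ x ^ 2 - 1 / 2 * pd i (pd i φ) x) * η x) := by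
    intro i
    rw [e i, pd_exp_half_mul hφ1 (hc i), pd_add i (hd (contDiff_one_pd hη i))
      (hd (contDiff_const.mul (hm i))), pd_const_mul i _ (hd (hm i)),
      pd_mul_of_contDiff (contDiff_one_pd hφ i) hη1]
    ring
  rw [Finset.sum_congr rfl fun i _ => e2 i, ← Finset.mul_sum, Finset.sum_add_distrib,
    ← Finset.sum_mul, Finset.sum_sub_distrib, ← Finset.mul_sum, ← Finset.mul_sum,
    Finset.sum_neg_distrib, pot, gradSq]
  ring

/-- Localized energy inequality for smooth functions. -/
theorem integral_energy_nonneg {φ θ u : Sp d → ℝ} (hφ : ContDiff ℝ 2 φ) (hθ : IsTest θ)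
    (hu : ContDiff ℝ 2 u) :
    0 ≤ ∫ x, (-(θ x ^ 2 * u x * ∑ i, pd i (pd i u) x) + gradSq θ x * u x * u x +
      pot φ x * θ x ^ 2 * u x * u x) := by
  have hφ1 : ContDiff ℝ 1 φ := hφ.of_le (by norm_num)
  have hu1 : ContDiff ℝ 1 u := hu.of_le (by norm_num)
  have hθ1 : ContDiff ℝ 1 θ := hθ.contDiff_of 1
  have hθ2 : ContDiff ℝ 2 θ := hθ.contDiff_of 2
  have hφp : ∀ i, ContDiff ℝ 1 (pd i φ) := contDiff_one_pd hφ
  have hup : ∀ i, ContDiff ℝ 1 (pd i u) := contDiff_one_pd hu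
  have hθp : ∀ i, ContDiff ℝ 1 (pd i θ) := contDiff_one_pd hθ2
  -- Subtracting `∂_iG_i` from the square `(∂_i(θu) + ∂_iφ θu/2)²` removes every first derivative of
  -- `u`. The integrand is therefore a sum of squares up to a divergence.
  let G : Fin d → Sp d → ℝ := fun i y => (θ y * u y) * (θ y * pd i u y) +
    (1 / 2 * pd i φ y) * ((θ y * u y) * (θ y * u y))
  have hG : ∀ i, ContDiff ℝ 1 (G i) := fun i => by
    have := hφp i
    have := hup i
    fun_prop
  have hGc : ∀ i, HasCompactSupport (G i) := fun i =>
    HasCompactSupport.intro hθ.2.isCompact fun x hx => by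
      simp [G, eq_zero_of_notMem_tsupport hx]
  have hpt : ∀ i x, (θ x * pd i u x + pd i θ x * u x + 1 / 2 * pd i φ x * (θ x * u x)) ^ 2 -
      pd i (G i) x = -(θ x ^ 2 * u x * pd i (pd i u) x) + pd i θ x ^ 2 * u x * u x +
        (1 / 4 * pd i φ x ^ 2 - 1 / 2 * pd i (pd i φ) x) * θ x ^ 2 * u x * u x := by
    intro i x
    have hd : ∀ {f : Sp d → ℝ}, ContDiff ℝ 1 f → DifferentiableAt ℝ f x := fun hf =>
      (hf.differentiable (by norm_num)) x
    have h1 := hφp i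
    have h2 := hup i
    rw [pd_add i (hd (by fun_prop)) (hd (by fun_prop)), pd_mul_of_contDiff (by fun_prop)
      (by fun_prop), pd_mul_of_contDiff hθ1 hu1, pd_mul_of_contDiff hθ1 h2,
      pd_mul_of_contDiff (by fun_prop) (by fun_prop), pd_const_mul i _ (hd h1),
      pd_mul_of_contDiff (by fun_prop) (by fun_prop), pd_mul_of_contDiff hθ1 hu1]
    ring
  have hsum : ∀ x, -(θ x ^ 2 * u x * ∑ i, pd i (pd i u) x) + gradSq θ x * u x * u x +
      pot φ x * θ x ^ 2 * u x * u x = ∑ i, ((θ x * pd i u x + pd i θ x * u x +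
        1 / 2 * pd i φ x * (θ x * u x)) ^ 2 - pd i (G i) x) := by
    intro x
    rw [Finset.sum_congr rfl fun i _ => hpt i x]
    simp only [Finset.sum_add_distrib, ← Finset.sum_mul, Finset.sum_neg_distrib, ← Finset.mul_sum,
      Finset.sum_sub_distrib, gradSq, pot]
    ring
  simp only [hsum]
  have iq : ∀ i, Integrable (fun x => (θ x * pd i u x + pd i θ x * u x +
      1 / 2 * pd i φ x * (θ x * u x)) ^ 2) volume := fun i => by
    refine Continuous.integrable_of_hasCompactSupport ?_
      (HasCompactSupport.intro hθ.2.isCompact fun x hx => ?_)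
    · have := (hφp i).continuous
      have := (hup i).continuous
      have := (hθp i).continuous
      have := hθ1.continuous
      have := hu1.continuous
      fun_prop
    · simp [eq_zero_of_notMem_tsupport hx, pd_eq_zero_of_notMem_tsupport hx]
  have iG : ∀ i, Integrable (pd i (G i)) volume := fun i =>
    (continuous_pd (hG i) i).integrable_of_hasCompactSupport (hasCompactSupport_pd (hGc i) i)
  rw [integral_finsetSum _ fun i _ => by exact (iq i).sub (iG i)]
  refine Finset.sum_nonneg fun i _ => ?_
  rw [integral_sub (iq i) (iG i), integral_pd_eq_zero (hG i) (hGc i), sub_zero]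
  exact integral_nonneg fun x => sq_nonneg _

/-! ### Comparison of `gibbs φ` with Lebesgue measure -/

theorem gibbs_absolutelyContinuous (φ : Sp d → ℝ) : gibbs φ ≪ volume :=
  withDensity_absolutelyContinuous _ _

theorem absolutelyContinuous_gibbs {φ : Sp d → ℝ} (hφ : Continuous φ) :
    (volume : Measure (Sp d)) ≪ gibbs φ := by
  refine withDensity_absolutelyContinuous' (by fun_prop) (Eventually.of_forall fun x => ?_)
  simpa using Real.exp_pos _

theorem integrable_gibbs_iff {φ : Sp d → ℝ} (hφ : Continuous φ) (f : Sp d → ℝ) :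
    Integrable f (gibbs φ) ↔ Integrable (fun x => Real.exp (-φ x) * f x) volume := by
  rw [gibbs, integrable_withDensity_iff_integrable_smul' (by fun_prop) (by simp)]
  simp [ENNReal.toReal_ofReal (Real.exp_pos _).le]

theorem locallyIntegrable_volume_of_gibbs {φ f : Sp d → ℝ} (hφ : Continuous φ)
    (hf : LocallyIntegrable f (gibbs φ)) : LocallyIntegrable f volume := by
  rw [locallyIntegrable_iff] at hf ⊢
  intro K hK
  have h1 := hf K hK
  have h2 : IntegrableOn (fun x => Real.exp (-φ x) * f x) K volume := by
    rw [← integrable_indicator_iff hK.measurableSet] at h1 ⊢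
    rw [integrable_gibbs_iff hφ] at h1
    refine h1.congr (Eventually.of_forall fun x => ?_)
    by_cases hx : x ∈ K <;> simp [hx]
  have h3 := h2.continuousOn_mul (g := fun x => Real.exp (φ x)) (by fun_prop) hK
  refine h3.congr (Eventually.of_forall fun x => ?_)
  simp only [← mul_assoc, ← Real.exp_add]
  simp

theorem locallyIntegrable_of_memLp_gibbs {φ f : Sp d → ℝ} (hφ : Continuous φ)
    (hf : MemLp f 2 (gibbs φ)) : LocallyIntegrable f volume := by
  have := isLocallyFiniteMeasure_gibbs hφ
  exact locallyIntegrable_volume_of_gibbs hφ (hf.locallyIntegrable (by norm_num))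

theorem memLp_exp_half_mul {φ h : Sp d → ℝ} (hφ : Continuous φ) (hh : MemLp h 2 (gibbs φ)) :
    MemLp (fun x => Real.exp (-(1 / 2 * φ x)) * h x) 2 volume := by
  have hm : AEStronglyMeasurable h volume := hh.1.mono_ac (absolutelyContinuous_gibbs hφ)
  have hm2 : AEStronglyMeasurable (fun x => Real.exp (-(1 / 2 * φ x)) * h x) volume :=
    (Continuous.aestronglyMeasurable (by fun_prop)).mul hm
  rw [memLp_two_iff_integrable_sq hm2]
  rw [memLp_two_iff_integrable_sq hh.1, integrable_gibbs_iff hφ] at hh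
  refine hh.congr (Eventually.of_forall fun x => ?_)
  simp only [mul_pow, ← Real.exp_nat_mul]
  ring_nf

/-! ### Vanishing of square integrable weak solutions -/

theorem pd_comp_const_sub {k : Sp d → ℝ} (hk : ContDiff ℝ 1 k) (x : Sp d) (i : Fin d) :
    pd i (fun y => k (x - y)) = fun y => -pd i k (x - y) := by
  funext y
  have h1 : HasFDerivAt k (fderiv ℝ k (x - y)) (x - y) :=
    ((hk.differentiable (by norm_num)) _).hasFDerivAt
  have h2 := h1.comp y ((hasFDerivAt_id y).const_sub x)
  change fderiv ℝ (k ∘ HSub.hSub x) y _ = _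
  rw [h2.fderiv]
  simp [pd]

/-- Test the weak equation with the reflected kernel `y ↦ kern d n (x - y)`; the two signs from the
reflection cancel. -/
theorem sum_pd_pd_moll {u g : Sp d → ℝ} (hu : LocallyIntegrable u volume)
    (h : ∀ η, IsTest η → ∫ x, u x * ∑ i, pd i (pd i η) x = ∫ x, g x * η x) (n : ℕ) (x : Sp d) :
    ∑ i, pd i (pd i (moll n u)) x = moll n g x := by
  have hk : IsTest (kern d n) := isTest_kern n
  have e1 : ∀ i, pd i (moll n u) =
      (pd i (kern d n) ⋆[ContinuousLinearMap.lsmul ℝ ℝ, volume] u) := fun i =>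
    funext (pd_convolution_left (hk.contDiff_of 1) hk.2 hu i)
  have e2 : ∀ i, pd i (pd i (moll n u)) x = ∫ y, u y * pd i (pd i (kern d n)) (x - y) := by
    intro i
    rw [e1, pd_convolution_left ((hk.pd i).contDiff_of 1) (hk.pd i).2 hu, convolution_eq_swap]
    exact integral_congr_ae (Eventually.of_forall fun y => mul_comm _ _)
  have hcs : ∀ {f : Sp d → ℝ}, HasCompactSupport f → HasCompactSupport fun y => f (x - y) :=
    fun hf => hf.comp_homeomorph (Homeomorph.subLeft x)
  have hη : IsTest fun y => kern d n (x - y) :=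
    ⟨hk.1.comp (contDiff_const.sub contDiff_id), hcs hk.2⟩
  have h1 := h _ hη
  have e3 : ∀ i y, pd i (pd i fun y => kern d n (x - y)) y = pd i (pd i (kern d n)) (x - y) := by
    intro i y
    rw [pd_comp_const_sub (hk.contDiff_of 1), pd_neg, pd_comp_const_sub ((hk.pd i).contDiff_of 1),
      neg_neg]
  simp only [e3] at h1
  rw [Finset.sum_congr rfl fun i _ => e2 i, ← integral_finsetSum _ fun i _ => ?_]
  · simp only [← Finset.mul_sum]
    rw [h1, moll, convolution_eq_swap]
    exact integral_congr_ae (Eventually.of_forall fun y => mul_comm _ _)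
  · have hp := (hk.pd i).pd i
    exact integrable_mul_of_hasCompactSupport hu
      (hp.1.continuous.comp (continuous_const.sub continuous_id)) (hcs hp.2)

/-- A Caccioppoli inequality for weak solutions of the Schrödinger equation. -/
theorem integral_sq_mul_le {φ θ u : Sp d → ℝ} (hφ : ContDiff ℝ 2 φ) (hθ : IsTest θ)
    (hu : MemLp u 2 volume)
    (h : ∀ η, IsTest η → ∫ x, u x * ∑ i, pd i (pd i η) x = ∫ x, (1 + pot φ x) * u x * η x) :
    ∫ x, θ x ^ 2 * u x * u x ≤ ∫ x, gradSq θ x * u x * u x := by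
  have hul : LocallyIntegrable u volume := hu.locallyIntegrable (by norm_num)
  have hpot := continuous_pot hφ
  have hθc := hθ.1.continuous
  have hθ1 : ContDiff ℝ 1 θ := hθ.contDiff_of 1
  have hgθ := continuous_gradSq hθ1
  set K := Metric.cthickening 1 (tsupport θ) with hKdef
  have hK : IsCompact K := hθ.2.isCompact.cthickening
  -- `(1 + V)u` is only locally square integrable. Its truncation to a unit neighbourhood of the
  -- support of `θ` lies in `L²` and has the same mollifications on that support.
  set w : Sp d → ℝ := K.indicator fun x => (1 + pot φ x) * u x with hw
  have hwL : MemLp w 2 volume := by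
    obtain ⟨M, hM⟩ := hK.exists_bound_of_continuousOn (f := fun x => 1 + pot φ x) (by fun_prop)
    refine MemLp.of_le_mul (c := |M|) hu (AEStronglyMeasurable.indicator
      ((Continuous.aestronglyMeasurable (by fun_prop)).mul hu.1) hK.measurableSet)
      (Eventually.of_forall fun x => ?_)
    by_cases hx : x ∈ K
    · rw [hw, Set.indicator_of_mem hx, norm_mul]
      exact mul_le_mul_of_nonneg_right ((hM x hx).trans (le_abs_self M)) (norm_nonneg _)
    · rw [hw, Set.indicator_of_notMem hx, norm_zero]
      positivity
  have hw_eq : ∀ n x, θ x ^ 2 * moll n u x * ∑ i, pd i (pd i (moll n u)) x =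
      θ x ^ 2 * moll n u x * moll n w x := by
    intro n x
    by_cases hx : x ∈ tsupport θ
    · rw [sum_pd_pd_moll hul h]
      congr 1
      refine moll_congr_on (fun t ht => ?_) n
      rw [hw, Set.indicator_of_mem]
      exact Metric.mem_cthickening_of_dist_le (x - t) x 1 _ hx (by simpa [dist_eq_norm] using ht)
    · simp [eq_zero_of_notMem_tsupport hx]
  have cs : ∀ {a : Sp d → ℝ}, (∀ x ∉ tsupport θ, a x = 0) → HasCompactSupport a :=
    HasCompactSupport.intro hθ.2.isCompact
  have c1 : HasCompactSupport fun x => θ x ^ 2 := cs fun x hx => by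
    simp [eq_zero_of_notMem_tsupport hx]
  have c2 : HasCompactSupport (gradSq θ) := cs fun x hx => gradSq_eq_zero_of_notMem_tsupport hx
  have c3 : HasCompactSupport fun x => pot φ x * θ x ^ 2 := cs fun x hx => by
    simp [eq_zero_of_notMem_tsupport hx]
  have hint : ∀ {a f g : Sp d → ℝ}, Continuous a → HasCompactSupport a → MemLp f 2 volume →
      MemLp g 2 volume → Integrable (fun x => a x * f x * g x) volume := by
    intro a f g ha hac hf hg
    have h := integrable_mul_of_hasCompactSupport (hf.integrable_mul hg).locallyIntegrable ha hac
    exact h.congr (Eventually.of_forall fun x => by simp only [Pi.mul_apply]; ring)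
  have hθ2 : Continuous fun x => θ x ^ 2 := by fun_prop
  have hpθ : Continuous fun x => pot φ x * θ x ^ 2 := by fun_prop
  have t1 := tendsto_integral_moll_mul_moll hθ2 c1 hu hwL
  have t2 := tendsto_integral_moll_mul_moll hgθ c2 hu hu
  have t3 := tendsto_integral_moll_mul_moll hpθ c3 hu hu
  have key : ∀ n, 0 ≤ -(∫ x, θ x ^ 2 * moll n u x * moll n w x) +
      (∫ x, gradSq θ x * moll n u x * moll n u x) +
      ∫ x, pot φ x * θ x ^ 2 * moll n u x * moll n u x := by
    intro n
    have hmu := memLp_moll hu n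
    have hmw := memLp_moll hwL n
    have e := integral_energy_nonneg hφ hθ ((contDiff_moll n hul).of_le (WithTop.coe_le_coe.2 le_top))
    simp only [hw_eq] at e
    have j1 := hint hθ2 c1 hmu hmw
    have j2 := hint hgθ c2 hmu hmu
    have j3 := hint hpθ c3 hmu hmu
    rwa [integral_add (by fun_prop) (by fun_prop), integral_add (by fun_prop) (by fun_prop),
      integral_neg] at e
  -- In the limit the weak equation contributes `∫ θ²u w = ∫ θ²u² + ∫ Vθ²u²`. The two potential
  -- terms cancel, whatever the sign of `V`.
  have lim := ge_of_tendsto' ((t1.neg.add t2).add t3) key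
  have e1 : ∫ x, θ x ^ 2 * u x * w x = (∫ x, θ x ^ 2 * u x * u x) +
      ∫ x, pot φ x * θ x ^ 2 * u x * u x := by
    rw [← integral_add (hint hθ2 c1 hu hu) (hint hpθ c3 hu hu)]
    refine integral_congr_ae (Eventually.of_forall fun x => ?_)
    by_cases hx : x ∈ tsupport θ
    · simp only [hw]
      rw [Set.indicator_of_mem (Metric.self_subset_cthickening _ hx)]
      ring
    · simp [eq_zero_of_notMem_tsupport hx]
  linarith

theorem pd_comp_smul {b : Sp d → ℝ} (hb : ContDiff ℝ 1 b) (c : ℝ) (i : Fin d) (x : Sp d) :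
    pd i (fun y => b (c • y)) x = c * pd i b (c • x) := by
  have h1 : HasFDerivAt b (fderiv ℝ b (c • x)) (c • x) :=
    ((hb.differentiable (by norm_num)) _).hasFDerivAt
  have h2 := h1.comp x ((hasFDerivAt_id x).const_smul c)
  change fderiv ℝ (b ∘ HSMul.hSMul c) x _ = _
  rw [h2.fderiv]
  simp [pd]

/-- Square integrable weak solutions of `-Δu + (1 + |∇φ|²/4 - Δφ/2) u = 0` vanish. -/
theorem ae_eq_zero_of_weak_schrodinger {φ u : Sp d → ℝ} (hφ : ContDiff ℝ 2 φ)
    (hu : MemLp u 2 volume)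
    (h : ∀ η, IsTest η → ∫ x, u x * ∑ i, pd i (pd i η) x = ∫ x, (1 + pot φ x) * u x * η x) :
    u =ᵐ[volume] 0 := by
  let b : ContDiffBump (0 : Sp d) := ⟨1, 2, by norm_num, by norm_num⟩
  have hb : IsTest b := ⟨b.contDiff, b.hasCompactSupport⟩
  have hb1 : ContDiff ℝ 1 b := hb.contDiff_of 1
  obtain ⟨M, hM⟩ := (HasCompactSupport.intro hb.2.isCompact fun x hx =>
    gradSq_eq_zero_of_notMem_tsupport hx).exists_bound_of_continuous (continuous_gradSq hb1)
  -- Dilated cutoffs, equal to 1 on the ball of radius `n + 1` and with squared gradient of order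
  -- `(n + 1)⁻²`.
  let θ : ℕ → Sp d → ℝ := fun n x => b (((n : ℝ) + 1)⁻¹ • x)
  have hpos : ∀ n : ℕ, (0 : ℝ) < (n : ℝ) + 1 := fun n => by positivity
  have hθ : ∀ n, IsTest (θ n) := fun n =>
    ⟨hb.1.comp (contDiff_const_smul _),
      hb.2.comp_homeomorph (Homeomorph.smulOfNeZero _ (inv_ne_zero (hpos n).ne'))⟩
  have hgrad : ∀ n x, gradSq (θ n) x ≤ (((n : ℝ) + 1)⁻¹) ^ 2 * M := by
    intro n x
    have e : gradSq (θ n) x = (((n : ℝ) + 1)⁻¹) ^ 2 * gradSq b (((n : ℝ) + 1)⁻¹ • x) := by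
      simp only [gradSq, θ, pd_comp_smul hb1, mul_pow, Finset.mul_sum]
    rw [e]
    exact mul_le_mul_of_nonneg_left ((le_abs_self _).trans (hM _)) (sq_nonneg _)
  have hu2 : Integrable (fun x => u x * u x) volume := hu.integrable_mul hu
  have hle : ∀ n, ∫ x, θ n x ^ 2 * u x * u x ≤ (((n : ℝ) + 1)⁻¹) ^ 2 * M * ∫ x, u x * u x := by
    intro n
    refine (integral_sq_mul_le hφ (hθ n) hu h).trans ?_
    rw [← integral_const_mul]
    refine integral_mono_of_nonneg (Eventually.of_forall fun x => ?_) (hu2.const_mul _)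
      (Eventually.of_forall fun x => ?_)
    · simp only [mul_assoc]
      exact mul_nonneg (gradSq_nonneg _ _) (mul_self_nonneg _)
    · simp only [mul_assoc (gradSq _ _)]
      exact mul_le_mul_of_nonneg_right (hgrad n x) (mul_self_nonneg _)
  have hlim : Tendsto (fun n => ∫ x, θ n x ^ 2 * u x * u x) atTop (𝓝 (∫ x, u x * u x)) := by
    refine tendsto_integral_of_dominated_convergence (fun x => u x * u x) (fun n => ?_) hu2
      (fun n => Eventually.of_forall fun x => ?_) (Eventually.of_forall fun x => ?_)
    · have := (hθ n).1.continuous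
      exact ((Continuous.aestronglyMeasurable (by fun_prop)).mul hu.1).mul hu.1
    · rw [mul_assoc, norm_mul, Real.norm_of_nonneg (mul_self_nonneg (u x)),
        Real.norm_of_nonneg (sq_nonneg _)]
      refine mul_le_of_le_one_left (mul_self_nonneg _) ?_
      exact pow_le_one₀ b.nonneg b.le_one
    · refine tendsto_const_nhds.congr' ?_
      obtain ⟨N, hN⟩ := exists_nat_ge ‖x‖
      filter_upwards [eventually_ge_atTop N] with n hn
      have : θ n x = 1 := by
        refine b.one_of_mem_closedBall ?_
        rw [mem_closedBall_zero_iff, norm_smul, norm_inv, Real.norm_of_nonneg (hpos n).le,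
          inv_mul_le_iff₀ (hpos n)]
        change ‖x‖ ≤ ((n : ℝ) + 1) * 1
        have : (N : ℝ) ≤ n := by exact_mod_cast hn
        linarith
      simp [this]
  have hzero : Tendsto (fun n : ℕ => (((n : ℝ) + 1)⁻¹) ^ 2 * M * ∫ x, u x * u x) atTop (𝓝 0) := by
    have h1 : Tendsto (fun n : ℕ => ((n : ℝ) + 1)⁻¹) atTop (𝓝 0) := by
      simpa using tendsto_one_div_add_atTop_nhds_zero_nat (𝕜 := ℝ)
    simpa using ((h1.pow 2).mul_const M).mul_const (∫ x, u x * u x)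
  have hfin : ∫ x, u x * u x = 0 :=
    le_antisymm (le_of_tendsto_of_tendsto' hlim hzero hle)
      (integral_nonneg fun x => mul_self_nonneg _)
  rw [integral_eq_zero_iff_of_nonneg (fun x => mul_self_nonneg _) hu2] at hfin
  filter_upwards [hfin] with x hx
  simpa using hx

/-- The range of `Λ` on test functions has trivial orthogonal complement. -/
theorem ae_eq_zero_of_orthogonal_diffOp {φ h : Sp d → ℝ} (hφ : ContDiff ℝ 2 φ)
    (hh : MemLp h 2 (gibbs φ))
    (h0 : ∀ ψ, IsTest ψ → ∫ x, h x * diffOp φ ψ x ∂(gibbs φ) = 0) : h =ᵐ[gibbs φ] 0 := by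
  have hφ1 : ContDiff ℝ 1 φ := hφ.of_le (by norm_num)
  have hloc := locallyIntegrable_of_memLp_gibbs hφ.continuous hh
  have hu := memLp_exp_half_mul hφ.continuous hh
  set u : Sp d → ℝ := fun x => Real.exp (-(1 / 2 * φ x)) * h x with hudef
  have hul : LocallyIntegrable u volume := hu.locallyIntegrable (by norm_num)
  have hz : u =ᵐ[volume] 0 := by
    refine ae_eq_zero_of_weak_schrodinger hφ hu fun η hη => ?_
    have hη2 : ContDiff ℝ 2 η := hη.contDiff_of 2
    -- `e^{φ/2}η` is only `C²`, because `φ` is; hence the enlarged class of test functions.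
    have h1 := integral_mul_diffOp_eq_zero (ψ := fun y => Real.exp (1 / 2 * φ y) * η y) hφ1 hloc h0
      ((contDiff_const.mul hφ).exp.mul hη2) hη.2.mul_left
    rw [integral_gibbs hφ.continuous] at h1
    have h2 : ∀ x, Real.exp (-φ x) * (h x * diffOp φ (fun y => Real.exp (1 / 2 * φ y) * η y) x) =
        (1 + pot φ x) * u x * η x - u x * ∑ i, pd i (pd i η) x := by
      intro x
      rw [diffOp_exp_half_mul hφ hη2, hudef]
      have : Real.exp (-φ x) * Real.exp (1 / 2 * φ x) = Real.exp (-(1 / 2 * φ x)) := by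
        rw [← Real.exp_add]
        congr 1
        ring
      simp only [← this]
      ring
    simp only [h2] at h1
    rw [integral_sub] at h1
    · linarith
    · exact integrable_mul_of_hasCompactSupport (locallyIntegrable_continuous_mul hul
        (continuous_const.add (continuous_pot hφ))) hη2.continuous hη.2
    · refine integrable_mul_of_hasCompactSupport hul (continuous_finsetSum _ fun i _ =>
        ((hη.pd i).pd i).1.continuous) (HasCompactSupport.intro hη.2.isCompact fun x hx => ?_)
      simp [pd_pd_eq_zero_of_notMem_tsupport hx]
  refine (gibbs_absolutelyContinuous φ).ae_eq ?_
  filter_upwards [hz] with x hx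
  simpa [hudef, (Real.exp_pos _).ne'] using hx

/-! ### Local operators on test functions as maps into `L²(e^{-φ} dx)` -/

/-- The space of test functions. -/
def Test (d : ℕ) : Submodule ℝ (Sp d → ℝ) where
  carrier := {ψ | IsTest ψ}
  add_mem' := fun h1 h2 => ⟨h1.1.add h2.1, h1.2.add h2.2⟩
  zero_mem' := ⟨contDiff_const, HasCompactSupport.zero⟩
  smul_mem' := fun c _ h => ⟨h.1.const_smul c, h.2.smul_left (f := fun _ => c)⟩

/-- Linear local operators from test functions to continuous functions. -/
structure IsTestOp (S : (Sp d → ℝ) → Sp d → ℝ) : Prop where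
  continuous : ∀ ψ, IsTest ψ → Continuous (S ψ)
  eq_zero : ∀ ψ, IsTest ψ → ∀ x ∉ tsupport ψ, S ψ x = 0
  map_add : ∀ ψ χ, IsTest ψ → IsTest χ → ∀ x, S (ψ + χ) x = S ψ x + S χ x
  map_smul : ∀ (c : ℝ) ψ, IsTest ψ → ∀ x, S (c • ψ) x = c * S ψ x

theorem IsTestOp.hasCompactSupport {S : (Sp d → ℝ) → Sp d → ℝ} (hS : IsTestOp S) {ψ : Sp d → ℝ}
    (hψ : IsTest ψ) : HasCompactSupport (S ψ) :=
  HasCompactSupport.intro hψ.2.isCompact (hS.eq_zero ψ hψ)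

theorem isTestOp_id : IsTestOp (fun ψ : Sp d → ℝ => ψ) where
  continuous _ h := h.1.continuous
  eq_zero _ _ _ hx := eq_zero_of_notMem_tsupport hx
  map_add _ _ _ _ _ := rfl
  map_smul _ _ _ _ := rfl

theorem isTestOp_pd (i : Fin d) : IsTestOp (pd i) where
  continuous _ h := (h.pd i).1.continuous
  eq_zero _ _ _ hx := pd_eq_zero_of_notMem_tsupport hx i
  map_add _ _ h1 h2 x := pd_add i (h1.differentiableAt x) (h2.differentiableAt x)
  map_smul c _ h x := pd_const_mul i c (h.differentiableAt x)

theorem isTestOp_pd_pd (i j : Fin d) : IsTestOp (fun ψ => pd i (pd j ψ)) where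
  continuous _ h := ((h.pd j).pd i).1.continuous
  eq_zero _ _ _ hx := pd_pd_eq_zero_of_notMem_tsupport hx i j
  map_add ψ χ h1 h2 x := by
    have e : pd j (ψ + χ) = fun y => pd j ψ y + pd j χ y :=
      funext fun y => (isTestOp_pd j).map_add ψ χ h1 h2 y
    rw [e]
    exact pd_add i ((h1.pd j).differentiableAt x) ((h2.pd j).differentiableAt x)
  map_smul c ψ h x := by
    have e : pd j (c • ψ) = fun y => c * pd j ψ y :=
      funext fun y => (isTestOp_pd j).map_smul c ψ h y
    rw [e]
    exact pd_const_mul i c ((h.pd j).differentiableAt x)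

theorem isTestOp_diffOp {φ : Sp d → ℝ} (hφ : ContDiff ℝ 1 φ) : IsTestOp (diffOp φ) where
  continuous _ h := continuous_diffOp hφ (h.contDiff_of 2)
  eq_zero _ h _ hx := diffOp_eq_zero_of_notMem_tsupport (h.contDiff_of 2) hx
  map_add _ _ h1 h2 x := diffOp_add φ h1 h2 x
  map_smul c _ h x := diffOp_smul φ c h x

theorem IsTestOp.mul_left {S : (Sp d → ℝ) → Sp d → ℝ} (hS : IsTestOp S) {a : Sp d → ℝ}
    (ha : Continuous a) : IsTestOp (fun ψ x => a x * S ψ x) where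
  continuous ψ h := ha.mul (hS.continuous ψ h)
  eq_zero ψ h x hx := by simp [hS.eq_zero ψ h x hx]
  map_add ψ χ h1 h2 x := by rw [hS.map_add ψ χ h1 h2, mul_add]
  map_smul c ψ h x := by rw [hS.map_smul c ψ h]; ring

theorem IsTestOp.add {S T : (Sp d → ℝ) → Sp d → ℝ} (hS : IsTestOp S) (hT : IsTestOp T) :
    IsTestOp (fun ψ x => S ψ x + T ψ x) where
  continuous ψ h := (hS.continuous ψ h).add (hT.continuous ψ h)
  eq_zero ψ h x hx := by simp [hS.eq_zero ψ h x hx, hT.eq_zero ψ h x hx]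
  map_add ψ χ h1 h2 x := by rw [hS.map_add ψ χ h1 h2, hT.map_add ψ χ h1 h2]; ring
  map_smul c ψ h x := by rw [hS.map_smul c ψ h, hT.map_smul c ψ h]; ring

theorem memLp_gibbs {φ f : Sp d → ℝ} (hφ : Continuous φ) (hf : Continuous f)
    (hc : HasCompactSupport f) : MemLp f 2 (gibbs φ) :=
  haveI := isLocallyFiniteMeasure_gibbs hφ
  hf.memLp_of_hasCompactSupport hc

theorem IsTestOp.memLp {φ : Sp d → ℝ} (hφ : Continuous φ) {S : (Sp d → ℝ) → Sp d → ℝ}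
    (hS : IsTestOp S) (ψ : Test d) : MemLp (S ψ) 2 (gibbs φ) :=
  memLp_gibbs hφ (hS.continuous _ ψ.2) (hS.hasCompactSupport ψ.2)

/-- A local operator on test functions as a linear map into `L²(e^{-φ} dx)`. -/
noncomputable def IsTestOp.toL2 {φ : Sp d → ℝ} (hφ : Continuous φ) {S : (Sp d → ℝ) → Sp d → ℝ}
    (hS : IsTestOp S) : Test d →ₗ[ℝ] L2 φ where
  toFun ψ := (hS.memLp hφ ψ).toLp
  map_add' ψ χ := by
    rw [← MemLp.toLp_add]
    exact MemLp.toLp_congr _ _ (Eventually.of_forall fun x => hS.map_add ψ χ ψ.2 χ.2 x)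
  map_smul' c ψ := by
    rw [RingHom.id_apply, ← MemLp.toLp_const_smul]
    exact MemLp.toLp_congr _ _ (Eventually.of_forall fun x => hS.map_smul c ψ ψ.2 x)

theorem IsTestOp.coeFn_toL2 {φ : Sp d → ℝ} (hφ : Continuous φ) {S : (Sp d → ℝ) → Sp d → ℝ}
    (hS : IsTestOp S) (ψ : Test d) : (hS.toL2 hφ ψ : Sp d → ℝ) =ᵐ[gibbs φ] S ψ :=
  (hS.memLp hφ ψ).coeFn_toLp

theorem inner_toLp {φ g : Sp d → ℝ} (f : L2 φ) (hg : MemLp g 2 (gibbs φ)) :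
    inner ℝ f hg.toLp = ∫ x, f x * g x ∂(gibbs φ) := by
  rw [L2.inner_def]
  refine integral_congr_ae ?_
  filter_upwards [hg.coeFn_toLp] with x hx
  rw [hx]
  simp [mul_comm]

theorem IsTestOp.inner_toL2 {φ : Sp d → ℝ} (hφ : Continuous φ) {S : (Sp d → ℝ) → Sp d → ℝ}
    (hS : IsTestOp S) (f : L2 φ) (ψ : Test d) :
    inner ℝ f (hS.toL2 hφ ψ) = ∫ x, f x * S ψ x ∂(gibbs φ) :=
  inner_toLp f (hS.memLp hφ ψ)

theorem IsTestOp.norm_toL2_sq {φ : Sp d → ℝ} (hφ : Continuous φ) {S : (Sp d → ℝ) → Sp d → ℝ}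
    (hS : IsTestOp S) (ψ : Test d) :
    ‖hS.toL2 hφ ψ‖ ^ 2 = ∫ x, S ψ x ^ 2 ∂(gibbs φ) := by
  rw [← real_inner_self_eq_norm_sq, hS.inner_toL2]
  refine integral_congr_ae ?_
  filter_upwards [hS.coeFn_toL2 hφ ψ] with x hx
  rw [hx, sq]

theorem ext_inner_toL2 {φ : Sp d → ℝ} {V : Type*} [AddCommGroup V] [Module ℝ V]
    {L : V →ₗ[ℝ] L2 φ} (hL : DenseRange L) {f g : L2 φ}
    (h : ∀ v, inner ℝ f (L v) = inner ℝ g (L v)) : f = g := by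
  have h1 : (fun k : L2 φ => inner ℝ f k) = fun k => inner ℝ g k :=
    hL.equalizer (by fun_prop) (by fun_prop) (funext h)
  exact ext_inner_right ℝ fun k => congrFun h1 k

theorem denseRange_of_orthogonal {φ : Sp d → ℝ} {V : Type*} [AddCommGroup V] [Module ℝ V]
    {L : V →ₗ[ℝ] L2 φ} (h : ∀ f, (∀ v, inner ℝ f (L v) = 0) → f = 0) : DenseRange L := by
  have h1 : (LinearMap.range L).topologicalClosure = ⊤ := by
    rw [Submodule.topologicalClosure_eq_top_iff, Submodule.eq_bot_iff]
    intro f hf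
    refine h f fun v => ?_
    rw [real_inner_comm]
    exact hf _ (LinearMap.mem_range_self L v)
  have h2 := Submodule.dense_iff_topologicalClosure_eq_top.2 h1
  rwa [LinearMap.coe_range] at h2

/-- The analytic core of essential self-adjointness. Bounds known on test functions pass to all of
`L²` through this density. -/
theorem denseRange_diffOp {φ : Sp d → ℝ} (hφ : ContDiff ℝ 2 φ) :
    DenseRange ((isTestOp_diffOp (hφ.of_le one_le_two)).toL2 hφ.continuous) := by
  refine denseRange_of_orthogonal fun f hf => ?_
  simp only [IsTestOp.inner_toL2] at hf
  rw [Lp.eq_zero_iff_ae_eq_zero]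
  exact ae_eq_zero_of_orthogonal_diffOp hφ (Lp.memLp f) fun ψ hψ => hf ⟨ψ, hψ⟩

theorem denseRange_id {φ : Sp d → ℝ} (hφ : Continuous φ) :
    DenseRange (isTestOp_id.toL2 hφ) := by
  have := isLocallyFiniteMeasure_gibbs hφ
  refine (Lp.dense_hasCompactSupport_contDiff (μ := gibbs φ) (F := ℝ) (p := 2)
    (by norm_num)).mono ?_
  rintro f ⟨g, hfg, hc, hg⟩
  refine ⟨⟨g, hg, hc⟩, Lp.ext ?_⟩
  exact (isTestOp_id.coeFn_toL2 hφ _).trans hfg.symm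

/-- Green's identity, with flux `χ∇ψ - ψ∇χ`. -/
theorem integral_diffOp_symm {φ ψ χ : Sp d → ℝ} (hφ : ContDiff ℝ 1 φ) (hψ : IsTest ψ)
    (hχ : IsTest χ) : ∫ x, ψ x * diffOp φ χ x ∂(gibbs φ) = ∫ x, χ x * diffOp φ ψ x ∂(gibbs φ) := by
  have hF : ∀ i, ContDiff ℝ 1 (fun y => χ y * pd i ψ y - ψ y * pd i χ y) := fun i =>
    ((hχ.contDiff_of 1).mul ((hψ.pd i).contDiff_of 1)).sub
      ((hψ.contDiff_of 1).mul ((hχ.pd i).contDiff_of 1))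
  have hFc : ∀ i, HasCompactSupport (fun y => χ y * pd i ψ y - ψ y * pd i χ y) := fun i =>
    hχ.2.mul_right.sub hψ.2.mul_right
  have hpt : ∀ x, ψ x * diffOp φ χ x - χ x * diffOp φ ψ x =
      ∑ i, (pd i (fun y => χ y * pd i ψ y - ψ y * pd i χ y) x -
        pd i φ x * (χ x * pd i ψ x - ψ x * pd i χ x)) := by
    intro x
    rw [diffOp_eq φ (hχ.contDiff_of 2), diffOp_eq φ (hψ.contDiff_of 2), mul_add, mul_add,
      mul_comm (χ x) (ψ x), add_sub_add_right_eq_sub, Finset.mul_sum, Finset.mul_sum,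
      ← Finset.sum_sub_distrib]
    refine Finset.sum_congr rfl fun i _ => ?_
    have hd : ∀ {f : Sp d → ℝ}, ContDiff ℝ 1 f → DifferentiableAt ℝ f x := fun hf =>
      (hf.differentiable (by norm_num)) x
    rw [pd_sub i (hd ((hχ.contDiff_of 1).mul ((hψ.pd i).contDiff_of 1)))
      (hd ((hψ.contDiff_of 1).mul ((hχ.pd i).contDiff_of 1))),
      pd_mul_of_contDiff (hχ.contDiff_of 1) ((hψ.pd i).contDiff_of 1),
      pd_mul_of_contDiff (hψ.contDiff_of 1) ((hχ.pd i).contDiff_of 1)]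
    ring
  have hi : ∀ {a b : Sp d → ℝ}, IsTest a → IsTest b →
      Integrable (fun x => a x * diffOp φ b x) (gibbs φ) := fun ha hb =>
    integrable_gibbs hφ.continuous (ha.1.continuous.mul (continuous_diffOp hφ (hb.contDiff_of 2)))
      ha.2.isCompact fun x hx => by simp [eq_zero_of_notMem_tsupport hx]
  rw [← sub_eq_zero, ← integral_sub (hi hψ hχ) (hi hχ hψ)]
  simp only [hpt]
  rw [integral_finsetSum _ fun i _ => ?_]
  · exact Finset.sum_eq_zero fun i _ => integral_gibbs_div_eq_zero hφ (hF i) (hFc i) i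
  · refine integrable_gibbs hφ.continuous ((continuous_pd (hF i) i).sub
      ((continuous_pd hφ i).mul (hF i).continuous)) (hFc i).isCompact fun x hx => ?_
    have h1 := pd_eq_zero_of_notMem_tsupport hx i
    have h2 := eq_zero_of_notMem_tsupport hx
    rw [h1, h2]
    simp

/-! ### The resolvent and the operator `Λ` -/

/-- `R` is the bounded extension of `Λψ ↦ ψ`. -/
def IsResolvent {φ : Sp d → ℝ} (hφ : ContDiff ℝ 2 φ) (R : L2 φ →L[ℝ] L2 φ) : Prop :=
  ∀ ψ : Test d, R ((isTestOp_diffOp (hφ.of_le one_le_two)).toL2 hφ.continuous ψ) =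
    isTestOp_id.toL2 hφ.continuous ψ

namespace IsResolvent

variable {φ : Sp d → ℝ} {hφ : ContDiff ℝ 2 φ} {R : L2 φ →L[ℝ] L2 φ}

/-- On vectors `Λψ`, `Λχ` this is the symmetry of `Λ` on test functions; density is then used once
in each argument. -/
theorem symm (hR : IsResolvent hφ R) (f g : L2 φ) : inner ℝ (R f) g = inner ℝ f (R g) := by
  have hL := denseRange_diffOp hφ
  have h0 : ∀ ψ χ : Test d,
      inner ℝ (R ((isTestOp_diffOp (hφ.of_le one_le_two)).toL2 hφ.continuous ψ))
        ((isTestOp_diffOp (hφ.of_le one_le_two)).toL2 hφ.continuous χ) =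
      inner ℝ ((isTestOp_diffOp (hφ.of_le one_le_two)).toL2 hφ.continuous ψ)
        (R ((isTestOp_diffOp (hφ.of_le one_le_two)).toL2 hφ.continuous χ)) := by
    intro ψ χ
    rw [hR ψ, hR χ, real_inner_comm (isTestOp_id.toL2 hφ.continuous χ), IsTestOp.inner_toL2,
      IsTestOp.inner_toL2]
    have e1 : ∀ (a b : Test d), ∫ x, isTestOp_id.toL2 hφ.continuous a x * diffOp φ b x ∂(gibbs φ) =
        ∫ x, a.1 x * diffOp φ b x ∂(gibbs φ) := fun a b => integral_congr_ae <| by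
      filter_upwards [isTestOp_id.coeFn_toL2 hφ.continuous a] with x hx
      rw [hx]
    rw [e1, e1]
    exact integral_diffOp_symm (hφ.of_le one_le_two) ψ.2 χ.2
  have h1 : ∀ (ψ : Test d) (g : L2 φ),
      inner ℝ (R ((isTestOp_diffOp (hφ.of_le one_le_two)).toL2 hφ.continuous ψ)) g =
      inner ℝ ((isTestOp_diffOp (hφ.of_le one_le_two)).toL2 hφ.continuous ψ) (R g) := fun ψ =>
    congrFun (hL.equalizer (by fun_prop) (by fun_prop) (funext (h0 ψ)))
  exact congrFun (hL.equalizer (g := fun f => inner ℝ (R f) g) (h := fun f => inner ℝ f (R g))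
    (by fun_prop) (by fun_prop) (funext fun ψ => h1 ψ g)) f

theorem denseRange (hR : IsResolvent hφ R) : DenseRange R := by
  refine (denseRange_id hφ.continuous).mono ?_
  rintro _ ⟨ψ, rfl⟩
  exact ⟨_, hR ψ⟩

/-- The kernel of a symmetric operator is orthogonal to its range, which is dense here. -/
theorem eq_zero (hR : IsResolvent hφ R) {f : L2 φ} (hf : R f = 0) : f = 0 := by
  refine ext_inner_toL2 (L := (R : L2 φ →ₗ[ℝ] L2 φ)) hR.denseRange fun g => ?_
  change inner ℝ f (R g) = inner ℝ 0 (R g)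
  rw [← hR.symm, hf, inner_zero_left, inner_zero_left]

/-- `(f, Λψ) = (g, ψ) = (g, RΛψ) = (Rg, Λψ)`, and the vectors `Λψ` are dense. -/
theorem eq_of_weak (hR : IsResolvent hφ R) {f g : L2 φ}
    (h : ∀ ψ : Test d, ∫ x, f x * diffOp φ ψ x ∂(gibbs φ) = ∫ x, g x * ψ.1 x ∂(gibbs φ)) :
    f = R g := by
  refine ext_inner_toL2 (denseRange_diffOp hφ) fun ψ => ?_
  rw [hR.symm, hR ψ, IsTestOp.inner_toL2, IsTestOp.inner_toL2]
  exact h ψ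

theorem eq_of_mem_minimalGraph (hR : IsResolvent hφ R) {p : L2 φ × L2 φ}
    (hp : p ∈ minimalGraph φ) : p.1 = R p.2 := by
  obtain ⟨ψ, hψ, h1, h2⟩ := hp
  have e1 : p.1 = isTestOp_id.toL2 hφ.continuous ⟨ψ, hψ⟩ :=
    Lp.ext (h1.trans (isTestOp_id.coeFn_toL2 hφ.continuous ⟨ψ, hψ⟩).symm)
  have e2 : p.2 = (isTestOp_diffOp (hφ.of_le one_le_two)).toL2 hφ.continuous ⟨ψ, hψ⟩ :=
    Lp.ext (h2.trans ((isTestOp_diffOp (hφ.of_le one_le_two)).coeFn_toL2 hφ.continuous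
      ⟨ψ, hψ⟩).symm)
  rw [e1, e2, hR]

/-- The set `{(Rf, f)}` is closed and contains the minimal graph. Conversely, `Λψ_n → f` implies
`(ψ_n, Λψ_n) → (Rf, f)`. -/
theorem mem_topologicalClosure_iff (hR : IsResolvent hφ R) (p : L2 φ × L2 φ) :
    p ∈ (minimalGraph φ).topologicalClosure ↔ p.1 = R p.2 := by
  constructor
  · intro hp
    have hcl : IsClosed {p : L2 φ × L2 φ | p.1 = R p.2} :=
      isClosed_eq continuous_fst (R.continuous.comp continuous_snd)
    exact closure_minimal (fun q hq => hR.eq_of_mem_minimalGraph hq) hcl hp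
  · intro hp
    have key : ∀ f : L2 φ, (R f, f) ∈ (minimalGraph φ).topologicalClosure := by
      intro f
      refine (denseRange_diffOp hφ).induction_on
        (p := fun f => (R f, f) ∈ (minimalGraph φ).topologicalClosure) f ?_ fun ψ => ?_
      · exact (minimalGraph φ).isClosed_topologicalClosure.preimage
          (R.continuous.prodMk continuous_id)
      · refine Submodule.le_topologicalClosure _ ⟨ψ, ψ.2, ?_, ?_⟩
        · simp only [hR ψ]
          exact isTestOp_id.coeFn_toL2 hφ.continuous ψ
        · exact (isTestOp_diffOp (hφ.of_le one_le_two)).coeFn_toL2 hφ.continuous ψ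
    have h := key p.2
    rwa [← hp] at h

theorem mem_graph_iff (hR : IsResolvent hφ R) (p : L2 φ × L2 φ) :
    p ∈ (Lam φ).graph ↔ p.1 = R p.2 := by
  -- `toLinearPMap` and `closure` take default values unless the relation is single-valued and
  -- closable. Both properties follow from the injectivity of `R`.
  have g0 : (minimalGraph φ).toLinearPMap.graph = minimalGraph φ := by
    refine Submodule.toLinearPMap_graph_eq _ fun q hq h0 => hR.eq_zero ?_
    rw [← hR.eq_of_mem_minimalGraph hq, h0]
  have hcl : (minimalGraph φ).toLinearPMap.IsClosable := by
    refine ⟨(minimalGraph φ).topologicalClosure.toLinearPMap, ?_⟩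
    rw [g0, Submodule.toLinearPMap_graph_eq]
    intro q hq h0
    refine hR.eq_zero ?_
    rw [← (hR.mem_topologicalClosure_iff q).1 hq, h0]
  rw [Lam, ← hcl.graph_closure_eq_closure_graph, g0]
  exact hR.mem_topologicalClosure_iff p

theorem coe_eq (hR : IsResolvent hφ R) (u : (Lam φ).domain) : (u : L2 φ) = R (Lam φ u) :=
  (hR.mem_graph_iff (u, Lam φ u)).1 ((Lam φ).mem_graph u)

theorem exists_eq (hR : IsResolvent hφ R) (f : L2 φ) :
    ∃ u : (Lam φ).domain, (u : L2 φ) = R f ∧ Lam φ u = f :=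
  LinearPMap.mem_graph_iff _ |>.1 ((hR.mem_graph_iff (R f, f)).2 rfl)

theorem mem_domain_iff (hR : IsResolvent hφ R) (u : L2 φ) :
    u ∈ (Lam φ).domain ↔ ∃ f, u = R f := by
  constructor
  · intro hu
    exact ⟨_, hR.coe_eq ⟨u, hu⟩⟩
  · rintro ⟨f, rfl⟩
    obtain ⟨u, hu, -⟩ := hR.exists_eq f
    rw [← hu]
    exact u.2

theorem bijective (hR : IsResolvent hφ R) :
    Function.Bijective (fun u : (Lam φ).domain => Lam φ u) := by
  constructor
  · intro u v huv
    refine Subtype.ext ?_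
    rw [hR.coe_eq u, hR.coe_eq v]
    exact congrArg R huv
  · intro f
    obtain ⟨u, -, hu⟩ := hR.exists_eq f
    exact ⟨u, hu⟩

theorem lamInv_eq (hR : IsResolvent hφ R) (f : L2 φ) : LamInv φ f = R f := by
  have h := Function.invFun_eq (f := fun u : (Lam φ).domain => Lam φ u) (hR.bijective.2 f)
  rw [LamInv, hR.coe_eq, h]

theorem isSelfAdjoint (hR : IsResolvent hφ R) : IsSelfAdjoint (Lam φ) := by
  have hd : Dense ((Lam φ).domain : Set (L2 φ)) := by
    refine hR.denseRange.mono ?_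
    rintro _ ⟨f, rfl⟩
    exact (hR.mem_domain_iff _).2 ⟨f, rfl⟩
  rw [LinearPMap.isSelfAdjoint_def]
  refine LinearPMap.eq_of_eq_graph ?_
  rw [LinearPMap.adjoint_graph_eq_graph_adjoint hd]
  ext p
  rw [Submodule.mem_adjoint_iff, hR.mem_graph_iff]
  constructor
  · intro h
    refine ext_inner_left ℝ fun f => ?_
    -- Testing the adjoint relation on the graph element `(Rf, f)` gives `(f, p.1) = (Rf, p.2) = (f,
    -- R p.2)` for every `f`.
    have h1 := h (R f) f ((hR.mem_graph_iff _).2 rfl)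
    rw [hR.symm] at h1
    exact sub_eq_zero.1 h1
  · intro h a b hab
    have h1 := (hR.mem_graph_iff _).1 hab
    simp only at h1
    rw [h1, h, hR.symm, sub_self]

end IsResolvent

/-! ### Bounded extensions along the dense range of `Λ` -/

/-- `Λ` on test functions, as a map into `L²(e^{-φ} dx)`. -/
noncomputable abbrev opLam {φ : Sp d → ℝ} (hφ : ContDiff ℝ 2 φ) : Test d →ₗ[ℝ] L2 φ :=
  (isTestOp_diffOp (hφ.of_le one_le_two)).toL2 hφ.continuous

/-- The bound makes `Sψ` a continuous function of `Λψ`; the extension `A` plays the role of `SΛ⁻¹`.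
-/
theorem exists_extension {φ : Sp d → ℝ} (hφ : ContDiff ℝ 2 φ) {S : (Sp d → ℝ) → Sp d → ℝ}
    (hS : IsTestOp S) {B : ℝ}
    (h : ∀ ψ, ‖hS.toL2 hφ.continuous ψ‖ ^ 2 ≤ B * ‖opLam hφ ψ‖ ^ 2) :
    ∃ A : L2 φ →L[ℝ] L2 φ, (∀ ψ, A (opLam hφ ψ) = hS.toL2 hφ.continuous ψ) ∧
      ∀ f, ‖A f‖ ^ 2 ≤ B * ‖f‖ ^ 2 := by
  have hL := denseRange_diffOp hφ
  have h1 : ∀ ψ, ‖hS.toL2 hφ.continuous ψ‖ ≤ Real.sqrt B * ‖opLam hφ ψ‖ := by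
    intro ψ
    have h2 := Real.sqrt_le_sqrt (h ψ)
    rwa [Real.sqrt_sq (norm_nonneg _), Real.sqrt_mul' _ (sq_nonneg _),
      Real.sqrt_sq (norm_nonneg _)] at h2
  have h3 := fun ψ => LinearMap.extendOfNorm_eq (f := hS.toL2 hφ.continuous) hL ⟨_, h1⟩ ψ
  refine ⟨(hS.toL2 hφ.continuous).extendOfNorm (opLam hφ), h3, fun f => ?_⟩
  refine hL.induction_on (p := fun f =>
    ‖(hS.toL2 hφ.continuous).extendOfNorm (opLam hφ) f‖ ^ 2 ≤ B * ‖f‖ ^ 2) f ?_ fun ψ => ?_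
  · exact isClosed_le (by fun_prop) (by fun_prop)
  · rw [h3]
    exact h ψ

/-- The multiplier `a` may be unbounded on `L²`, but against a compactly supported `χ` it can be
moved onto `χ`. Both sides then become continuous functionals of `f`, equal on a dense set. -/
theorem ae_eq_mul_of_extension {φ : Sp d → ℝ} (hφ : ContDiff ℝ 2 φ) {S : (Sp d → ℝ) → Sp d → ℝ}
    (hS : IsTestOp S) {a : Sp d → ℝ} (ha : Continuous a) {A A' : L2 φ →L[ℝ] L2 φ}
    (hA : ∀ ψ, A (opLam hφ ψ) = hS.toL2 hφ.continuous ψ)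
    (hA' : ∀ ψ, A' (opLam hφ ψ) = (hS.mul_left ha).toL2 hφ.continuous ψ) (f : L2 φ) :
    (A' f : Sp d → ℝ) =ᵐ[gibbs φ] fun x => a x * A f x := by
  have := isLocallyFiniteMeasure_gibbs hφ.continuous
  have hl : ∀ g : L2 φ, LocallyIntegrable g (gibbs φ) := fun g =>
    (Lp.memLp g).locallyIntegrable (by norm_num)
  refine ae_eq_of_integral_contDiff_smul_eq (hl _) (locallyIntegrable_continuous_mul (hl _) ha)
    fun χ hχ hc => ?_
  have m1 : MemLp χ 2 (gibbs φ) := memLp_gibbs hφ.continuous hχ.continuous hc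
  have m2 : MemLp (fun x => a x * χ x) 2 (gibbs φ) :=
    memLp_gibbs hφ.continuous (ha.mul hχ.continuous) hc.mul_left
  have e : (fun f => inner ℝ (A' f) m1.toLp) = fun f => inner ℝ (A f) m2.toLp := by
    refine (denseRange_diffOp hφ).equalizer (by fun_prop) (by fun_prop) (funext fun ψ => ?_)
    simp only [Function.comp_apply, inner_toLp]
    rw [hA ψ, hA' ψ]
    refine integral_congr_ae ?_
    filter_upwards [hS.coeFn_toL2 hφ.continuous ψ,
      (hS.mul_left ha).coeFn_toL2 hφ.continuous ψ] with x h1 h2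
    rw [h1, h2]
    ring
  have e1 := congrFun e f
  simp only [inner_toLp] at e1
  simp only [smul_eq_mul, mul_comm (χ _)]
  rw [e1]
  exact integral_congr_ae (Eventually.of_forall fun x => by ring)

theorem integral_volume_eq {φ : Sp d → ℝ} (hφ : Continuous φ) (f χ : Sp d → ℝ) :
    ∫ x, f x * χ x = ∫ x, f x * (Real.exp (φ x) * χ x) ∂(gibbs φ) := by
  rw [integral_gibbs hφ]
  refine integral_congr_ae (Eventually.of_forall fun x => ?_)
  have : Real.exp (-φ x) * Real.exp (φ x) = 1 := by rw [← Real.exp_add]; simp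
  calc f x * χ x = (Real.exp (-φ x) * Real.exp (φ x)) * (f x * χ x) := by rw [this, one_mul]
    _ = _ := by ring

/-- For fixed `χ`, Lebesgue pairings become `L²(e^{-φ} dx)` pairings with `e^φ χ` and `e^φ ∂_iχ`.
Integration by parts is thus an identity between continuous functionals, true on the dense range. -/
theorem hasWeakPartial_of_extension {φ : Sp d → ℝ} (hφ : ContDiff ℝ 2 φ)
    {S S' : (Sp d → ℝ) → Sp d → ℝ} (hS : IsTestOp S) (hS' : IsTestOp S') {i : Fin d}
    (hST : ∀ ψ, IsTest ψ → IsTest (S ψ)) (hSS : ∀ ψ, S' ψ = pd i (S ψ)) {A A' : L2 φ →L[ℝ] L2 φ}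
    (hA : ∀ ψ, A (opLam hφ ψ) = hS.toL2 hφ.continuous ψ)
    (hA' : ∀ ψ, A' (opLam hφ ψ) = hS'.toL2 hφ.continuous ψ) (f : L2 φ) :
    HasWeakPartial i (A f) (A' f) := by
  refine ⟨locallyIntegrable_of_memLp_gibbs hφ.continuous (Lp.memLp _),
    locallyIntegrable_of_memLp_gibbs hφ.continuous (Lp.memLp _), fun χ hχ => ?_⟩
  have hφc := hφ.continuous
  have hm : ∀ {η : Sp d → ℝ}, IsTest η → MemLp (fun x => Real.exp (φ x) * η x) 2 (gibbs φ) :=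
    fun hη => memLp_gibbs hφc ((Real.continuous_exp.comp hφc).mul hη.1.continuous) hη.2.mul_left
  have e : (fun f => inner ℝ (A f) (hm (hχ.pd i)).toLp) =
      fun f => -inner ℝ (A' f) (hm hχ).toLp := by
    refine (denseRange_diffOp hφ).equalizer (by fun_prop) (by fun_prop) (funext fun ψ => ?_)
    simp only [Function.comp_apply, inner_toLp]
    rw [hA ψ, hA' ψ, ← integral_volume_eq hφc, ← integral_volume_eq hφc]
    have e1 : ∫ x, hS.toL2 hφc ψ x * pd i χ x = ∫ x, S ψ x * pd i χ x := by
      refine integral_congr_ae ?_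
      filter_upwards [(absolutelyContinuous_gibbs hφc).ae_eq (hS.coeFn_toL2 hφc ψ)] with x hx
      rw [hx]
    have e2 : ∫ x, hS'.toL2 hφc ψ x * χ x = ∫ x, pd i (S ψ) x * χ x := by
      refine integral_congr_ae ?_
      filter_upwards [(absolutelyContinuous_gibbs hφc).ae_eq (hS'.coeFn_toL2 hφc ψ)] with x hx
      rw [hx, hSS]
    have hT := hST ψ ψ.2
    have h0 := integral_pd_eq_zero ((hT.contDiff_of 1).mul (hχ.contDiff_of 1)) hT.2.mul_right i
    simp only [pd_mul_of_contDiff (hT.contDiff_of 1) (hχ.contDiff_of 1)] at h0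
    rw [integral_add] at h0
    · rw [e1, e2]
      linarith
    · exact ((hT.pd i).1.continuous.mul hχ.1.continuous).integrable_of_hasCompactSupport
        hχ.2.mul_left
    · exact (hT.1.continuous.mul (hχ.pd i).1.continuous).integrable_of_hasCompactSupport
        hT.2.mul_right
  have e1 := congrFun e f
  simp only [inner_toLp] at e1
  rw [integral_volume_eq hφc, integral_volume_eq hφc, e1]

theorem sqNorm_eq {φ g : Sp d → ℝ} {f : L2 φ} (h : (f : Sp d → ℝ) =ᵐ[gibbs φ] g) :
    sqNorm φ g = ENNReal.ofReal (‖f‖ ^ 2) := by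
  have h1 : sqNorm φ g = eLpNorm f 2 (gibbs φ) ^ 2 := by
    have h2 := eLpNorm_nnreal_pow_eq_lintegral (p := 2) (μ := gibbs φ) (f := g) (by norm_num)
    norm_num at h2
    rw [eLpNorm_congr_ae h, sqNorm]
    exact_mod_cast h2.symm
  rw [h1, ENNReal.ofReal_pow (norm_nonneg _), Lp.norm_def,
    ENNReal.ofReal_toReal (Lp.memLp f).eLpNorm_ne_top]

theorem memLp_of_sqNorm_lt_top {φ g : Sp d → ℝ} (hg : AEStronglyMeasurable g (gibbs φ))
    (h : sqNorm φ g < ⊤) : MemLp g 2 (gibbs φ) := by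
  refine ⟨hg, ?_⟩
  have h2 := eLpNorm_nnreal_pow_eq_lintegral (p := 2) (μ := gibbs φ) (f := g) (by norm_num)
  norm_num at h2
  have h3 : eLpNorm g 2 (gibbs φ) ^ 2 = sqNorm φ g := by
    rw [sqNorm]
    exact_mod_cast h2
  rw [← h3] at h
  exact (ENNReal.pow_lt_top_iff.1 h).resolve_right two_ne_zero

/-- The toolbox estimate on test functions in terms of norms in `L²(e^{-φ} dx)`. -/
theorem toolbox_toL2 {φ : Sp d → ℝ} {C C' : ℝ} (h8 : 8 < C) (hCC : C < C')
    (hφ : ContDiff ℝ 2 φ) (hC : HasConstants φ C C') (ψ : Test d) :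
    ‖isTestOp_id.toL2 hφ.continuous ψ‖ ^ 2 ≤ 1 * ‖opLam hφ ψ‖ ^ 2 ∧
    (∑ i, ∑ j, ‖(isTestOp_pd_pd i j).toL2 hφ.continuous ψ‖ ^ 2) +
      (∑ j, ‖((isTestOp_pd j).mul_left (contDiff_wgt hφ).continuous).toL2
        hφ.continuous ψ‖ ^ 2) +
      ‖(isTestOp_id.mul_left ((contDiff_wgt hφ).continuous.pow 2)).toL2 hφ.continuous ψ‖ ^ 2 ≤
        196 * C' ^ 2 * ‖opLam hφ ψ‖ ^ 2 := by
  have h := toolbox_test h8 hCC hφ hC ψ.2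
  have hi : ∀ {S : (Sp d → ℝ) → Sp d → ℝ}, IsTestOp S →
      Integrable (fun x => S ψ x ^ 2) (gibbs φ) := fun hS => (hS.memLp hφ.continuous ψ).integrable_sq
  simp only [IsTestOp.norm_toL2_sq]
  refine ⟨by rw [one_mul]; exact h.1, ?_⟩
  refine le_trans (le_of_eq ?_) h.2
  congr 1
  congr 1
  · simp only [hessNorm_sq]
    rw [integral_finsetSum _ fun i _ => integrable_finsetSum _ fun j _ => hi (isTestOp_pd_pd i j)]
    exact Finset.sum_congr rfl fun i _ =>
      (integral_finsetSum _ fun j _ => hi (isTestOp_pd_pd i j)).symm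
  · rw [← integral_finsetSum _ fun j _ =>
      hi ((isTestOp_pd j).mul_left (contDiff_wgt hφ).continuous)]
    simp only [gradSq, Finset.mul_sum, mul_pow]

theorem pd_exp_neg {φ : Sp d → ℝ} (hφ : ContDiff ℝ 1 φ) (i : Fin d) (x : Sp d) :
    pd i (fun y => Real.exp (-φ y)) x = -(Real.exp (-φ x) * pd i φ x) := by
  have h : DifferentiableAt ℝ φ x := (hφ.differentiable (by norm_num)) x
  rw [pd_exp i h.fun_neg, pd_neg, mul_neg]

theorem one_le_wgt_sq (φ : Sp d → ℝ) (x : Sp d) : 1 ≤ wgt φ x ^ 2 := by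
  rw [wgt_sq]
  exact le_add_of_nonneg_right (gradSq_nonneg φ x)

theorem toolbox_toL2_single {φ : Sp d → ℝ} {C C' : ℝ} (h8 : 8 < C) (hCC : C < C')
    (hφ : ContDiff ℝ 2 φ) (hC : HasConstants φ C C') (ψ : Test d) :
    (∀ i j, ‖(isTestOp_pd_pd i j).toL2 hφ.continuous ψ‖ ^ 2 ≤
      196 * C' ^ 2 * ‖opLam hφ ψ‖ ^ 2) ∧
    (∀ j, ‖((isTestOp_pd j).mul_left (contDiff_wgt hφ).continuous).toL2 hφ.continuous ψ‖ ^ 2 ≤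
      196 * C' ^ 2 * ‖opLam hφ ψ‖ ^ 2) ∧
    ‖(isTestOp_id.mul_left ((contDiff_wgt hφ).continuous.pow 2)).toL2 hφ.continuous ψ‖ ^ 2 ≤
      196 * C' ^ 2 * ‖opLam hφ ψ‖ ^ 2 := by
  have h := (toolbox_toL2 h8 hCC hφ hC ψ).2
  set a : Fin d → Fin d → ℝ := fun i j => ‖(isTestOp_pd_pd i j).toL2 hφ.continuous ψ‖ ^ 2
  set b : Fin d → ℝ := fun j =>
    ‖((isTestOp_pd j).mul_left (contDiff_wgt hφ).continuous).toL2 hφ.continuous ψ‖ ^ 2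
  have ha : ∀ i j, 0 ≤ a i j := fun i j => sq_nonneg _
  have hb : ∀ j, 0 ≤ b j := fun j => sq_nonneg _
  have hsa : 0 ≤ ∑ i, ∑ j, a i j := Finset.sum_nonneg fun i _ => Finset.sum_nonneg fun j _ => ha i j
  have hsb : 0 ≤ ∑ j, b j := Finset.sum_nonneg fun j _ => hb j
  have hc := sq_nonneg
    ‖(isTestOp_id.mul_left ((contDiff_wgt hφ).continuous.pow 2)).toL2 hφ.continuous ψ‖
  refine ⟨fun i j => ?_, fun j => ?_, by linarith⟩
  · have h1 := Finset.single_le_sum (f := fun j => a i j) (fun j _ => ha i j) (Finset.mem_univ j)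
    have h2 := Finset.single_le_sum (f := fun i => ∑ j, a i j)
      (fun i _ => Finset.sum_nonneg fun j _ => ha i j) (Finset.mem_univ i)
    exact (h1.trans h2).trans (by linarith)
  · exact (Finset.single_le_sum (fun j _ => hb j) (Finset.mem_univ j)).trans (by linarith)

theorem exists_resolvent {φ : Sp d → ℝ} {C C' : ℝ} (h8 : 8 < C) (hCC : C < C')
    (hφ : ContDiff ℝ 2 φ) (hC : HasConstants φ C C') :
    ∃ R : L2 φ →L[ℝ] L2 φ, IsResolvent hφ R ∧ ∀ f : L2 φ, ∃ G H, HasWeakDerivs (R f) G H ∧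
      toolboxSq φ (R f) G H ≤ ENNReal.ofReal (196 * C' ^ 2 * ‖f‖ ^ 2) := by
  have hφc := hφ.continuous
  have hw := (contDiff_wgt hφ).continuous
  have bS := toolbox_toL2_single h8 hCC hφ hC
  -- The unweighted derivative is extended separately, using `⌊∇φ⌉ ≥ 1`: it is the weak gradient,
  -- and the weighted extension is identified with its multiple.
  have bG : ∀ j ψ, ‖(isTestOp_pd j).toL2 hφc ψ‖ ^ 2 ≤ 196 * C' ^ 2 * ‖opLam hφ ψ‖ ^ 2 := by
    intro j ψ
    refine le_trans ?_ ((bS ψ).2.1 j)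
    rw [IsTestOp.norm_toL2_sq, IsTestOp.norm_toL2_sq]
    refine integral_mono ((isTestOp_pd j).memLp hφc ψ).integrable_sq
      (((isTestOp_pd j).mul_left hw).memLp hφc ψ).integrable_sq fun x => ?_
    simp only [mul_pow]
    exact le_mul_of_one_le_left (sq_nonneg _) (one_le_wgt_sq φ x)
  obtain ⟨R, hR, -⟩ := exists_extension hφ isTestOp_id fun ψ => (toolbox_toL2 h8 hCC hφ hC ψ).1
  choose H hH _ using fun i j => exists_extension hφ (isTestOp_pd_pd i j) fun ψ => (bS ψ).1 i j
  choose G hG _ using fun j => exists_extension hφ (isTestOp_pd j) fun ψ => bG j ψ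
  choose W hW _ using fun j => exists_extension hφ ((isTestOp_pd j).mul_left hw)
    fun ψ => (bS ψ).2.1 j
  obtain ⟨Q, hQ, -⟩ := exists_extension hφ (isTestOp_id.mul_left (hw.pow 2))
    fun ψ => (bS ψ).2.2
  -- The whole sum is passed to the limit as one closed condition; adding the separate bounds would
  -- multiply the constant by the number of terms.
  have hsum : ∀ f, (∑ i, ∑ j, ‖H i j f‖ ^ 2) + (∑ j, ‖W j f‖ ^ 2) + ‖Q f‖ ^ 2 ≤
      196 * C' ^ 2 * ‖f‖ ^ 2 := by
    intro f
    refine (denseRange_diffOp hφ).induction_on (p := fun f => (∑ i, ∑ j, ‖H i j f‖ ^ 2) +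
      (∑ j, ‖W j f‖ ^ 2) + ‖Q f‖ ^ 2 ≤ 196 * C' ^ 2 * ‖f‖ ^ 2) f ?_ fun ψ => ?_
    · exact isClosed_le (by fun_prop) (by fun_prop)
    · simp only [hH, hW, hQ]
      exact (toolbox_toL2 h8 hCC hφ hC ψ).2
  refine ⟨R, hR, fun f => ⟨fun j => G j f, fun i j => H i j f, ⟨fun j => ?_, fun i j => ?_⟩, ?_⟩⟩
  · exact hasWeakPartial_of_extension hφ isTestOp_id (isTestOp_pd j) (fun _ h => h)
      (fun _ => rfl) hR (hG j) f
  · exact hasWeakPartial_of_extension hφ (isTestOp_pd j) (isTestOp_pd_pd i j)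
      (fun _ h => h.pd j) (fun _ => rfl) (hG j) (hH i j) f
  · have e1 : ∀ i j, sqNorm φ (H i j f) = ENNReal.ofReal (‖H i j f‖ ^ 2) := fun i j =>
      sqNorm_eq (EventuallyEq.refl _ _)
    have e2 : ∀ j, sqNorm φ (fun x => wgt φ x * G j f x) = ENNReal.ofReal (‖W j f‖ ^ 2) :=
      fun j => sqNorm_eq (ae_eq_mul_of_extension hφ (isTestOp_pd j) hw (hG j) (hW j) f)
    have e3 : sqNorm φ (fun x => wgt φ x ^ 2 * R f x) = ENNReal.ofReal (‖Q f‖ ^ 2) :=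
      sqNorm_eq (ae_eq_mul_of_extension hφ isTestOp_id (hw.pow 2) hR hQ f)
    have p1 : ∀ i, 0 ≤ ∑ j, ‖H i j f‖ ^ 2 := fun i => Finset.sum_nonneg fun j _ => sq_nonneg _
    have p2 : 0 ≤ ∑ j, ‖W j f‖ ^ 2 := Finset.sum_nonneg fun j _ => sq_nonneg _
    have p3 : 0 ≤ ∑ i, ∑ j, ‖H i j f‖ ^ 2 := Finset.sum_nonneg fun i _ => p1 i
    simp only [toolboxSq, e1, e2, e3]
    rw [Finset.sum_congr rfl fun i _ => (ENNReal.ofReal_sum_of_nonneg (s := Finset.univ)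
        (f := fun j => ‖H i j f‖ ^ 2) fun j _ => sq_nonneg _).symm,
      ← ENNReal.ofReal_sum_of_nonneg fun i _ => p1 i,
      ← ENNReal.ofReal_sum_of_nonneg fun j _ => sq_nonneg _, ← ENNReal.ofReal_add p3 p2,
      ← ENNReal.ofReal_add (add_nonneg p3 p2) (sq_nonneg _)]
    exact ENNReal.ofReal_le_ofReal (hsum f)

theorem abs_pd_le_wgt (φ : Sp d → ℝ) (i : Fin d) (x : Sp d) : |pd i φ x| ≤ wgt φ x := by
  refine abs_le_of_sq_le_sq ?_ (wgt_pos φ x).le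
  rw [wgt_sq]
  have := Finset.single_le_sum (f := fun i => pd i φ x ^ 2) (fun _ _ => sq_nonneg _)
    (Finset.mem_univ i)
  unfold gradSq
  linarith

/-- A function with weak derivatives in the weighted spaces belongs to the domain of `Λ`. -/
theorem IsResolvent.exists_eq_of_toolboxSq_lt_top {φ : Sp d → ℝ} {hφ : ContDiff ℝ 2 φ}
    {R : L2 φ →L[ℝ] L2 φ} (hR : IsResolvent hφ R) {f : L2 φ} {G : Fin d → Sp d → ℝ}
    {H : Fin d → Fin d → Sp d → ℝ} (hd : HasWeakDerivs f G H) (ht : toolboxSq φ f G H < ⊤) :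
    ∃ g, f = R g := by
  have hφc := hφ.continuous
  have hφ1 : ContDiff ℝ 1 φ := hφ.of_le (by norm_num)
  have hw := (contDiff_wgt hφ).continuous
  simp only [toolboxSq, ENNReal.add_lt_top, ENNReal.sum_lt_top, Finset.mem_univ, true_imp_iff] at ht
  have mH : ∀ i, MemLp (H i i) 2 (gibbs φ) := fun i => memLp_of_sqNorm_lt_top
    ((hd.2 i i).2.1.aestronglyMeasurable.mono_ac (gibbs_absolutelyContinuous φ)) (ht.1.1 i i)
  have aG : ∀ i, AEStronglyMeasurable (G i) (gibbs φ) := fun i =>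
    (hd.1 i).2.1.aestronglyMeasurable.mono_ac (gibbs_absolutelyContinuous φ)
  have mG : ∀ i, MemLp (fun x => pd i φ x * G i x) 2 (gibbs φ) := fun i =>
    (memLp_of_sqNorm_lt_top (hw.aestronglyMeasurable.mul (aG i)) (ht.1.2 i)).of_le
      ((continuous_pd hφ1 i).aestronglyMeasurable.mul (aG i)) (Eventually.of_forall fun x => by
        rw [Real.norm_eq_abs, Real.norm_eq_abs, abs_mul]
        change _ ≤ |wgt φ x * G i x|
        rw [abs_mul, abs_of_pos (wgt_pos φ x)]
        exact mul_le_mul_of_nonneg_right (abs_pd_le_wgt φ i x) (abs_nonneg _))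
  have mi : ∀ i, MemLp (fun x => -H i i x + pd i φ x * G i x) 2 (gibbs φ) := fun i =>
    (mH i).neg.add (mG i)
  -- The only candidate for `Λf`: the differential expression evaluated on the weak derivatives. It
  -- lies in `L²` because `|∂_iφ| ≤ ⌊∇φ⌉`.
  have mg : MemLp (fun x => (∑ i, (-H i i x + pd i φ x * G i x)) + f x) 2 (gibbs φ) :=
    (memLp_finsetSum _ fun i _ => mi i).add (Lp.memLp f)
  obtain ⟨g, hg⟩ : ∃ g : L2 φ, (g : Sp d → ℝ) =ᵐ[gibbs φ]
      fun x => (∑ i, (-H i i x + pd i φ x * G i x)) + f x := ⟨mg.toLp, mg.coeFn_toLp⟩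
  refine ⟨g, hR.eq_of_weak fun ψ => ?_⟩
  have hψ := ψ.2
  set η : Sp d → ℝ := ψ.1
  have hη : IsTest η := hψ
  have hη1 : ContDiff ℝ 1 η := hη.contDiff_of 1
  have e0 : ∫ x, g x * η x ∂(gibbs φ) =
      ∫ x, ((∑ i, (-H i i x + pd i φ x * G i x)) + f x) * η x ∂(gibbs φ) := by
    refine integral_congr_ae ?_
    filter_upwards [hg] with x hx
    rw [hx]
  have hE : ContDiff ℝ 1 fun x => Real.exp (-φ x) := hφ1.neg.exp
  have hl : LocallyIntegrable f volume := locallyIntegrable_of_memLp_gibbs hφc (Lp.memLp f)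
  have hG : ∀ i, LocallyIntegrable (G i) volume := fun i => (hd.1 i).2.1
  have hH : ∀ i, LocallyIntegrable (H i i) volume := fun i => (hd.2 i i).2.1
  have cb : HasCompactSupport fun x => Real.exp (-φ x) * η x := hη.2.mul_left
  have db : ContDiff ℝ 1 fun x => Real.exp (-φ x) * η x := hE.mul hη1
  -- Two integrations by parts, tested with `e^{-φ}∂_iη` and `e^{-φ}η`, which are not smooth; hence
  -- the use of `HasWeakPartial.integral_eq`.
  have term : ∀ i, ∫ x, Real.exp (-φ x) * (f x * (-pd i (pd i η) x + pd i φ x * pd i η x)) =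
      ∫ x, Real.exp (-φ x) * ((-H i i x + pd i φ x * G i x) * η x) := by
    intro i
    have hp1 : ContDiff ℝ 1 (pd i η) := (hη.pd i).contDiff_of 1
    have w1 := (hd.1 i).integral_eq (hE.mul hp1) (hη.pd i).2.mul_left
    have w2 := (hd.2 i i).integral_eq db cb
    simp only [pd_mul_of_contDiff hE hp1, pd_mul_of_contDiff hE hη1, pd_exp_neg hφ1] at w1 w2
    have i2 : Integrable (fun x => G i x * (pd i φ x * (Real.exp (-φ x) * η x))) volume :=
      integrable_mul_of_hasCompactSupport (hG i) ((continuous_pd hφ1 i).mul db.continuous)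
        cb.mul_left
    have i3 : Integrable (fun x => G i x * (Real.exp (-φ x) * pd i η x)) volume :=
      integrable_mul_of_hasCompactSupport (hG i) (hE.mul hp1).continuous (hη.pd i).2.mul_left
    have i4 : Integrable (fun x => H i i x * (Real.exp (-φ x) * η x)) volume :=
      integrable_mul_of_hasCompactSupport (hH i) db.continuous cb
    have w2' : (∫ x, G i x * (Real.exp (-φ x) * pd i η x)) -
        ∫ x, G i x * (pd i φ x * (Real.exp (-φ x) * η x)) =
          -∫ x, H i i x * (Real.exp (-φ x) * η x) := by
      rw [← integral_sub i3 i2, ← w2]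
      exact integral_congr_ae (Eventually.of_forall fun x => by ring)
    have e1 : ∫ x, Real.exp (-φ x) * (f x * (-pd i (pd i η) x + pd i φ x * pd i η x)) =
        ∫ x, G i x * (Real.exp (-φ x) * pd i η x) := by
      rw [← neg_neg (∫ x, G i x * _), ← w1, ← integral_neg]
      exact integral_congr_ae (Eventually.of_forall fun x => by ring)
    have e2 : ∫ x, Real.exp (-φ x) * ((-H i i x + pd i φ x * G i x) * η x) =
        (∫ x, G i x * (pd i φ x * (Real.exp (-φ x) * η x))) -
          ∫ x, H i i x * (Real.exp (-φ x) * η x) := by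
      rw [← integral_sub i2 i4]
      exact integral_congr_ae (Eventually.of_forall fun x => by ring)
    rw [e1, e2]
    linarith
  have j1 : ∀ i, Integrable (fun x => f x * (-pd i (pd i η) x + pd i φ x * pd i η x)) (gibbs φ) := by
    intro i
    refine (Lp.memLp f).integrable_mul (memLp_gibbs hφc
      (((hη.pd i).pd i).1.continuous.neg.add ((continuous_pd hφ1 i).mul (hη.pd i).1.continuous)) ?_)
    exact ((hη.pd i).pd i).2.neg.add (hη.pd i).2.mul_left
  have mη : MemLp η 2 (gibbs φ) := memLp_gibbs hφc hη.1.continuous hη.2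
  have j2 : Integrable (fun x => f x * η x) (gibbs φ) := (Lp.memLp f).integrable_mul mη
  have j3 : ∀ i, Integrable (fun x => (-H i i x + pd i φ x * G i x) * η x) (gibbs φ) := fun i =>
    (mi i).integrable_mul mη
  have e1 : ∫ x, f x * diffOp φ η x ∂(gibbs φ) =
      (∑ i, ∫ x, f x * (-pd i (pd i η) x + pd i φ x * pd i η x) ∂(gibbs φ)) +
        ∫ x, f x * η x ∂(gibbs φ) := by
    have hpt : ∀ x, f x * diffOp φ η x =
        (∑ i, f x * (-pd i (pd i η) x + pd i φ x * pd i η x)) + f x * η x := fun x => by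
      rw [diffOp_eq φ (hη.contDiff_of 2), mul_add, Finset.mul_sum]
    simp only [hpt]
    rw [integral_add (integrable_finsetSum _ fun i _ => j1 i) j2,
      integral_finsetSum _ fun i _ => j1 i]
  have e2 : ∫ x, ((∑ i, (-H i i x + pd i φ x * G i x)) + f x) * η x ∂(gibbs φ) =
      (∑ i, ∫ x, (-H i i x + pd i φ x * G i x) * η x ∂(gibbs φ)) +
        ∫ x, f x * η x ∂(gibbs φ) := by
    have hpt : ∀ x, ((∑ i, (-H i i x + pd i φ x * G i x)) + f x) * η x =
        (∑ i, (-H i i x + pd i φ x * G i x) * η x) + f x * η x := fun x => by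
      rw [add_mul, Finset.sum_mul]
    simp only [hpt]
    rw [integral_add (integrable_finsetSum _ fun i _ => j3 i) j2,
      integral_finsetSum _ fun i _ => j3 i]
  rw [e0, e1, e2]
  congr 1
  refine Finset.sum_congr rfl fun i _ => ?_
  rw [integral_gibbs hφc, integral_gibbs hφc]
  exact term i

/-! ### The dual estimate -/

/-- `∂ᵢ∂ⱼ` conjugated with `e^{-φ}`. -/
noncomputable def adjHess (φ : Sp d → ℝ) (i j : Fin d) (ψ : Sp d → ℝ) (x : Sp d) : ℝ :=
  pd i (pd j ψ) x + (-pd i φ x * pd j ψ x + (-pd j φ x * pd i ψ x +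
    (pd i φ x * pd j φ x - pd i (pd j φ) x) * ψ x))

/-- The formal adjoint of `⌊∇φ⌉∂ᵢ` in `L²(e^{-φ} dx)`. -/
noncomputable def adjGrad (φ : Sp d → ℝ) (i : Fin d) (ψ : Sp d → ℝ) (x : Sp d) : ℝ :=
  -wgt φ x * pd i ψ x + (wgt φ x * pd i φ x - pd i (wgt φ) x) * ψ x

theorem isTestOp_adjHess {φ : Sp d → ℝ} (hφ : ContDiff ℝ 2 φ) (i j : Fin d) :
    IsTestOp (adjHess φ i j) := by
  have h : ∀ k, ContDiff ℝ 1 (pd k φ) := contDiff_one_pd hφ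
  exact (isTestOp_pd_pd i j).add (((isTestOp_pd j).mul_left (h i).continuous.neg).add
    (((isTestOp_pd i).mul_left (h j).continuous.neg).add (isTestOp_id.mul_left
      (((h i).continuous.mul (h j).continuous).sub (continuous_pd (h j) i)))))

theorem isTestOp_adjGrad {φ : Sp d → ℝ} (hφ : ContDiff ℝ 2 φ) (i : Fin d) :
    IsTestOp (adjGrad φ i) := by
  have hw := contDiff_wgt hφ
  exact ((isTestOp_pd i).mul_left hw.continuous.neg).add (isTestOp_id.mul_left
    ((hw.continuous.mul (contDiff_one_pd hφ i).continuous).sub (continuous_pd hw i)))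

theorem pairHess_eq {φ : Sp d → ℝ} (hφ : ContDiff ℝ 2 φ) (i j : Fin d) (f : Sp d → ℝ)
    {ψ : Sp d → ℝ} (hψ : IsTest ψ) :
    pairHess φ i j f ψ = ∫ x, f x * adjHess φ i j ψ x ∂(gibbs φ) := by
  have hφ1 : ContDiff ℝ 1 φ := hφ.of_le one_le_two
  have hE : ContDiff ℝ 1 fun x => Real.exp (-φ x) := hφ1.neg.exp
  have hψ1 := hψ.contDiff_of 1
  have hp := contDiff_one_pd hφ j
  rw [integral_gibbs hφ.continuous, pairHess]
  refine integral_congr_ae (Eventually.of_forall fun x => ?_)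
  have e1 : pd j (fun y => ψ y * Real.exp (-φ y)) =
      fun y => Real.exp (-φ y) * (pd j ψ y - ψ y * pd j φ y) := funext fun y => by
    rw [pd_mul_of_contDiff hψ1 hE, pd_exp_neg hφ1]
    ring
  have hpψ : ContDiff ℝ 1 (pd j ψ) := (hψ.pd j).contDiff_of 1
  have hm : ContDiff ℝ 1 fun y => ψ y * pd j φ y := hψ1.mul hp
  simp only [e1]
  rw [pd_mul_of_contDiff hE (hpψ.sub hm), pd_exp_neg hφ1,
    pd_sub i ((hpψ.differentiable (by norm_num)) x) ((hm.differentiable (by norm_num)) x),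
    pd_mul_of_contDiff hψ1 hp, adjHess]
  ring

theorem pairGrad_eq {φ : Sp d → ℝ} (hφ : ContDiff ℝ 2 φ) (i : Fin d) (f : Sp d → ℝ)
    {ψ : Sp d → ℝ} (hψ : IsTest ψ) :
    pairGrad φ i f ψ = ∫ x, f x * adjGrad φ i ψ x ∂(gibbs φ) := by
  have hφ1 : ContDiff ℝ 1 φ := hφ.of_le one_le_two
  have hE : ContDiff ℝ 1 fun x => Real.exp (-φ x) := hφ1.neg.exp
  have hψ1 := hψ.contDiff_of 1
  have hw := contDiff_wgt hφ
  rw [integral_gibbs hφ.continuous, pairGrad, ← integral_neg]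
  refine integral_congr_ae (Eventually.of_forall fun x => ?_)
  simp only [pd_mul_of_contDiff (hw.mul hψ1) hE, pd_mul_of_contDiff hw hψ1, pd_exp_neg hφ1,
    adjGrad]
  ring

/-- With `A` extending `Λψ ↦ Sψ`, the dual object is `A*f`, since `(A*f, Λψ) = (f, Sψ) = T ψ`.
Uniqueness is the density of the range. -/
theorem exists_lamInvDist {φ : Sp d → ℝ} (hφ : ContDiff ℝ 2 φ) {S : (Sp d → ℝ) → Sp d → ℝ}
    (hS : IsTestOp S) {B : ℝ} (hB : 0 ≤ B)
    (h : ∀ ψ, ‖hS.toL2 hφ.continuous ψ‖ ^ 2 ≤ B * ‖opLam hφ ψ‖ ^ 2) (f : L2 φ)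
    {T : (Sp d → ℝ) → ℝ} (hT : ∀ ψ, IsTest ψ → T ψ = ∫ x, f x * S ψ x ∂(gibbs φ)) :
    ∃ a : L2 φ, (∀ g, IsLamInvDist φ T g ↔ g = a) ∧ ‖a‖ ^ 2 ≤ B * ‖f‖ ^ 2 := by
  obtain ⟨A, hA, hAB⟩ := exists_extension hφ hS h
  set a : L2 φ := ContinuousLinearMap.adjoint A f with ha
  have key : ∀ ψ : Test d, inner ℝ a (opLam hφ ψ) = T ψ.1 := fun ψ => by
    rw [ha, ContinuousLinearMap.adjoint_inner_left, hA, IsTestOp.inner_toL2, hT ψ.1 ψ.2]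
  refine ⟨a, fun g => ⟨fun hg => ?_, ?_⟩, ?_⟩
  · refine ext_inner_toL2 (denseRange_diffOp hφ) fun ψ => ?_
    refine Eq.trans ?_ (key ψ).symm
    rw [IsTestOp.inner_toL2]
    exact hg ψ.1 ψ.2
  · rintro rfl ψ hψ
    rw [← key ⟨ψ, hψ⟩, IsTestOp.inner_toL2]
  -- `‖A*f‖² = (f, AA*f)`; square, insert the bound on `A`, and cancel `‖a‖²`.
  · have h1 : ‖a‖ ^ 2 ≤ ‖f‖ * ‖A a‖ := by
      rw [← real_inner_self_eq_norm_sq]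
      nth_rewrite 1 [ha]
      rw [ContinuousLinearMap.adjoint_inner_left]
      exact real_inner_le_norm _ _
    have h2 := hAB a
    rcases (norm_nonneg a).eq_or_lt with h0 | h0
    · rw [← h0, zero_pow two_ne_zero]
      positivity
    · have h3 : ‖a‖ ^ 2 * ‖a‖ ^ 2 ≤ (B * ‖f‖ ^ 2) * ‖a‖ ^ 2 := by
        have h4 := mul_self_le_mul_self (sq_nonneg _) h1
        have h5 := mul_le_mul_of_nonneg_left h2 (sq_nonneg ‖f‖)
        linarith
      exact le_of_mul_le_mul_right h3 (by positivity)

/-- Each of the four toolbox terms is at most `196 C'²‖Λψ‖²`, and `4 · 196 = 784`. -/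
theorem norm_toL2_sq_le_of_pointwise {φ : Sp d → ℝ} {C C' : ℝ} (h8 : 8 < C) (hCC : C < C')
    (hφ : ContDiff ℝ 2 φ) (hC : HasConstants φ C C') {S : (Sp d → ℝ) → Sp d → ℝ}
    (hS : IsTestOp S) (i j : Fin d) {k : ℝ} (hk : 0 ≤ k)
    (h : ∀ ψ, IsTest ψ → ∀ x, S ψ x ^ 2 ≤ k * (pd i (pd j ψ) x ^ 2 + (wgt φ x * pd i ψ x) ^ 2 +
      (wgt φ x * pd j ψ x) ^ 2 + (wgt φ x ^ 2 * ψ x) ^ 2)) (ψ : Test d) :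
    ‖hS.toL2 hφ.continuous ψ‖ ^ 2 ≤ k * (784 * C' ^ 2) * ‖opLam hφ ψ‖ ^ 2 := by
  obtain ⟨h1, h2, h3⟩ := toolbox_toL2_single h8 hCC hφ hC ψ
  have hw := (contDiff_wgt hφ).continuous
  have hi : ∀ {S : (Sp d → ℝ) → Sp d → ℝ}, IsTestOp S →
      Integrable (fun x => S ψ x ^ 2) (gibbs φ) := fun hS => (hS.memLp hφ.continuous ψ).integrable_sq
  have i1 := hi (isTestOp_pd_pd i j)
  have i2 := fun j => hi ((isTestOp_pd j).mul_left hw)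
  have i3 := hi (isTestOp_id.mul_left (hw.pow 2))
  have h4 := integral_mono (hi hS) ((((i1.add (i2 i)).add (i2 j)).add i3).const_mul k)
    fun x => h ψ ψ.2 x
  simp only [Pi.add_apply] at h4
  rw [integral_const_mul, integral_add (by exact (i1.add (i2 i)).add (i2 j)) i3,
    integral_add (by exact i1.add (i2 i)) (i2 j), integral_add i1 (i2 i)] at h4
  have g1 := h1 i j
  have g2 := h2 i
  have g3 := h2 j
  simp only [IsTestOp.norm_toL2_sq (hφ.continuous) (isTestOp_pd_pd i j),
    IsTestOp.norm_toL2_sq (hφ.continuous) ((isTestOp_pd i).mul_left hw),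
    IsTestOp.norm_toL2_sq (hφ.continuous) ((isTestOp_pd j).mul_left hw),
    IsTestOp.norm_toL2_sq (hφ.continuous) (isTestOp_id.mul_left (hw.pow 2))] at g1 g2 g3 h3
  rw [hS.norm_toL2_sq]
  refine h4.trans ?_
  rw [mul_assoc]
  exact mul_le_mul_of_nonneg_left (by linarith) hk

theorem HasConstants.hessNorm_sq_le_mul_wgt {φ : Sp d → ℝ} {C C' : ℝ} (hC : HasConstants φ C C')
    (h8 : 8 < C) (hCC : C < C') (x : Sp d) : hessNorm φ x ^ 2 ≤ C' ^ 2 * (wgt φ x ^ 2) ^ 2 := by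
  have h := hC.hessNorm_sq_le h8 x
  have hg := gradSq_nonneg φ x
  have h1 : 1 ≤ C' ^ 2 := by nlinarith
  rw [wgt_sq]
  nlinarith [mul_nonneg (sub_nonneg.2 h1) (sq_nonneg (gradSq φ x)), mul_nonneg (sq_nonneg C') hg]

theorem sq_add_four_le (a b c e g : ℝ) :
    (a + (b + (c + (e + g)))) ^ 2 ≤ 5 * (a ^ 2 + b ^ 2 + c ^ 2 + e ^ 2 + g ^ 2) := by
  nlinarith [sq_nonneg (a - b), sq_nonneg (a - c), sq_nonneg (a - e), sq_nonneg (a - g),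
    sq_nonneg (b - c), sq_nonneg (b - e), sq_nonneg (b - g), sq_nonneg (c - e),
    sq_nonneg (c - g), sq_nonneg (e - g)]

theorem pd_sq_le_wgt_sq (φ : Sp d → ℝ) (i : Fin d) (x : Sp d) : pd i φ x ^ 2 ≤ wgt φ x ^ 2 :=
  sq_le_sq.2 ((abs_pd_le_wgt φ i x).trans (le_abs_self _))

/-- The adjoint has five terms, whence the factor 5. Each derivative moved onto `φ` costs one power
of `⌊∇φ⌉`, and two of them cost `⌊∇φ⌉²`, with an extra `C'` for the Hessian of `φ`. -/
theorem adjHess_sq_le {φ : Sp d → ℝ} {C C' : ℝ} (h8 : 8 < C) (hCC : C < C')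
    (hC : HasConstants φ C C') (i j : Fin d) (ψ : Sp d → ℝ) (x : Sp d) :
    adjHess φ i j ψ x ^ 2 ≤ 5 * (1 + C' ^ 2) * (pd i (pd j ψ) x ^ 2 + (wgt φ x * pd i ψ x) ^ 2 +
      (wgt φ x * pd j ψ x) ^ 2 + (wgt φ x ^ 2 * ψ x) ^ 2) := by
  have h1 := hC.hessNorm_sq_le_mul_wgt h8 hCC x
  have h2 : pd i (pd j φ) x ^ 2 ≤ hessNorm φ x ^ 2 := by
    rw [hessNorm_sq]
    exact (Finset.single_le_sum (f := fun j => pd i (pd j φ) x ^ 2) (fun _ _ => sq_nonneg _)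
      (Finset.mem_univ j)).trans (Finset.single_le_sum (f := fun i => ∑ j, pd i (pd j φ) x ^ 2)
        (fun _ _ => Finset.sum_nonneg fun _ _ => sq_nonneg _) (Finset.mem_univ i))
  have pi := pd_sq_le_wgt_sq φ i x
  have pj := pd_sq_le_wgt_sq φ j x
  have h3 := sq_add_four_le (pd i (pd j ψ) x) (-pd i φ x * pd j ψ x) (-pd j φ x * pd i ψ x)
    (pd i φ x * pd j φ x * ψ x) (-pd i (pd j φ) x * ψ x)
  have e : adjHess φ i j ψ x = pd i (pd j ψ) x + (-pd i φ x * pd j ψ x + (-pd j φ x * pd i ψ x +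
      (pd i φ x * pd j φ x * ψ x + -pd i (pd j φ) x * ψ x))) := by
    rw [adjHess]; ring
  rw [e]
  have k1 := mul_le_mul_of_nonneg_right pi (sq_nonneg (pd j ψ x))
  have k2 := mul_le_mul_of_nonneg_right pj (sq_nonneg (pd i ψ x))
  have k3 := mul_le_mul_of_nonneg_right (mul_le_mul pi pj (sq_nonneg _) (sq_nonneg _))
    (sq_nonneg (ψ x))
  have k4 := mul_le_mul_of_nonneg_right (h2.trans h1) (sq_nonneg (ψ x))
  have p1 := mul_nonneg (sq_nonneg C') (sq_nonneg (pd i (pd j ψ) x))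
  have p2 := mul_nonneg (sq_nonneg C') (sq_nonneg (wgt φ x * pd i ψ x))
  have p3 := mul_nonneg (sq_nonneg C') (sq_nonneg (wgt φ x * pd j ψ x))
  linarith

theorem adjGrad_sq_le {φ : Sp d → ℝ} {C C' : ℝ} (h8 : 8 < C) (hCC : C < C')
    (hφ : ContDiff ℝ 2 φ) (hC : HasConstants φ C C') (i : Fin d) (ψ : Sp d → ℝ) (x : Sp d) :
    adjGrad φ i ψ x ^ 2 ≤ 5 * (1 + C' ^ 2) * (pd i (pd i ψ) x ^ 2 + (wgt φ x * pd i ψ x) ^ 2 +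
      (wgt φ x * pd i ψ x) ^ 2 + (wgt φ x ^ 2 * ψ x) ^ 2) := by
  have h1 := (gradSq_wgt_le hφ x).trans (hC.hessNorm_sq_le_mul_wgt h8 hCC x)
  have h2 : pd i (wgt φ) x ^ 2 ≤ gradSq (wgt φ) x :=
    Finset.single_le_sum (f := fun i => pd i (wgt φ) x ^ 2) (fun _ _ => sq_nonneg _)
      (Finset.mem_univ i)
  -- Only three terms occur; padding with zeros lets the five-term inequality and the common
  -- constant be reused.
  have h3 := sq_add_four_le 0 0 (-wgt φ x * pd i ψ x) (wgt φ x * pd i φ x * ψ x)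
    (-pd i (wgt φ) x * ψ x)
  have e : adjGrad φ i ψ x = 0 + (0 + (-wgt φ x * pd i ψ x + (wgt φ x * pd i φ x * ψ x +
      -pd i (wgt φ) x * ψ x))) := by
    rw [adjGrad]; ring
  rw [e]
  have k3 := mul_le_mul_of_nonneg_right (mul_le_mul_of_nonneg_left (pd_sq_le_wgt_sq φ i x)
    (sq_nonneg (wgt φ x))) (sq_nonneg (ψ x))
  have k4 := mul_le_mul_of_nonneg_right (h2.trans h1) (sq_nonneg (ψ x))
  have p0 := sq_nonneg (pd i (pd i ψ) x)
  have p1 := mul_nonneg (sq_nonneg C') p0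
  have p2 := mul_nonneg (sq_nonneg C') (sq_nonneg (wgt φ x * pd i ψ x))
  have p3 := sq_nonneg (wgt φ x * pd i ψ x)
  linarith

/-- The bound is uniform over the `d² + d + 1` entries: Hessian, weighted gradient and weighted
function. -/
theorem dualEstimate {φ : Sp d → ℝ} {C C' : ℝ} (h8 : 8 < C) (hCC : C < C')
    (hφ : ContDiff ℝ 2 φ) (hC : HasConstants φ C C') :
    DualEstimate φ (((d : ℝ) ^ 2 + d + 1) * (5 * (1 + C' ^ 2) * (784 * C' ^ 2))) := by
  have hw := (contDiff_wgt hφ).continuous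
  have hk : 0 ≤ 5 * (1 + C' ^ 2) := by positivity
  have hB : 0 ≤ 5 * (1 + C' ^ 2) * (784 * C' ^ 2) := by positivity
  intro f
  choose a ha hab using fun i j => exists_lamInvDist hφ (isTestOp_adjHess hφ i j) hB
    (norm_toL2_sq_le_of_pointwise h8 hCC hφ hC _ i j hk fun ψ _ x =>
      adjHess_sq_le h8 hCC hC i j ψ x) f fun ψ hψ => pairHess_eq hφ i j f hψ
  choose b hb hbb using fun i => exists_lamInvDist hφ (isTestOp_adjGrad hφ i) hB
    (norm_toL2_sq_le_of_pointwise h8 hCC hφ hC _ i i hk fun ψ _ x =>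
      adjGrad_sq_le h8 hCC hφ hC i ψ x) f fun ψ hψ => pairGrad_eq hφ i f hψ
  obtain ⟨c, hc, hcb⟩ := exists_lamInvDist hφ (isTestOp_id.mul_left (hw.pow 2)) hB
    (fun ψ => (toolbox_toL2_single h8 hCC hφ hC ψ).2.2.trans
      (mul_le_mul_of_nonneg_right (by nlinarith [sq_nonneg C', sq_nonneg (C' ^ 2)])
        (sq_nonneg _))) f (T := pairWgt φ f) fun ψ hψ =>
      integral_congr_ae (Eventually.of_forall fun x => by
        change wgt φ x ^ 2 * f x * ψ x = f x * (wgt φ x ^ 2 * ψ x)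
        ring)
  refine ⟨a, b, c, ha, hb, hc, ?_⟩
  have s1 : ∑ i, ∑ j, ‖a i j‖ ^ 2 ≤
      ∑ _i : Fin d, ∑ _j : Fin d, 5 * (1 + C' ^ 2) * (784 * C' ^ 2) * ‖f‖ ^ 2 :=
    Finset.sum_le_sum fun i _ => Finset.sum_le_sum fun j _ => hab i j
  have s2 : ∑ i, ‖b i‖ ^ 2 ≤ ∑ _i : Fin d, 5 * (1 + C' ^ 2) * (784 * C' ^ 2) * ‖f‖ ^ 2 :=
    Finset.sum_le_sum fun i _ => hbb i
  simp only [Finset.sum_const, Finset.card_univ, Fintype.card_fin, nsmul_eq_mul] at s1 s2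
  linarith

/-! ### The structural constants -/

theorem IsRegular.exists_hasConstants {φ : Sp d → ℝ} (hd : 0 < d) (h : IsRegular φ) :
    ∃ C C' : ℝ, 8 < C ∧ C < C' ∧ HasConstants φ C C' := by
  have hs : 0 < Real.sqrt d := Real.sqrt_pos.2 (Nat.cast_pos.2 hd)
  -- The two inequalities are (H2) with `ε = 1/(4√d)` and then `ε = 1/(4√C)`; `C` must be fixed
  -- before the second choice. The maxima enforce `C > 8` and `C' > C`.
  obtain ⟨c₁, h₁⟩ := h.2 (4 * Real.sqrt d)⁻¹ (by positivity)
  set C := max 9 (4 * Real.sqrt d * c₁ + 1) with hCd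
  have hC9 : 9 ≤ C := le_max_left _ _
  have hC1 : 4 * Real.sqrt d * c₁ + 1 ≤ C := le_max_right _ _
  have hsC : 0 < Real.sqrt C := Real.sqrt_pos.2 (by linarith)
  obtain ⟨c₂, h₂⟩ := h.2 (4 * Real.sqrt C)⁻¹ (by positivity)
  set C' := max (C + 1) (4 * Real.sqrt C * c₂)
  have hC' : C + 1 ≤ C' := le_max_left _ _
  have hC2 : 4 * Real.sqrt C * c₂ ≤ C' := le_max_right _ _
  refine ⟨C, C', by linarith, by linarith, fun x => ⟨?_, ?_⟩⟩
  · have k := mul_le_mul_of_nonneg_left (h₁ x) (show 0 ≤ 4 * Real.sqrt d by positivity)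
    rw [mul_add, mul_inv_cancel_left₀ (by positivity)] at k
    linarith
  · have k := mul_le_mul_of_nonneg_left (h₂ x) (show 0 ≤ 4 * Real.sqrt C by positivity)
    rw [mul_add, mul_inv_cancel_left₀ (by positivity)] at k
    rw [inv_mul_eq_div, le_div_iff₀ hsC]
    linarith

theorem le_constB (d : ℕ) {C C' : ℝ} (hC : 1 ≤ C) : 196 * C' ^ 2 ≤ constB d C C' := by
  have hK : 0 ≤ constK C C' := by
    have : 0 ≤ C - 1 := by linarith
    unfold constK
    positivity
  have h1 : 0 ≤ 81 * C' ^ 2 / C := by positivity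
  unfold constB
  have h2 : 0 ≤ ((d : ℝ) + Real.sqrt ((d : ℝ) ^ 2 + 4 * d * constK C C')) / 2 := by positivity
  linarith

theorem ToolboxEstimate.mono {φ : Sp d → ℝ} {B B' : ℝ} (h : ToolboxEstimate φ B) (hB : B ≤ B') :
    ToolboxEstimate φ B' := fun f => by
  obtain ⟨G, H, h1, h2⟩ := h f
  exact ⟨G, H, h1, h2.trans (ENNReal.ofReal_le_ofReal
    (mul_le_mul_of_nonneg_right hB (sq_nonneg _)))⟩

theorem DualEstimate.mono {φ : Sp d → ℝ} {B B' : ℝ} (h : DualEstimate φ B) (hB : B ≤ B') :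
    DualEstimate φ B' := fun f => by
  obtain ⟨a, b, c, h1, h2, h3, h4⟩ := h f
  exact ⟨a, b, c, h1, h2, h3, h4.trans (mul_le_mul_of_nonneg_right hB (sq_nonneg _))⟩

theorem toolboxEstimate {φ : Sp d → ℝ} {C C' : ℝ} (h8 : 8 < C) (hCC : C < C')
    (hφ : ContDiff ℝ 2 φ) (hC : HasConstants φ C C') : ToolboxEstimate φ (196 * C' ^ 2) := by
  obtain ⟨R, hR, h⟩ := exists_resolvent h8 hCC hφ hC
  intro f
  rw [hR.lamInv_eq]
  exact h f

end WittenToolbox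

/-! ### Assembly of the two assertions -/

theorem mainTheorem6 (d : ℕ) (hd : 2 ≤ d) :
    (∀ φ : WittenToolbox.Sp d → ℝ,
      WittenToolbox.IsCentredProb φ → WittenToolbox.IsRegular φ →
        IsSelfAdjoint (WittenToolbox.Lam φ) ∧
        Function.Bijective
          (fun u : (WittenToolbox.Lam φ).domain => WittenToolbox.Lam φ u) ∧
        (∀ f : WittenToolbox.L2 φ,
          f ∈ (WittenToolbox.Lam φ).domain ↔
            ∃ G H, WittenToolbox.HasWeakDerivs f G H ∧
              WittenToolbox.toolboxSq φ f G H < ⊤) ∧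
        ∃ C C' : ℝ, 8 < C ∧ C < C' ∧ WittenToolbox.HasConstants φ C C') ∧
    (∀ C C' : ℝ, 8 < C → C < C' →
      ∃ B : ℝ, 0 < B ∧
        ∀ φ : WittenToolbox.Sp d → ℝ,
          WittenToolbox.IsCentredProb φ → WittenToolbox.IsRegular φ →
          WittenToolbox.HasConstants φ C C' →
            WittenToolbox.ToolboxEstimate φ (WittenToolbox.constB d C C') ∧
            WittenToolbox.ToolboxEstimate φ B ∧
            WittenToolbox.DualEstimate φ B) := by
  refine ⟨fun φ _ hreg => ?_, fun C C' h8 hCC => ?_⟩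
  · obtain ⟨C, C', h8, hCC, hC⟩ := hreg.exists_hasConstants (by omega)
    obtain ⟨R, hR, hb⟩ := WittenToolbox.exists_resolvent h8 hCC hreg.1 hC
    refine ⟨hR.isSelfAdjoint, hR.bijective, fun f => ?_, C, C', h8, hCC, hC⟩
    rw [hR.mem_domain_iff]
    constructor
    · rintro ⟨g, rfl⟩
      obtain ⟨G, H, h1, h2⟩ := hb g
      exact ⟨G, H, h1, h2.trans_lt ENNReal.ofReal_lt_top⟩
    · rintro ⟨G, H, h1, h2⟩
      exact hR.exists_eq_of_toolboxSq_lt_top h1 h2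
  · have h0 : 0 < C' ^ 2 := by
      have : 0 < C' := by linarith
      positivity
    have h1 := WittenToolbox.le_constB d (C := C) (C' := C') (by linarith)
    have h2 : 0 ≤ ((d : ℝ) ^ 2 + d + 1) * (5 * (1 + C' ^ 2) * (784 * C' ^ 2)) := by positivity
    -- The sum of the dual constant and `constB` dominates both, so one `B` serves (a) and (b).
    refine ⟨((d : ℝ) ^ 2 + d + 1) * (5 * (1 + C' ^ 2) * (784 * C' ^ 2)) +
      WittenToolbox.constB d C C', by linarith, fun φ _ hreg hC => ?_⟩
    have h3 := WittenToolbox.toolboxEstimate h8 hCC hreg.1 hC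
    exact ⟨h3.mono h1, h3.mono (by linarith),
      (WittenToolbox.dualEstimate h8 hCC hreg.1 hC).mono (by linarith)⟩
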